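/- **Setting.** Let $\mathcal K=\mathbb C^2$, $H=\mathrm{diag}(e,e)$ with $e\in\mathbb R$, let $G$ be a selfadjoint operator on $\mathcal K$ and let $\mathcal C$ be complex conjugation of coordinates in the canonical basis of $\mathbb C^2$. Let $\mathcal F_+$ be the symmetric Fock space over $L^2(\mathbb R^3,d^3k)$ with vacuum $\Omega$, creation and annihilation operators $a^*(f)=\int f(k)a^*(k)\,d^3k$, $a(f)=\int\overline{f(k)}a(k)\,d^3k$, $[a(k),a^*(l)]=\delta(k-l)$, and put $\omega(k)=|k|$, $\rho(k)=(e^{\beta|k|}-1)^{-1}$ for $\beta>0$. On $\mathcal H=\mathcal K\otimes\mathcal K\otimes\mathcal F_+\otimes\mathcal F_+$ let $$L_0=L_S+L_R,\quad L_S=H\otimes 1-1\otimes H,\quad L_R=d\Gamma(\omega)\otimes 1-1\otimes d\Gamma(\omega),\quad \Phi_\beta=\Omega\otimes\Omega ,$$ $$V=G\otimes 1\otimes\phi_\beta(g),\qquad \phi_\beta(g)=\tfrac1{\sqrt2}\big(a_\beta^*(g)+a_\beta(g)\big),\qquad a_\beta^*(g)=a^*(\sqrt{1+\rho}\,g)\otimes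 1+1\otimes a(\sqrt{\rho}\,\overline g),$$ with $a_\beta(g)$ the adjoint of $a_\beta^*(g)$, and $I=V-JVJ$, where $J$ is the antiunitary operator $J(\varphi\otimes\psi\otimes f\otimes h)=\mathcal C\psi\otimes\mathcal C\varphi\otimes\overline h\otimes\overline f$. Let $P_0=\chi_{L_S=0}\otimes|\Phi_\beta\rangle\langle\Phi_\beta|$, $\overline P_0=1-P_0$, let $\overline L_0$ be the restriction of $\overline P_0L_0\overline P_0$ to $\mathrm{Ran}\,\overline P_0$, and for real $\epsilon\ne0$ $$\Lambda_0(\epsilon)=P_0I\overline P_0(\overline L_0-i\epsilon)^{-1}\overline P_0IP_0 ,$$ viewed as an operator on $\mathrm{Ran}\,\chi_{L_S=0}\subset\mathbb C^2\otimes\mathbb C^2$ through $v\otimes\Phi_\beta\leftrightarrow v$. The level shift operator $\Lambda_0$ is the weak limit of $\Lambda_0(\epsilon)$ as $\epsilon\downarrow0$; it is said to exist if this limit exists. Let $g\in L^2(\mathbb R^3,d^3k)$ have compact support, be continuous except possibly at $k=0$, and satisfy $\lim_{|k|\to0}|g(k)|/|k|^p=\gamma$ for some $p>-1$ and $\gamma\ge0$.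 Set $$\xi=\tfrac12\|g/\sqrt\omega\|^2,\qquad \eta=\frac{2\pi^2\gamma^2}{\beta}.$$ **Theorem.** We have $\dim P_0=4$, the operators $\Lambda_0(\epsilon)$, $\epsilon\neq 0$, are everywhere defined, and: 1. If $-1<p<-1/2$, $\gamma>0$, and $G$ is not a multiple of the identity, then $\Lambda_0$ does not exist. 2. If $p=-1/2$ then $\Lambda_0$ exists and $$\Lambda_0=(\xi+i\eta)\,G^2\otimes 1-(\xi-i\eta)\,1\otimes\mathcal CG^2\mathcal C-2i\eta\,G\otimes\mathcal CG\mathcal C .$$ 3. If $p>-1/2$ then $\Lambda_0$ exists and is given by the same formula with $\eta=0$. -/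

import Mathlib

open MeasureTheory Filter Topology
open scoped ENNReal ComplexConjugate Kronecker InnerProductSpace

noncomputable section

namespace LevelShift

/-! ### Natural composition of partially defined (semi)linear operators -/

/-- The product `g f` of two unbounded operators on its natural domain
`{x ∈ D(f) | f x ∈ D(g)}`. -/
def pcomp {E F G : Type*} [AddCommGroup E] [Module ℂ E] [AddCommGroup F] [Module ℂ F]
    [AddCommGroup G] [Module ℂ G] {σ τ ρ : ℂ →+* ℂ} [RingHomCompTriple σ τ ρ]
    (g : F →ₛₗ.[τ] G) (f : E →ₛₗ.[σ] F) : E →ₛₗ.[ρ] G :=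
  g.comp (f.domRestrict ((g.domain.comap f.toFun).map f.domain.subtype)) (by
    rintro ⟨x, ⟨⟨y, hy⟩, hyg, rfl⟩, hx⟩
    exact hyg)

/-! ### Configuration space and the Hilbert space -/

/-- Momentum space `ℝ³`. -/
abbrev R3 := EuclideanSpace ℝ (Fin 3)

/-- Configurations of finitely many bosons: the disjoint union of the spaces `(ℝ³)ⁿ`, `n ≥ 0`. -/
abbrev Conf := Σ n : ℕ, (Fin n → R3)

/-- Lebesgue measure on each `(ℝ³)ⁿ`; so `L²(Conf) = ⨁ₙ L²(ℝ³ⁿ)`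
(and the `0`-particle configuration has mass one). -/
def confVol : Measure Conf :=
  Measure.sum fun n => (volume : Measure (Fin n → R3)).map fun x => (⟨n, x⟩ : Conf)

instance : SFinite confVol := by
  unfold confVol; infer_instance

/-- `𝒦 ⊗ 𝒦` for `𝒦 = ℂ^ι`; the coordinate `(i, j)` belongs to the basis vector `φ_i ⊗ φ_j`. -/
abbrev KK (ι : Type) [Fintype ι] := EuclideanSpace ℂ (ι × ι)

/-- Square integrable functions of two configurations with values in `𝒦 ⊗ 𝒦`. -/
abbrev FullSpace (ι : Type) [Fintype ι] := Lp (KK ι) 2 (confVol.prod confVol)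

/-- Relabel the particles of a configuration, in the `n`-particle sector by `σ n`. -/
def permConf (σ : ∀ n, Equiv.Perm (Fin n)) (x : Conf) : Conf := ⟨x.1, x.2 ∘ σ x.1⟩

lemma measurable_sigmaMk (n : ℕ) : Measurable (fun x : Fin n → R3 => (⟨n, x⟩ : Conf)) := by
  intro s hs
  exact MeasurableSpace.measurableSet_iInf.1 hs n

lemma measurable_conf {X : Type*} [MeasurableSpace X] {f : Conf → X}
    (h : ∀ n, Measurable fun x : Fin n → R3 => f ⟨n, x⟩) : Measurable f := by
  intro s hs
  exact MeasurableSpace.measurableSet_iInf.2 fun n => h n hs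

lemma measurableEmbedding_sigmaMk (n : ℕ) :
    MeasurableEmbedding (fun x : Fin n → R3 => (⟨n, x⟩ : Conf)) where
  injective := fun x y h => sigma_mk_injective (β := fun n : ℕ => Fin n → R3) h
  measurable := measurable_sigmaMk n
  measurableSet_image' := by
    intro s hs
    refine MeasurableSpace.measurableSet_iInf.2 fun m => ?_
    change MeasurableSet ((fun x : Fin m → R3 => (⟨m, x⟩ : Conf)) ⁻¹' ((fun x : Fin n → R3 => (⟨n, x⟩ : Conf)) '' s))
    by_cases h : m = n
    · subst h
      rwa [Set.preimage_image_eq _ fun x y h => sigma_mk_injective (β := fun n : ℕ => Fin n → R3) h]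
    · convert MeasurableSet.empty
      ext x
      simp only [Set.mem_preimage, Set.mem_image, Set.mem_empty_iff_false, iff_false, not_exists,
        not_and]
      intro y _ hy
      exact h (congrArg Sigma.fst hy).symm

lemma measurePreserving_permConf (σ : ∀ n, Equiv.Perm (Fin n)) :
    MeasurePreserving (permConf σ) confVol confVol := by
  have hm : Measurable (permConf σ) := measurable_conf fun n => by
    refine (measurable_sigmaMk n).comp ?_
    exact measurable_pi_lambda _ fun i => measurable_pi_apply (σ n i)
  refine ⟨hm, ?_⟩
  unfold confVol
  rw [Measure.map_sum hm.aemeasurable]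
  congr 1
  funext n
  rw [Measure.map_map hm (measurable_sigmaMk n)]
  have h1 : permConf σ ∘ (fun x : Fin n → R3 => (⟨n, x⟩ : Conf)) =
      (fun x : Fin n → R3 => (⟨n, x⟩ : Conf)) ∘ (MeasurableEquiv.piCongrLeft (fun _ : Fin n => R3) (σ n).symm) := by
    funext x
    simp only [Function.comp_apply, permConf]
    congr 1
    funext i
    have := Equiv.piCongrLeft_apply_apply (fun _ : Fin n => R3) (σ n).symm x (σ n i)
    simp only [Equiv.symm_apply_apply] at this
    simp [MeasurableEquiv.coe_piCongrLeft, this]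
  rw [h1, ← Measure.map_map (measurable_sigmaMk n) (MeasurableEquiv.measurable _),
    (volume_measurePreserving_piCongrLeft (fun _ : Fin n => R3) (σ n).symm).map_eq]

/-- Exchange of the labels in both groups of particles. -/
def permPair (σ τ : ∀ n, Equiv.Perm (Fin n)) : Conf × Conf → Conf × Conf :=
  Prod.map (permConf σ) (permConf τ)

lemma measurePreserving_permPair (σ τ : ∀ n, Equiv.Perm (Fin n)) :
    MeasurePreserving (permPair σ τ) (confVol.prod confVol) (confVol.prod confVol) :=
  (measurePreserving_permConf σ).prod (measurePreserving_permConf τ)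

/-- The functions that are symmetric in the particles of the first group and in those of the
second one. -/
def bosonic (ι : Type) [Fintype ι] : Submodule ℂ (FullSpace ι) where
  carrier := {ψ | ∀ σ τ, (fun z => ψ (permPair σ τ z)) =ᵐ[confVol.prod confVol] ψ}
  zero_mem' := by
    intro σ τ
    have h := Lp.coeFn_zero (KK ι) 2 (confVol.prod confVol)
    have h' := (measurePreserving_permPair σ τ).quasiMeasurePreserving.ae h
    filter_upwards [h, h'] with z hz hz'
    rw [hz, hz']; rfl
  add_mem' := by
    intro a b ha hb σ τ
    have h := Lp.coeFn_add a b
    have h' := (measurePreserving_permPair σ τ).quasiMeasurePreserving.ae h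
    filter_upwards [h, h', ha σ τ, hb σ τ] with z hz hz' h1 h2
    rw [hz, hz']
    simp only [Pi.add_apply, h1, h2]
  smul_mem' := by
    intro c a ha σ τ
    have h := Lp.coeFn_smul c a
    have h' := (measurePreserving_permPair σ τ).quasiMeasurePreserving.ae h
    filter_upwards [h, h', ha σ τ] with z hz hz' h1
    rw [hz, hz']
    simp only [Pi.smul_apply, h1]

/-- The Hilbert space `𝒦 ⊗ 𝒦 ⊗ 𝓕₊ ⊗ 𝓕₊`, where `𝓕₊` is the symmetric Fock space over
`L²(ℝ³)`: symmetric `L²` functions `ψ(x, y) ∈ 𝒦 ⊗ 𝒦`, where `x` is the configuration belonging to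
the first Fock factor and `y` the one belonging to the second. -/
abbrev Hil (ι : Type) [Fintype ι] := ↥(bosonic ι)

section
variable {ι : Type} [Fintype ι]

/-- The value of (a representative of) `ψ`. -/
def val (ψ : Hil ι) (x y : Conf) : KK ι := (ψ : FullSpace ι) (x, y)

lemma isClosed_bosonic : IsClosed (bosonic ι : Set (FullSpace ι)) := by
  have : (bosonic ι : Set (FullSpace ι)) = ⋂ σ, ⋂ τ, {ψ : FullSpace ι |
      Lp.compMeasurePreserving (permPair σ τ) (measurePreserving_permPair σ τ) ψ = ψ} := by
    ext ψ
    simp only [Set.mem_iInter, Set.mem_ofPred_eq]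
    refine forall₂_congr fun σ τ => ?_
    have h := Lp.coeFn_compMeasurePreserving ψ (measurePreserving_permPair σ τ)
    constructor
    · intro h1; exact Lp.ext (h.trans h1)
    · intro h1; rw [h1] at h; exact h.symm
  rw [this]
  refine isClosed_iInter fun σ => isClosed_iInter fun τ => isClosed_eq ?_ continuous_id
  exact (Lp.isometry_compMeasurePreserving (measurePreserving_permPair σ τ)).continuous

instance : CompleteSpace (Hil ι) := isClosed_bosonic.completeSpace_coe

/-! ### Bounded operators -/

/-- `A ⊗ 𝟙 ⊗ 𝟙` for a bounded (possibly antilinear) operator `A` on `𝒦 ⊗ 𝒦`: apply `A` to the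
values. -/
def smallOp {σ : ℂ →+* ℂ} [RingHomIsometric σ] (A : KK ι →SL[σ] KK ι) : Hil ι →SL[σ] Hil ι :=
  ((A.compLpL 2 (confVol.prod confVol)).comp (bosonic ι).subtypeL).codRestrict (bosonic ι) (by
    intro ψ s t
    have h := A.coeFn_compLp (ψ : FullSpace ι)
    have h' := (measurePreserving_permPair s t).quasiMeasurePreserving.ae h
    filter_upwards [h, h', ψ.2 s t] with z hz hz' h1
    exact (hz'.trans (congrArg A h1)).trans hz.symm)

/-- The unitary exchange of the two Fock factors, `(S ψ)(x, y) = ψ(y, x)`. -/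
def swapFock : Hil ι →L[ℂ] Hil ι :=
  ((Lp.compMeasurePreservingₗᵢ ℂ (E := KK ι) (p := 2) Prod.swap
    (Measure.measurePreserving_swap (μ := confVol) (ν := confVol))).toContinuousLinearMap.comp
      (bosonic ι).subtypeL).codRestrict (bosonic ι) (by
    intro ψ s t
    have h := Lp.coeFn_compMeasurePreserving (ψ : FullSpace ι)
      (Measure.measurePreserving_swap (μ := confVol) (ν := confVol))
    have h' := (measurePreserving_permPair s t).quasiMeasurePreserving.ae h
    have h'' := (Measure.measurePreserving_swap (μ := confVol)
      (ν := confVol)).quasiMeasurePreserving.ae (ψ.2 t s)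
    filter_upwards [h, h', h''] with z hz hz' h1
    exact (hz'.trans h1).trans hz.symm)

/-- `J_S (φ_i ⊗ φ_j) = φ_j ⊗ φ_i`, antilinearly extended. -/
def JS : KK ι →L⋆[ℂ] KK ι where
  toFun v := WithLp.toLp 2 fun q => conj (v (q.2, q.1))
  map_add' u v := by ext q; simp
  map_smul' c v := by ext q; simp
  cont := by fun_prop

/-- The modular conjugation `J = J_S ⊗ J_R`; here `J_R (f ⊗ h) = h̄ ⊗ f̄` on `𝓕₊ ⊗ 𝓕₊`, so that
`(J ψ)_{ij}(x, y) = conj (ψ_{ji}(y, x))`. -/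
def J : Hil ι →L⋆[ℂ] Hil ι := (smallOp JS).comp swapFock

/-- The vacuum configurations (no particle in either Fock factor). -/
def vacSet : Set (Conf × Conf) := {z | z.1.1 = 0 ∧ z.2.1 = 0}

lemma measurableSet_sector (n : ℕ) : MeasurableSet {x : Conf | x.1 = n} := by
  have : Measurable (fun x : Conf => x.1) := measurable_conf fun n => measurable_const
  exact this (measurableSet_singleton n)

lemma measurableSet_vacSet : MeasurableSet vacSet :=
  (measurableSet_sector 0).prod (measurableSet_sector 0)

lemma confVol_zero : confVol {x : Conf | x.1 = 0} = 1 := by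
  unfold confVol
  rw [Measure.sum_apply _ (measurableSet_sector 0), tsum_eq_single 0]
  · rw [Measure.map_apply (measurable_sigmaMk 0) (measurableSet_sector 0),
      Measure.volume_pi_eq_dirac 0]
    simp
  · intro n hn
    rw [Measure.map_apply (measurable_sigmaMk n) (measurableSet_sector 0)]
    simp [hn]

lemma volume_vacSet : (confVol.prod confVol) vacSet = 1 := by
  have : vacSet = {x : Conf | x.1 = 0} ×ˢ {x : Conf | x.1 = 0} := rfl
  rw [this, Measure.prod_prod, confVol_zero, one_mul]

/-- The vector `v ⊗ Φ_β = v ⊗ Ω ⊗ Ω`. -/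
def vac : KK ι →ₗ[ℂ] Hil ι where
  toFun v := ⟨indicatorConstLp 2 measurableSet_vacSet (by simp [volume_vacSet]) v, by
    intro s t
    have h := indicatorConstLp_coeFn (p := 2) (μ := confVol.prod confVol)
      (hs := measurableSet_vacSet) (hμs := by simp [volume_vacSet]) (c := v)
    have h' := (measurePreserving_permPair s t).quasiMeasurePreserving.ae h
    filter_upwards [h, h'] with z hz hz'
    rw [hz, hz']
    rfl⟩
  map_add' u v := Subtype.ext (indicatorConstLp_add (hs := measurableSet_vacSet)
    (hμs := by simp [volume_vacSet])).symm
  map_smul' c v := by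
    refine Subtype.ext (Lp.ext ?_)
    have hv : ∀ v : KK ι, _ := fun v => indicatorConstLp_coeFn (p := 2)
      (μ := confVol.prod confVol) (hs := measurableSet_vacSet) (hμs := by simp [volume_vacSet])
      (c := v)
    have h2 := Lp.coeFn_smul c (indicatorConstLp 2 (μ := confVol.prod confVol)
      measurableSet_vacSet (by simp [volume_vacSet]) v)
    filter_upwards [hv (c • v), hv v, h2] with z h1 h3 h4
    refine h1.trans (Eq.trans ?_ h4.symm)
    rw [Pi.smul_apply, h3]
    by_cases hz : z ∈ vacSet <;> simp [hz]

/-! ### Creation and annihilation operators -/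

/-- `(a*(f) φ)(k₁, …, kₙ) = n^{-1/2} ∑ⱼ f(kⱼ) φ(k₁, …, k̂ⱼ, …, kₙ)`. -/
def creation (f : R3 → ℂ) (φ : Conf → KK ι) : Conf → KK ι
  | ⟨0, _⟩ => 0
  | ⟨n + 1, x⟩ => ((√((n : ℝ) + 1) : ℝ) : ℂ)⁻¹ • ∑ j, f (x j) • φ ⟨n, j.removeNth x⟩

/-- The integrand in the definition of the annihilation operator. -/
def annIntegrand (f : R3 → ℂ) (φ : Conf → KK ι) (x : Conf) (k : R3) : KK ι :=
  conj (f k) • φ ⟨x.1 + 1, Fin.cons k x.2⟩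

/-- `(a(f) φ)(k₁, …, kₙ) = (n + 1)^{1/2} ∫ conj f(k) φ(k, k₁, …, kₙ) dk`. -/
def annihilation (f : R3 → ℂ) (φ : Conf → KK ι) (x : Conf) : KK ι :=
  ((√((x.1 : ℝ) + 1) : ℝ) : ℂ) • ∫ k, annIntegrand f φ x k

lemma creation_add (f : R3 → ℂ) (φ ψ : Conf → KK ι) (x : Conf) :
    creation f (fun y => φ y + ψ y) x = creation f φ x + creation f ψ x := by
  obtain ⟨n, x⟩ := x
  cases n with
  | zero => simp [creation]
  | succ n => simp only [creation, smul_add, Finset.sum_add_distrib]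

lemma creation_smul (f : R3 → ℂ) (c : ℂ) (φ : Conf → KK ι) (x : Conf) :
    creation f (fun y => c • φ y) x = c • creation f φ x := by
  obtain ⟨n, x⟩ := x
  cases n with
  | zero => simp [creation]
  | succ n =>
    simp only [creation, Finset.smul_sum]
    refine Finset.sum_congr rfl fun j _ => ?_
    rw [smul_comm (f (x j)) c, smul_comm _ c]

lemma ae_sector {P : Conf × Conf → Prop} :
    (∀ᵐ z ∂confVol.prod confVol, P z) ↔
      ∀ n, ∀ᵐ w ∂(volume : Measure (Fin n → R3)).prod confVol, P (⟨n, w.1⟩, w.2) := by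
  have h : confVol.prod confVol = Measure.sum fun n =>
      ((volume : Measure (Fin n → R3)).prod confVol).map
        (Prod.map (fun x => (⟨n, x⟩ : Conf)) id) := by
    conv_lhs => enter [1]; unfold confVol
    rw [Measure.prod_sum_left]
    congr 1
    funext n
    rw [← Measure.map_prod_map _ _ (measurable_sigmaMk n) measurable_id, Measure.map_id]
  rw [h, Measure.ae_sum_iff]
  refine forall_congr' fun n => ?_
  rw [((measurableEmbedding_sigmaMk n).prodMap MeasurableEmbedding.id).ae_map_iff]
  rfl

/-- An a.e. equality of two functions passes to their creation expressions. -/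
lemma ae_creation {φ ψ : Conf × Conf → KK ι} (f : R3 → ℂ)
    (h : ∀ᵐ z ∂confVol.prod confVol, φ z = ψ z) :
    ∀ᵐ z ∂confVol.prod confVol,
      creation f (fun x => φ (x, z.2)) z.1 = creation f (fun x => ψ (x, z.2)) z.1 := by
  rw [ae_sector] at h ⊢
  intro n
  cases n with
  | zero => simp [creation]
  | succ n =>
    have key : ∀ j : Fin (n + 1), ∀ᵐ w ∂(volume : Measure (Fin (n + 1) → R3)).prod confVol,
        φ (⟨n, j.removeNth w.1⟩, w.2) = ψ (⟨n, j.removeNth w.1⟩, w.2) := by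
      intro j
      have h1 : Measure.QuasiMeasurePreserving (fun x : Fin (n + 1) → R3 => j.removeNth x)
          volume volume :=
        Measure.quasiMeasurePreserving_snd.comp
          (volume_preserving_piFinSuccAbove (fun _ : Fin (n + 1) => R3) j).quasiMeasurePreserving
      exact (QuasiMeasurePreserving.prodMap h1 (Measure.QuasiMeasurePreserving.id confVol)).ae (h n)
    filter_upwards [ae_all_iff.2 key] with w hw
    simp only [creation, hw]

/-- An a.e. equality of two functions passes to their annihilation integrands. -/
lemma ae_annIntegrand {φ ψ : Conf × Conf → KK ι} (f : R3 → ℂ)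
    (h : ∀ᵐ z ∂confVol.prod confVol, φ z = ψ z) :
    ∀ᵐ z ∂confVol.prod confVol,
      annIntegrand f (fun x => φ (x, z.2)) z.1 =ᵐ[volume]
        annIntegrand f (fun x => ψ (x, z.2)) z.1 := by
  rw [ae_sector] at h ⊢
  intro n
  have h1 : MeasurePreserving (fun q : R3 × (Fin n → R3) => (Fin.cons q.1 q.2 : Fin (n + 1) → R3))
      (volume.prod volume) volume := by
    have := (volume_preserving_piFinSuccAbove (fun _ : Fin (n + 1) => R3) 0).symm
    have e : (fun q : R3 × (Fin n → R3) => (Fin.cons q.1 q.2 : Fin (n + 1) → R3)) =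
        (MeasurableEquiv.piFinSuccAbove (fun _ : Fin (n + 1) => R3) 0).symm := by
      funext q
      exact (Fin.insertNth_zero' (β := R3) q.1 q.2).symm
    rw [e]
    exact this
  have h2 : MeasurePreserving (fun q : ((Fin n → R3) × Conf) × R3 => ((q.2, q.1.1), q.1.2))
      ((volume.prod confVol).prod volume) ((volume.prod volume).prod confVol) :=
    (measurePreserving_prodAssoc volume volume confVol).symm.comp Measure.measurePreserving_swap
  have h3 := (h1.prod (MeasurePreserving.id confVol)).comp h2
  have h4 := Measure.ae_ae_of_ae_prod (h3.quasiMeasurePreserving.ae (h (n + 1)))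
  filter_upwards [h4] with w hw
  filter_upwards [hw] with k hk
  simpa [annIntegrand] using congrArg (fun v => conj (f k) • v) hk

/-- The graph of `a*(f)`, acting on the first Fock factor. -/
def creGraph (f : R3 → ℂ) : Submodule ℂ (Hil ι × Hil ι) where
  carrier := {p | ∀ᵐ z ∂confVol.prod confVol,
    val p.2 z.1 z.2 = creation f (fun x => val p.1 x z.2) z.1}
  zero_mem' := by
    have h := Lp.coeFn_zero (KK ι) 2 (confVol.prod confVol)
    filter_upwards [h, ae_creation f h] with z hz hz'
    have e0 := creation_smul f 0 (fun _ => (0 : KK ι)) z.1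
    simp only [smul_zero, zero_smul] at e0
    exact hz.trans (e0.symm.trans hz'.symm)
  add_mem' := by
    rintro ⟨a, b⟩ ⟨c, d⟩ h h'
    have h1 := Lp.coeFn_add (a : FullSpace ι) c
    have h2 := Lp.coeFn_add (b : FullSpace ι) d
    filter_upwards [h, h', h2, ae_creation f h1] with z k k' k2 k1
    refine k2.trans (Eq.trans ?_ k1.symm)
    exact (congrArg₂ (· + ·) k k').trans (creation_add f _ _ z.1).symm
  smul_mem' := by
    rintro c ⟨a, b⟩ h
    have h1 := Lp.coeFn_smul c (a : FullSpace ι)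
    have h2 := Lp.coeFn_smul c (b : FullSpace ι)
    filter_upwards [h, h2, ae_creation f h1] with z k k2 k1
    refine k2.trans (Eq.trans ?_ k1.symm)
    exact (congrArg (c • ·) k).trans (creation_smul f c _ z.1).symm

/-- The graph of `a(f)`, acting on the first Fock factor. -/
def annGraph (f : R3 → ℂ) : Submodule ℂ (Hil ι × Hil ι) where
  carrier := {p | ∀ᵐ z ∂confVol.prod confVol,
    Integrable (annIntegrand f (fun x => val p.1 x z.2) z.1) ∧
      val p.2 z.1 z.2 = annihilation f (fun x => val p.1 x z.2) z.1}
  zero_mem' := by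
    have h := Lp.coeFn_zero (KK ι) 2 (confVol.prod confVol)
    filter_upwards [h, ae_annIntegrand f h] with z hz hz'
    have e : annIntegrand f (fun x => (0 : Conf × Conf → KK ι) (x, z.2)) z.1 = 0 := by
      funext k; simp [annIntegrand]
    rw [e] at hz'
    refine ⟨(integrable_zero _ _ _).congr hz'.symm, hz.trans ?_⟩
    have := integral_congr_ae hz'
    simp only [Pi.zero_apply, integral_zero] at this ⊢
    exact (smul_eq_zero_of_right _ this).symm
  add_mem' := by
    rintro ⟨a, b⟩ ⟨c, d⟩ h h'
    have h1 := Lp.coeFn_add (a : FullSpace ι) c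
    have h2 := Lp.coeFn_add (b : FullSpace ι) d
    filter_upwards [h, h', h2, ae_annIntegrand f h1] with z k k' k2 k1
    have e : annIntegrand f (fun x => ((a : FullSpace ι) + (c : FullSpace ι) :
          Conf × Conf → KK ι) (x, z.2)) z.1 =
        annIntegrand f (fun x => val a x z.2) z.1 + annIntegrand f (fun x => val c x z.2) z.1 := by
      funext k; simp [annIntegrand, val]
    rw [e] at k1
    refine ⟨(k.1.add k'.1).congr k1.symm, k2.trans ?_⟩
    refine (congrArg₂ (· + ·) k.2 k'.2).trans ?_
    have := (integral_congr_ae k1).trans (integral_add k.1 k'.1)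
    exact ((congrArg (((√((z.1.1 : ℝ) + 1) : ℝ) : ℂ) • ·) this).trans (smul_add _ _ _)).symm
  smul_mem' := by
    rintro c ⟨a, b⟩ h
    have h1 := Lp.coeFn_smul c (a : FullSpace ι)
    have h2 := Lp.coeFn_smul c (b : FullSpace ι)
    filter_upwards [h, h2, ae_annIntegrand f h1] with z k k2 k1
    have e : annIntegrand f (fun x => (c • (a : FullSpace ι) :
          Conf × Conf → KK ι) (x, z.2)) z.1 =
        c • annIntegrand f (fun x => val a x z.2) z.1 := by
      funext k; simp only [annIntegrand, val, Pi.smul_apply]; rw [smul_comm]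
    rw [e] at k1
    refine ⟨(k.1.smul c).congr k1.symm, k2.trans ?_⟩
    refine (congrArg (c • ·) k.2).trans ?_
    have := (integral_congr_ae k1).trans (integral_smul c _)
    exact ((congrArg (((√((z.1.1 : ℝ) + 1) : ℝ) : ℂ) • ·) this).trans (smul_comm _ _ _)).symm

/-- `a*(f) ⊗ 𝟙`, on its maximal domain. -/
def creL (f : R3 → ℂ) : Hil ι →ₗ.[ℂ] Hil ι := (creGraph f).toLinearPMap

/-- `a(f) ⊗ 𝟙`, on its maximal domain. -/
def annL (f : R3 → ℂ) : Hil ι →ₗ.[ℂ] Hil ι := (annGraph f).toLinearPMap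

/-- The operator `S A S` with the exchange `S` of the Fock factors: turns `a ⊗ 𝟙` into `𝟙 ⊗ a`. -/
def onRight (A : Hil ι →ₗ.[ℂ] Hil ι) : Hil ι →ₗ.[ℂ] Hil ι :=
  (swapFock (ι := ι)).toLinearMap.compPMap (pcomp A ((swapFock (ι := ι)).toLinearMap.toPMap ⊤))

/-- `𝟙 ⊗ a*(f)`. -/
def creR (f : R3 → ℂ) : Hil ι →ₗ.[ℂ] Hil ι := onRight (creL f)

/-- `𝟙 ⊗ a(f)`. -/
def annR (f : R3 → ℂ) : Hil ι →ₗ.[ℂ] Hil ι := onRight (annL f)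

lemma creGraph_unique (f : R3 → ℂ) {p : Hil ι × Hil ι} (hp : p ∈ creGraph f) (h0 : p.1 = 0) :
    p.2 = 0 := by
  obtain ⟨a, b⟩ := p
  subst h0
  have hz := (creGraph (ι := ι) f).zero_mem
  refine Subtype.ext (Lp.ext ?_)
  filter_upwards [hp, hz] with z h1 h2
  exact h1.trans h2.symm

lemma annGraph_unique (f : R3 → ℂ) {p : Hil ι × Hil ι} (hp : p ∈ annGraph f) (h0 : p.1 = 0) :
    p.2 = 0 := by
  obtain ⟨a, b⟩ := p
  subst h0
  have hz := (annGraph (ι := ι) f).zero_mem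
  refine Subtype.ext (Lp.ext ?_)
  filter_upwards [hp, hz] with z h1 h2
  exact h1.2.trans h2.2.symm

lemma graph_creL (f : R3 → ℂ) : (creL (ι := ι) f).graph = creGraph f :=
  Submodule.toLinearPMap_graph_eq _ fun _ hp h0 => creGraph_unique f hp h0

lemma graph_annL (f : R3 → ℂ) : (annL (ι := ι) f).graph = annGraph f :=
  Submodule.toLinearPMap_graph_eq _ fun _ hp h0 => annGraph_unique f hp h0

/-! ### The thermal field (Araki–Woods representation), dispersion relation `ω(k) = |k|` -/

/-- `ρ_β(k) = (e^{β|k|} - 1)⁻¹`. -/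
def rho (β : ℝ) (k : R3) : ℝ := (Real.exp (β * ‖k‖) - 1)⁻¹

/-- `√(1 + ρ_β) g`. -/
def gPlus (β : ℝ) (g : R3 → ℂ) (k : R3) : ℂ := (√(1 + rho β k) : ℝ) * g k

/-- `√ρ_β ḡ`. -/
def gMinus (β : ℝ) (g : R3 → ℂ) (k : R3) : ℂ := (√(rho β k) : ℝ) * conj (g k)

/-- `a_β*(g) = a*(√(1 + ρ_β) g) ⊗ 𝟙 + 𝟙 ⊗ a(√ρ_β ḡ)`. -/
def thermalCre (β : ℝ) (g : R3 → ℂ) : Hil ι →ₗ.[ℂ] Hil ι :=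
  creL (gPlus β g) + annR (gMinus β g)

/-- `a_β(g) = a(√(1 + ρ_β) g) ⊗ 𝟙 + 𝟙 ⊗ a*(√ρ_β ḡ)`. -/
def thermalAnn (β : ℝ) (g : R3 → ℂ) : Hil ι →ₗ.[ℂ] Hil ι :=
  annL (gPlus β g) + creR (gMinus β g)

/-- The field operator `φ_β(g) = (a_β*(g) + a_β(g)) / √2`, as a closed operator. -/
def thermalField (β : ℝ) (g : R3 → ℂ) : Hil ι →ₗ.[ℂ] Hil ι :=
  (((√2 : ℝ) : ℂ)⁻¹ • (thermalCre β g + thermalAnn β g : Hil ι →ₗ.[ℂ] Hil ι)).closure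

/-! ### Liouville operators -/

/-- The energy `∑ⱼ |kⱼ|` of a configuration. -/
def energy (x : Conf) : ℝ := ∑ j, ‖x.2 j‖

/-- The graph of `L_R`. -/
def LRGraph : Submodule ℂ (Hil ι × Hil ι) where
  carrier := {p | ∀ᵐ z ∂confVol.prod confVol,
    val p.2 z.1 z.2 = ((energy z.1 - energy z.2 : ℝ) : ℂ) • val p.1 z.1 z.2}
  zero_mem' := by
    have h := Lp.coeFn_zero (KK ι) 2 (confVol.prod confVol)
    filter_upwards [h] with z hz
    have hz' : val (0 : Hil ι) z.1 z.2 = 0 := hz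
    simp [hz']
  add_mem' := by
    rintro ⟨a, b⟩ ⟨c, d⟩ h h'
    have h1 := Lp.coeFn_add (a : FullSpace ι) c
    have h2 := Lp.coeFn_add (b : FullSpace ι) d
    filter_upwards [h, h', h2, h1] with z k k' k2 k1
    have k1' : val (a + c) z.1 z.2 = val a z.1 z.2 + val c z.1 z.2 := k1
    have k2' : val (b + d) z.1 z.2 = val b z.1 z.2 + val d z.1 z.2 := k2
    simp only [Prod.mk_add_mk, k1', k2', k, k', smul_add]
  smul_mem' := by
    rintro c ⟨a, b⟩ h
    have h1 := Lp.coeFn_smul c (a : FullSpace ι)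
    have h2 := Lp.coeFn_smul c (b : FullSpace ι)
    filter_upwards [h, h2, h1] with z k k2 k1
    have k1' : val (c • a) z.1 z.2 = c • val a z.1 z.2 := k1
    have k2' : val (c • b) z.1 z.2 = c • val b z.1 z.2 := k2
    simp only [Prod.smul_mk, k1', k2', k]
    rw [smul_comm]

/-- `L_R = dΓ(ω) ⊗ 𝟙 - 𝟙 ⊗ dΓ(ω)`: multiplication by `∑ᵢ |xᵢ| - ∑ⱼ |yⱼ|` on its maximal domain. -/
def LR : Hil ι →ₗ.[ℂ] Hil ι := LRGraph.toLinearPMap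

lemma graph_LR : (LR (ι := ι)).graph = LRGraph := by
  refine Submodule.toLinearPMap_graph_eq _ ?_
  rintro ⟨a, b⟩ hp h0
  simp only at h0
  subst h0
  refine Subtype.ext (Lp.ext ?_)
  filter_upwards [hp, (LRGraph (ι := ι)).zero_mem] with z h1 h2
  exact h1.trans h2.symm

variable [DecidableEq ι]

/-- The bounded operator on `𝒦 ⊗ 𝒦` with the given matrix. -/
def matOp (A : Matrix (ι × ι) (ι × ι) ℂ) : KK ι →L[ℂ] KK ι := Matrix.toEuclideanCLM (𝕜 := ℂ) A

/-- The Hamiltonian `H = diag(E)` of the small system. -/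
def ham (E : ι → ℝ) : Matrix ι ι ℂ := Matrix.diagonal fun i => (E i : ℂ)

/-- `L_S = H ⊗ 𝟙 - 𝟙 ⊗ H`. -/
def LS (E : ι → ℝ) : KK ι →L[ℂ] KK ι :=
  matOp (ham E ⊗ₖ (1 : Matrix ι ι ℂ) - (1 : Matrix ι ι ℂ) ⊗ₖ ham E)

/-- `L₀ = L_S + L_R`. -/
def L0 (E : ι → ℝ) : Hil ι →ₗ.[ℂ] Hil ι :=
  (smallOp (LS E)).toLinearMap.toPMap ⊤ + LR

/-- `V = G ⊗ 𝟙 ⊗ φ_β(g)`, as a closed operator. -/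
def V (G : Matrix ι ι ℂ) (β : ℝ) (g : R3 → ℂ) : Hil ι →ₗ.[ℂ] Hil ι :=
  ((smallOp (matOp (G ⊗ₖ (1 : Matrix ι ι ℂ)))).toLinearMap.compPMap (thermalField β g)).closure

/-- `J V J` for an operator `V`, on the domain `{ψ | J ψ ∈ D(V)}`. -/
def conjJ (A : Hil ι →ₗ.[ℂ] Hil ι) : Hil ι →ₗ.[ℂ] Hil ι :=
  (J (ι := ι)).toLinearMap.compPMap (pcomp A ((J (ι := ι)).toLinearMap.toPMap ⊤) :
    Hil ι →ₛₗ.[starRingEnd ℂ] Hil ι)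

/-- The interaction `I = V - J V J`. -/
def interaction (G : Matrix ι ι ℂ) (β : ℝ) (g : R3 → ℂ) : Hil ι →ₗ.[ℂ] Hil ι :=
  V G β g - conjJ (V G β g)

/-! ### Level shift operators -/

/-- `Ran χ_{L_S = e}`, the eigenspace of `L_S`. -/
def eigS (E : ι → ℝ) (e : ℝ) : Submodule ℂ (KK ι) :=
  Module.End.eigenspace (LS E).toLinearMap (e : ℂ)

/-- `P_e = χ_{L_S = e} ⊗ |Φ_β⟩⟨Φ_β|`: the orthogonal projection onto `Ran χ_{L_S = e} ⊗ ℂΦ_β`. -/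
def P (E : ι → ℝ) (e : ℝ) : Hil ι →L[ℂ] Hil ι := ((eigS E e).map vac).starProjection

/-- `P̄_e = 𝟙 - P_e`. -/
def Pbar (E : ι → ℝ) (e : ℝ) : Hil ι →L[ℂ] Hil ι := 1 - P E e

/-- `L̄₀ᵉ`: the operator `P̄_e L₀ P̄_e` restricted to `Ran P̄_e`. -/
def L0bar (E : ι → ℝ) (e : ℝ) : Hil ι →ₗ.[ℂ] Hil ι :=
  ((Pbar E e).toLinearMap.compPMap (L0 E)).domRestrict
    (LinearMap.range (Pbar E e).toLinearMap)

/-- The resolvent `(L̄₀ᵉ - z)⁻¹`. -/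
def redResolvent (E : ι → ℝ) (e : ℝ) (z : ℂ) : Hil ι →ₗ.[ℂ] Hil ι :=
  (L0bar E e - (z • (LinearMap.id : Hil ι →ₗ[ℂ] Hil ι)).toPMap ⊤).inverse

/-- `Λ_e(ε) = P_e I P̄_e (L̄₀ᵉ - e - iε)⁻¹ P̄_e I P_e`. -/
def Lam (E : ι → ℝ) (G : Matrix ι ι ℂ) (β : ℝ) (g : R3 → ℂ) (e ε : ℝ) : Hil ι →ₗ.[ℂ] Hil ι :=
  (P E e).toLinearMap.compPMap <| pcomp (interaction G β g) <|
    (Pbar E e).toLinearMap.compPMap <|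
      pcomp (redResolvent E e (e + Complex.I * ε)) <|
        (Pbar E e).toLinearMap.compPMap <|
          pcomp (interaction G β g) ((P E e).toLinearMap.toPMap ⊤)

open Classical in
/-- The matrix element `⟨u ⊗ Φ_β, Λ_e(ε) (w ⊗ Φ_β)⟩` (with value `0` if `w ⊗ Φ_β` is not in the
domain of `Λ_e(ε)`). -/
def lamForm (E : ι → ℝ) (G : Matrix ι ι ℂ) (β : ℝ) (g : R3 → ℂ) (e ε : ℝ) (u w : KK ι) : ℂ :=
  if h : vac w ∈ (Lam E G β g e ε).domain then ⟪vac u, Lam E G β g e ε ⟨vac w, h⟩⟫_ℂ else 0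

/-- `T` is the level shift operator `Λ_e`: the weak limit of `Λ_e(ε)` as `ε ↓ 0`, where `Ran P_e` is
identified with `Ran χ_{L_S = e}` through `v ⊗ Φ_β ↔ v`. (This space has finite dimension, so its
only dense subspace is the space itself.) -/
def IsLevelShiftOperator (E : ι → ℝ) (G : Matrix ι ι ℂ) (β : ℝ) (g : R3 → ℂ) (e : ℝ)
    (T : eigS E e →ₗ[ℂ] eigS E e) : Prop :=
  ∀ u w : eigS E e,
    Tendsto (fun ε : ℝ => lamForm E G β g e ε u w) (𝓝[>] 0) (𝓝 ⟪(u : KK ι), (T w : KK ι)⟫_ℂ)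

/-- The matrix `(ξ + iη) G² ⊗ 𝟙 - (ξ - iη) 𝟙 ⊗ 𝒞G²𝒞 - 2iη G ⊗ 𝒞G𝒞`; the operator `𝒞A𝒞` has the
entrywise conjugate matrix. -/
def shiftMatrix (G : Matrix ι ι ℂ) (ξ η : ℝ) : Matrix (ι × ι) (ι × ι) ℂ :=
  ((ξ : ℂ) + Complex.I * η) • ((G ^ 2) ⊗ₖ (1 : Matrix ι ι ℂ))
    - ((ξ : ℂ) - Complex.I * η) • ((1 : Matrix ι ι ℂ) ⊗ₖ (G ^ 2).map conj)
    - (2 * Complex.I * η) • (G ⊗ₖ G.map conj)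

end

end LevelShift

end

/-! Since `H` is scalar, `L_S = 0`: the range of `P_0` is all of `𝒦 ⊗ 𝒦 ⊗ Φ_β`, of dimension 4, and
`L_0` reduces to `L_R`. The interaction sends `u ⊗ Φ_β` to one-particle vectors. With `a = (G ⊗ 1)
u` and `b = (1 ⊗ 𝒞G𝒞) u`, the vector `I (u ⊗ Φ_β)` is `1/√2` times `a ⊗ (√(1+ρ) g ⊗ Ω + Ω ⊗ √ρ ḡ) -
b ⊗ (Ω ⊗ √(1+ρ) ḡ + √ρ g ⊗ Ω)` (`intVac`). On such vectors `L_R` multiplies by `±|k|`, so the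
resolvent divides by `±|k| - iε`.

Pairing the result with `I (u ⊗ Φ_β)` gives `lamForm_eq`: a quadratic form in `a` and `b` with three
scalar coefficients. The dispersive integral `N(ε)` has density `|g|² |k| / (|k|² + ε²)`. The
absorptive integrals `M₁(ε)`, `M₂(ε)` have the kernel `ε / (|k|² + ε²)` with weights `1 + 2ρ` and
`2√(ρ(1+ρ))`. For `p > -1`, `N` tends to `2ξ` by dominated convergence. Both weights behave like `2
/ (β|k|)` at the origin, so in dimension three the absorptive integrals resemble `∫ r^(2p+1) ε / (r²
+ ε²) dr` there. They vanish in the limit for `p > -1/2`, tend to `2η` for `p = -1/2` by an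
approximate-identity argument (`tendsto_absorptiveIntegral_critical`), and for `p < -1/2`, `γ > 0`
the second diverges (`tendsto_absorptiveIntegral_atTop`).

Divergence of the coefficients alone does not exclude a limit, as terms could cancel. But `M₁ ≥ M₂`,
so the imaginary part of a diagonal matrix element is at least `½ M₂ ‖a - b‖²`
(`absorptiveIntegral_csch_mul_le_im_lamForm`), and some `u` has `a ≠ b` unless `G` is scalar
(`exists_matOp_ne`).

The unbounded operators are handled through their graphs. The second application of `I` is never
computed: it suffices that the resolved vectors lie in the domain of `I`, and that `I` can be moved
onto `u ⊗ Φ_β` in the inner product. The latter is the relation `HasAdj`, which survives closures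
and conjugation by `J`, so no selfadjointness of the field is needed. -/

noncomputable section

namespace LevelShift

/-! ### Partially defined operators as relations -/

section Relations

variable {E F K : Type*} [AddCommGroup E] [Module ℂ E] [AddCommGroup F] [Module ℂ F]
  [AddCommGroup K] [Module ℂ K] {σ τ ρ : ℂ →+* ℂ} [RingHomCompTriple σ τ ρ]

/-- `x` is in the domain of `A`, and `A x = y`. -/
def MapsTo (A : E →ₛₗ.[σ] F) (x : E) (y : F) : Prop := ∃ h : x ∈ A.domain, A ⟨x, h⟩ = y

lemma mapsTo_of_mem_graph {A : E →ₗ.[ℂ] F} {x : E} {y : F} (h : (x, y) ∈ A.graph) :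
    MapsTo A x y := by
  obtain ⟨z, hz, rfl⟩ := (A.mem_graph_iff).1 h
  simp only at hz
  subst hz
  exact ⟨z.2, rfl⟩

lemma MapsTo.mem_graph {A : E →ₗ.[ℂ] F} {x : E} {y : F} (h : MapsTo A x y) :
    (x, y) ∈ A.graph := by
  obtain ⟨hx, rfl⟩ := h
  exact A.mem_graph ⟨x, hx⟩

lemma MapsTo.unique {A : E →ₛₗ.[σ] F} {x : E} {y z : F} (h : MapsTo A x y) (h' : MapsTo A x z) :
    y = z := by
  obtain ⟨hx, rfl⟩ := h
  obtain ⟨_, rfl⟩ := h'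
  rfl

lemma mapsTo_toPMap_top (A : E →ₛₗ[σ] F) (x : E) : MapsTo (A.toPMap ⊤) x (A x) :=
  ⟨trivial, rfl⟩

lemma MapsTo.compPMap {A : E →ₛₗ.[σ] F} {x : E} {y : F} (h : MapsTo A x y) (B : F →ₛₗ[τ] K) :
    MapsTo (B.compPMap A : E →ₛₗ.[ρ] K) x (B y) := by
  obtain ⟨hx, rfl⟩ := h
  exact ⟨hx, rfl⟩

lemma MapsTo.pcomp {A : E →ₛₗ.[σ] F} {B : F →ₛₗ.[τ] K} {x : E} {y : F} {z : K}
    (h : MapsTo A x y) (h' : MapsTo B y z) : MapsTo (pcomp B A : E →ₛₗ.[ρ] K) x z := by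
  obtain ⟨hx, rfl⟩ := h
  obtain ⟨hy, rfl⟩ := h'
  exact ⟨⟨⟨⟨x, hx⟩, hy, rfl⟩, hx⟩, rfl⟩

lemma exists_mapsTo_of_pcomp {A : E →ₛₗ.[σ] F} {B : F →ₛₗ.[τ] K} {x : E} {z : K}
    (h : MapsTo (LevelShift.pcomp B A : E →ₛₗ.[ρ] K) x z) : ∃ y, MapsTo A x y ∧ MapsTo B y z := by
  obtain ⟨⟨⟨⟨x', hx'⟩, hy, hxx⟩, hx⟩, rfl⟩ := h
  simp only [Submodule.coe_subtype] at hxx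
  subst hxx
  exact ⟨A ⟨x', hx⟩, ⟨hx, rfl⟩, ⟨hy, rfl⟩⟩

lemma MapsTo.add {A B : E →ₛₗ.[σ] F} {x : E} {y z : F} (h : MapsTo A x y) (h' : MapsTo B x z) :
    MapsTo (A + B) x (y + z) := by
  obtain ⟨hx, rfl⟩ := h
  obtain ⟨hx', rfl⟩ := h'
  exact ⟨⟨hx, hx'⟩, rfl⟩

lemma MapsTo.sub {A B : E →ₛₗ.[σ] F} {x : E} {y z : F} (h : MapsTo A x y) (h' : MapsTo B x z) :
    MapsTo (A - B) x (y - z) := by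
  obtain ⟨hx, rfl⟩ := h
  obtain ⟨hx', rfl⟩ := h'
  exact ⟨⟨hx, hx'⟩, rfl⟩

lemma MapsTo.smul {A : E →ₗ.[ℂ] F} {x : E} {y : F} (h : MapsTo A x y) (c : ℂ) :
    MapsTo (c • A) x (c • y) := by
  obtain ⟨hx, rfl⟩ := h
  exact ⟨hx, rfl⟩

lemma MapsTo.domRestrict {A : E →ₛₗ.[σ] F} {x : E} {y : F} (h : MapsTo A x y) {S : Submodule ℂ E}
    (hS : x ∈ S) : MapsTo (A.domRestrict S) x y := by
  obtain ⟨hx, rfl⟩ := h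
  exact ⟨⟨hS, hx⟩, LinearPMap.domRestrict_apply rfl⟩

lemma MapsTo.inverse {A : E →ₗ.[ℂ] F} {x : E} {y : F} (h : MapsTo A x y)
    (hA : LinearMap.ker A.toFun = ⊥) : MapsTo A.inverse y x := by
  obtain ⟨hx, rfl⟩ := h
  exact mapsTo_of_mem_graph (LinearPMap.mem_inverse_graph hA ⟨x, hx⟩)

lemma MapsTo.add_vec {A : E →ₛₗ.[σ] F} {x x' : E} {y y' : F} (h : MapsTo A x y)
    (h' : MapsTo A x' y') : MapsTo A (x + x') (y + y') := by
  obtain ⟨hx, rfl⟩ := h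
  obtain ⟨hx', rfl⟩ := h'
  exact ⟨A.domain.add_mem hx hx', A.map_add ⟨x, hx⟩ ⟨x', hx'⟩⟩

lemma MapsTo.smul_vec {A : E →ₗ.[ℂ] F} {x : E} {y : F} (h : MapsTo A x y) (c : ℂ) :
    MapsTo A (c • x) (c • y) := by
  obtain ⟨hx, rfl⟩ := h
  exact ⟨A.domain.smul_mem c hx, A.map_smul c ⟨x, hx⟩⟩

end Relations

/-! ### Adjoint relations at a single vector -/

section Adjoint

variable {E : Type*} [NormedAddCommGroup E] [InnerProductSpace ℂ E]

lemma MapsTo.closure {A : E →ₗ.[ℂ] E} {x y : E} (h : MapsTo A x y) : MapsTo A.closure x y :=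
  mapsTo_of_mem_graph (LinearPMap.le_graph_of_le A.le_closure h.mem_graph)

/-- `x` is in the domain of the adjoint of `A`, and `A* x = y`. -/
def HasAdj (A : E →ₗ.[ℂ] E) (x y : E) : Prop :=
  ∀ ψ φ, MapsTo A ψ φ → ⟪x, φ⟫_ℂ = ⟪y, ψ⟫_ℂ

lemma HasAdj.add {A B : E →ₗ.[ℂ] E} {x y z : E} (h : HasAdj A x y) (h' : HasAdj B x z) :
    HasAdj (A + B) x (y + z) := by
  rintro ψ φ ⟨hx, rfl⟩
  rw [LinearPMap.add_apply, inner_add_right, inner_add_left, h ψ _ ⟨hx.1, rfl⟩,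
    h' ψ _ ⟨hx.2, rfl⟩]

lemma HasAdj.sub {A B : E →ₗ.[ℂ] E} {x y z : E} (h : HasAdj A x y) (h' : HasAdj B x z) :
    HasAdj (A - B) x (y - z) := by
  rintro ψ φ ⟨hx, rfl⟩
  rw [LinearPMap.sub_apply, inner_sub_right, inner_sub_left, h ψ _ ⟨hx.1, rfl⟩,
    h' ψ _ ⟨hx.2, rfl⟩]

lemma HasAdj.smul {A : E →ₗ.[ℂ] E} {x y : E} (h : HasAdj A x y) (c : ℂ) :
    HasAdj (c • A) x (conj c • y) := by
  rintro ψ φ ⟨hx, rfl⟩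
  rw [LinearPMap.smul_apply, inner_smul_right, inner_smul_left, h ψ _ ⟨hx, rfl⟩, RingHomCompTriple.comp_apply]
  simp

/-- For fixed `x` and `y` the relation is a closed condition on the pair `(ψ, φ)`, so it extends
from the graph to its closure. Closability of the field and of `V` thus never has to be proved. -/
lemma HasAdj.closure {A : E →ₗ.[ℂ] E} {x y : E} (h : HasAdj A x y) : HasAdj A.closure x y := by
  by_cases hA : A.IsClosable
  · intro ψ φ hφ
    have h1 := hφ.mem_graph
    rw [← hA.graph_closure_eq_closure_graph] at h1
    have hc : IsClosed {q : E × E | ⟪x, q.2⟫_ℂ = ⟪y, q.1⟫_ℂ} :=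
      isClosed_eq (by fun_prop) (by fun_prop)
    have hs : (A.graph : Set (E × E)) ⊆ {q : E × E | ⟪x, q.2⟫_ℂ = ⟪y, q.1⟫_ℂ} := fun q hq =>
      h q.1 q.2 (mapsTo_of_mem_graph hq)
    exact closure_minimal hs hc h1
  -- By convention an operator that is not closable is its own closure.
  · rwa [LinearPMap.closure_def' hA]

/-- Here `hB` says that the adjoint of `B` sends `x` to `x'`. -/
lemma HasAdj.compPMap {A : E →ₗ.[ℂ] E} {B : E →ₗ[ℂ] E} {x x' y : E} (h : HasAdj A x' y)
    (hB : ∀ φ, ⟪x, B φ⟫_ℂ = ⟪x', φ⟫_ℂ) : HasAdj (B.compPMap A) x y := by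
  rintro ψ φ ⟨hx, rfl⟩
  exact (hB _).trans (h ψ _ ⟨hx, rfl⟩)

lemma HasAdj.pcomp_toPMap {A : E →ₗ.[ℂ] E} {B : E →ₗ[ℂ] E} {x y y' : E} (h : HasAdj A x y)
    (hB : ∀ ψ, ⟪y, B ψ⟫_ℂ = ⟪y', ψ⟫_ℂ) : HasAdj (pcomp A (B.toPMap ⊤)) x y' := by
  intro ψ φ hφ
  obtain ⟨χ, h1, h2⟩ := exists_mapsTo_of_pcomp hφ
  obtain rfl := h1.unique (mapsTo_toPMap_top B ψ)
  exact (h _ _ h2).trans (hB ψ)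

end Adjoint

/-! ### The one-particle sector -/

section OneParticle

/-- The summands of `confVol` live on disjoint sectors, so only one survives. This reduces the
vacuum to a point mass and the one-particle sector to Lebesgue measure on `ℝ³`. -/
lemma confVol_restrict_sector (n : ℕ) :
    confVol.restrict {x : Conf | x.1 = n} =
      (volume : Measure (Fin n → R3)).map fun x => (⟨n, x⟩ : Conf) := by
  unfold confVol
  rw [Measure.restrict_sum _ (measurableSet_sector n)]
  ext s hs
  rw [Measure.sum_apply _ hs, tsum_eq_single n]
  · rw [Measure.restrict_map (measurable_sigmaMk n) (measurableSet_sector n)]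
    have : (fun x : Fin n → R3 => (⟨n, x⟩ : Conf)) ⁻¹' {x : Conf | x.1 = n} = Set.univ := by
      ext x; simp
    rw [this, Measure.restrict_univ]
  · intro m hm
    rw [Measure.restrict_map (measurable_sigmaMk m) (measurableSet_sector n)]
    have : (fun x : Fin m → R3 => (⟨m, x⟩ : Conf)) ⁻¹' {x : Conf | x.1 = n} = ∅ := by
      ext x; simp [hm]
    rw [this, Measure.restrict_empty, Measure.map_zero]; simp

/-- The vacuum configuration. -/
def emptyConf : Conf := ⟨0, Fin.elim0⟩

lemma conf_eq_emptyConf {x : Conf} (h : x.1 = 0) : x = emptyConf := by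
  obtain ⟨n, x⟩ := x
  simp only at h
  subst h
  exact congrArg (Sigma.mk 0) (Subsingleton.elim _ _)

/-- The configuration of one particle with momentum `k` in the first Fock factor. -/
def leftConf (k : R3) : Conf × Conf := (⟨1, fun _ => k⟩, emptyConf)

/-- The configurations of one particle in the first Fock factor. -/
def leftSet : Set (Conf × Conf) := {z | z.1.1 = 1 ∧ z.2.1 = 0}

lemma measurableSet_leftSet : MeasurableSet leftSet :=
  (measurableSet_sector 1).prod (measurableSet_sector 0)

lemma confVol_restrict_zero : confVol.restrict {x : Conf | x.1 = 0} = Measure.dirac emptyConf := by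
  rw [confVol_restrict_sector, Measure.volume_pi_eq_dirac Fin.elim0,
    Measure.map_dirac' (measurable_sigmaMk 0)]
  rfl

lemma restrict_vacSet :
    (confVol.prod confVol).restrict vacSet = Measure.dirac (emptyConf, emptyConf) := by
  have : vacSet = {x : Conf | x.1 = 0} ×ˢ {x : Conf | x.1 = 0} := rfl
  rw [this, ← Measure.prod_restrict, confVol_restrict_zero, Measure.dirac_prod_dirac]

lemma measurable_leftConf : Measurable leftConf :=
  ((measurable_sigmaMk 1).comp (measurable_pi_lambda _ fun _ => measurable_id)).prodMk
    measurable_const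

lemma restrict_leftSet :
    (confVol.prod confVol).restrict leftSet = (volume : Measure R3).map leftConf := by
  have : leftSet = {x : Conf | x.1 = 1} ×ˢ {x : Conf | x.1 = 0} := rfl
  have e : (volume : Measure (Fin 1 → R3)) =
      (volume : Measure R3).map (MeasurableEquiv.funUnique (Fin 1) R3).symm :=
    (volume_preserving_funUnique (Fin 1) R3).symm.map_eq.symm
  rw [this, ← Measure.prod_restrict, confVol_restrict_zero, Measure.prod_dirac,
    confVol_restrict_sector, e,
    Measure.map_map (measurable_sigmaMk 1) (MeasurableEquiv.measurable _),
    Measure.map_map (by fun_prop) ((measurable_sigmaMk 1).comp (MeasurableEquiv.measurable _))]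
  rfl

/-- A function on configurations which vanishes unless there is exactly one particle, belonging to
the first Fock factor. -/
def leftFun {X : Type*} [Zero X] (h : R3 → X) : Conf × Conf → X
  | (⟨1, x⟩, ⟨0, _⟩) => h (x 0)
  | _ => 0

lemma leftFun_leftConf {X : Type*} [Zero X] (h : R3 → X) (k : R3) :
    leftFun h (leftConf k) = h k := rfl

lemma leftFun_of_notMem {X : Type*} [Zero X] (h : R3 → X) {z : Conf × Conf} (hz : z ∉ leftSet) :
    leftFun h z = 0 := by
  obtain ⟨⟨n, x⟩, ⟨m, y⟩⟩ := z
  unfold leftFun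
  split
  · next heq =>
    simp only [Prod.mk.injEq] at heq
    exact absurd ⟨congrArg Sigma.fst heq.1, congrArg Sigma.fst heq.2⟩ hz
  · rfl

lemma exists_leftConf {z : Conf × Conf} (hz : z ∈ leftSet) : ∃ k, z = leftConf k := by
  obtain ⟨⟨n, x⟩, y⟩ := z
  obtain ⟨h1, h2⟩ := hz
  simp only at h1 h2
  subst h1
  refine ⟨x 0, ?_⟩
  rw [conf_eq_emptyConf h2]
  unfold leftConf
  congr 2
  funext i
  rw [Subsingleton.elim i 0]

lemma leftSet_eq_range : leftSet = Set.range leftConf := by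
  ext z
  constructor
  · intro hz
    obtain ⟨k, rfl⟩ := exists_leftConf hz
    exact ⟨k, rfl⟩
  · rintro ⟨k, rfl⟩
    exact ⟨rfl, rfl⟩

/-- `leftFun id` is a left inverse of `leftConf`; its measurability makes `leftConf` a measurable
embedding. -/
lemma measurable_leftFun_id : Measurable (leftFun (id : R3 → R3)) := by
  have key : Measurable fun x : Conf => leftFun (id : R3 → R3) (x, emptyConf) := by
    refine measurable_conf fun n => ?_
    by_cases hn : n = 1
    · subst hn
      exact measurable_pi_apply 0
    · have : (fun x : Fin n → R3 => leftFun (id : R3 → R3) ((⟨n, x⟩ : Conf), emptyConf)) =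
          fun _ => 0 := by
        funext x
        exact leftFun_of_notMem _ fun h => hn h.1
      rw [this]
      exact measurable_const
  have e : leftFun (id : R3 → R3) = leftSet.indicator
      ((fun x : Conf => leftFun (id : R3 → R3) (x, emptyConf)) ∘ Prod.fst) := by
    funext z
    by_cases hz : z ∈ leftSet
    · rw [Set.indicator_of_mem hz]
      obtain ⟨k, rfl⟩ := exists_leftConf hz
      rfl
    · rw [Set.indicator_of_notMem hz, leftFun_of_notMem _ hz]
  rw [e]
  exact (key.comp measurable_fst).indicator measurableSet_leftSet

lemma measurableEmbedding_leftConf : MeasurableEmbedding leftConf :=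
  MeasurableEmbedding.of_measurable_inverse measurable_leftConf
    (leftSet_eq_range ▸ measurableSet_leftSet) measurable_leftFun_id fun k => leftFun_leftConf id k

lemma leftFun_eq_indicator {X : Type*} [Zero X] (h : R3 → X) :
    leftFun h = leftSet.indicator (leftFun h) := by
  refine (Set.indicator_eq_self.2 fun z hz => ?_).symm
  by_contra hz'
  exact hz (leftFun_of_notMem h hz')

lemma memLp_leftFun {X : Type*} [NormedAddCommGroup X] {h : R3 → X} {p : ℝ≥0∞}
    (hh : MemLp h p volume) : MemLp (leftFun h) p (confVol.prod confVol) := by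
  rw [leftFun_eq_indicator, memLp_indicator_iff_restrict measurableSet_leftSet, restrict_leftSet,
    measurableEmbedding_leftConf.memLp_map_measure_iff]
  exact hh

lemma ae_leftConf {Q : Conf × Conf → Prop} (h : ∀ᵐ z ∂confVol.prod confVol, Q z) :
    ∀ᵐ k : R3, Q (leftConf k) := by
  have := ae_restrict_of_ae (s := leftSet) h
  rwa [restrict_leftSet, measurableEmbedding_leftConf.ae_map_iff] at this

/-- The vacuum configuration is an atom, so point values there do not depend on the representative.
-/
lemma ae_emptyConf {Q : Conf × Conf → Prop} (h : ∀ᵐ z ∂confVol.prod confVol, Q z) :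
    Q (emptyConf, emptyConf) := by
  have h1 := ae_restrict_of_ae (s := vacSet) h
  rw [restrict_vacSet] at h1
  by_contra hc
  have h3 := Measure.le_dirac_apply (a := (emptyConf, emptyConf)) (s := {z | ¬ Q z})
  rw [ae_iff] at h1
  rw [h1] at h3
  simp [hc] at h3

lemma setIntegral_leftSet {X : Type*} [NormedAddCommGroup X] [NormedSpace ℝ X]
    (F : Conf × Conf → X) : ∫ z in leftSet, F z ∂confVol.prod confVol = ∫ k, F (leftConf k) := by
  rw [restrict_leftSet, measurableEmbedding_leftConf.integral_map]

end OneParticle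

/-! ### One-particle vectors, exchange and conjugation -/

section Vectors

variable {ι : Type} [Fintype ι]

lemma permPair_mem_leftSet {σ τ : ∀ n, Equiv.Perm (Fin n)} {z : Conf × Conf} :
    permPair σ τ z ∈ leftSet ↔ z ∈ leftSet := Iff.rfl

lemma leftFun_permPair {X : Type*} [Zero X] (h : R3 → X) (σ τ : ∀ n, Equiv.Perm (Fin n))
    (z : Conf × Conf) : leftFun h (permPair σ τ z) = leftFun h z := by
  by_cases hz : z ∈ leftSet
  · obtain ⟨k, rfl⟩ := exists_leftConf hz
    rfl
  · rw [leftFun_of_notMem h hz, leftFun_of_notMem h (mt permPair_mem_leftSet.1 hz)]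

lemma memLp_smul_const {f : R3 → ℂ} (hf : MemLp f 2 volume) (u : KK ι) :
    MemLp (fun k => f k • u) 2 volume :=
  (ContinuousLinearMap.toSpanSingleton ℂ u).comp_memLp' hf

/-- A square integrable function, symmetric everywhere, as a vector of the Hilbert space. -/
def mkHil (F : Conf × Conf → KK ι) (hF : MemLp F 2 (confVol.prod confVol))
    (hs : ∀ σ τ, ∀ᵐ z ∂confVol.prod confVol, F (permPair σ τ z) = F z) : Hil ι :=
  ⟨hF.toLp F, by
    intro σ τ
    have h := hF.coeFn_toLp
    have h' := (measurePreserving_permPair σ τ).quasiMeasurePreserving.ae h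
    filter_upwards [h, h', hs σ τ] with z hz hz' h1
    rw [hz, hz', h1]⟩

lemma val_mkHil (F : Conf × Conf → KK ι) (hF : MemLp F 2 (confVol.prod confVol))
    (hs : ∀ σ τ, ∀ᵐ z ∂confVol.prod confVol, F (permPair σ τ z) = F z) :
    ∀ᵐ z ∂confVol.prod confVol, val (mkHil F hF hs) z.1 z.2 = F z :=
  hF.coeFn_toLp

/-- The vector `u ⊗ f ⊗ Ω`. -/
def oneL (f : R3 → ℂ) (hf : MemLp f 2 volume) (u : KK ι) : Hil ι :=
  mkHil (leftFun fun k => f k • u) (memLp_leftFun (memLp_smul_const hf u))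
    fun σ τ => ae_of_all _ (leftFun_permPair _ σ τ)

lemma val_oneL (f : R3 → ℂ) (hf : MemLp f 2 volume) (u : KK ι) :
    ∀ᵐ z ∂confVol.prod confVol, val (oneL f hf u) z.1 z.2 = leftFun (fun k => f k • u) z :=
  val_mkHil _ _ _

lemma val_vac (u : KK ι) :
    ∀ᵐ z ∂confVol.prod confVol, val (vac u) z.1 z.2 = vacSet.indicator (fun _ => u) z :=
  indicatorConstLp_coeFn (p := 2) (hs := measurableSet_vacSet) (hμs := by simp [volume_vacSet])

lemma ext_val {a b : Hil ι}
    (h : ∀ᵐ z ∂confVol.prod confVol, val a z.1 z.2 = val b z.1 z.2) : a = b :=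
  Subtype.ext (Lp.ext h)

lemma val_add (a b : Hil ι) :
    ∀ᵐ z ∂confVol.prod confVol, val (a + b) z.1 z.2 = val a z.1 z.2 + val b z.1 z.2 :=
  Lp.coeFn_add (a : FullSpace ι) b

lemma val_smul (c : ℂ) (a : Hil ι) :
    ∀ᵐ z ∂confVol.prod confVol, val (c • a) z.1 z.2 = c • val a z.1 z.2 :=
  Lp.coeFn_smul c (a : FullSpace ι)

lemma val_smallOp {σ : ℂ →+* ℂ} [RingHomIsometric σ] (A : KK ι →SL[σ] KK ι) (ψ : Hil ι) :
    ∀ᵐ z ∂confVol.prod confVol, val (smallOp A ψ) z.1 z.2 = A (val ψ z.1 z.2) :=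
  A.coeFn_compLp (ψ : FullSpace ι)

lemma val_swapFock (ψ : Hil ι) :
    ∀ᵐ z ∂confVol.prod confVol, val (swapFock ψ) z.1 z.2 = val ψ z.2 z.1 :=
  Lp.coeFn_compMeasurePreserving (ψ : FullSpace ι)
      (Measure.measurePreserving_swap (μ := confVol) (ν := confVol))

lemma ae_swap {Q : Conf × Conf → Prop} (h : ∀ᵐ z ∂confVol.prod confVol, Q z) :
    ∀ᵐ z ∂confVol.prod confVol, Q z.swap :=
  (Measure.measurePreserving_swap (μ := confVol) (ν := confVol)).quasiMeasurePreserving.ae h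

lemma val_J (ψ : Hil ι) :
    ∀ᵐ z ∂confVol.prod confVol, val (J ψ) z.1 z.2 = JS (val ψ z.2 z.1) := by
  filter_upwards [val_smallOp JS (swapFock ψ), val_swapFock ψ] with z h1 h2
  rw [← h2, ← h1]
  rfl

lemma inner_eq_integral (a b : Hil ι) :
    ⟪a, b⟫_ℂ = ∫ z, ⟪val a z.1 z.2, val b z.1 z.2⟫_ℂ ∂confVol.prod confVol := by
  rw [Submodule.coe_inner, L2.inner_def]
  rfl

/-- The measure restricted to `vacSet` is a Dirac mass, so the inner product integral is an
evaluation. -/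
lemma inner_vac (u : KK ι) (ψ : Hil ι) : ⟪vac u, ψ⟫_ℂ = ⟪u, val ψ emptyConf emptyConf⟫_ℂ := by
  rw [Submodule.coe_inner]
  have h := L2.inner_indicatorConstLp_eq_setIntegral_inner ℂ (ψ : FullSpace ι)
    measurableSet_vacSet u (by simp [volume_vacSet])
  refine h.trans ?_
  rw [restrict_vacSet]
  have hm : (fun z => ⟪u, (ψ : FullSpace ι) z⟫_ℂ) =ᵐ[Measure.dirac (emptyConf, emptyConf)]
      fun _ => ⟪u, val ψ emptyConf emptyConf⟫_ℂ := by
    have hz : ∀ᵐ z ∂Measure.dirac (emptyConf, emptyConf), z = (emptyConf, emptyConf) := by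
      rw [← restrict_vacSet]
      filter_upwards [ae_restrict_mem measurableSet_vacSet] with z hz
      exact Prod.ext (conf_eq_emptyConf hz.1) (conf_eq_emptyConf hz.2)
    filter_upwards [hz] with z hz
    rw [hz]
    rfl
  rw [integral_congr_ae hm]
  simp

lemma inner_oneL (f : R3 → ℂ) (hf : MemLp f 2 volume) (u : KK ι) (ψ : Hil ι) :
    ⟪oneL f hf u, ψ⟫_ℂ =
      ∫ k, ⟪f k • u, val ψ (leftConf k).1 (leftConf k).2⟫_ℂ := by
  refine Eq.trans ?_ (setIntegral_leftSet
    fun z => ⟪leftFun (fun k => f k • u) z, val ψ z.1 z.2⟫_ℂ)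
  rw [inner_eq_integral, ← integral_indicator measurableSet_leftSet]
  refine integral_congr_ae ?_
  filter_upwards [val_oneL f hf u] with z hz
  rw [hz]
  by_cases h : z ∈ leftSet
  · rw [Set.indicator_of_mem h]
  · rw [Set.indicator_of_notMem h, leftFun_of_notMem _ h, inner_zero_left]

lemma inner_oneL_oneL (f f' : R3 → ℂ) (hf : MemLp f 2 volume) (hf' : MemLp f' 2 volume)
    (u u' : KK ι) :
    ⟪oneL f hf u, oneL f' hf' u'⟫_ℂ = (∫ k, conj (f k) * f' k) * ⟪u, u'⟫_ℂ := by
  rw [inner_oneL, ← integral_mul_const]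
  refine integral_congr_ae ?_
  filter_upwards [ae_leftConf (val_oneL f' hf' u')] with k hk
  rw [hk, leftFun_leftConf, inner_smul_left, inner_smul_right, mul_assoc]

/-- Linearity in the one-particle function. The combination `h` is a separate variable, so that its
integrability proof need not be transported along an equality of functions. -/
lemma oneL_comb (a b : ℂ) (f f' h : R3 → ℂ) (hf : MemLp f 2 volume) (hf' : MemLp f' 2 volume)
    (hh : MemLp h 2 volume) (e : ∀ k, h k = a * f k + b * f' k) (u : KK ι) :
    a • oneL f hf u + b • oneL f' hf' u = oneL h hh u := by
  refine ext_val ?_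
  filter_upwards [val_oneL f hf u, val_oneL f' hf' u, val_oneL h hh u,
    val_add (a • oneL f hf u) (b • oneL f' hf' u), val_smul a (oneL f hf u),
    val_smul b (oneL f' hf' u)] with z h1 h2 h3 h4 h5 h6
  rw [h3, h4, h5, h6, h1, h2]
  by_cases hz : z ∈ leftSet
  · obtain ⟨k, rfl⟩ := exists_leftConf hz
    simp only [leftFun_leftConf, e, add_smul, smul_smul]
  · simp only [leftFun_of_notMem _ hz, smul_zero, add_zero]

lemma smallOp_oneL (A : KK ι →L[ℂ] KK ι) (f : R3 → ℂ) (hf : MemLp f 2 volume) (u : KK ι) :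
    smallOp A (oneL f hf u) = oneL f hf (A u) := by
  refine ext_val ?_
  filter_upwards [val_oneL f hf u, val_oneL f hf (A u), val_smallOp A (oneL f hf u)]
    with z h1 h2 h3
  rw [h2, h3, h1]
  by_cases hz : z ∈ leftSet
  · obtain ⟨k, rfl⟩ := exists_leftConf hz
    simp only [leftFun_leftConf, map_smul]
  · simp only [leftFun_of_notMem _ hz, map_zero]

lemma smallOp_swapFock {σ : ℂ →+* ℂ} [RingHomIsometric σ] (A : KK ι →SL[σ] KK ι) (ψ : Hil ι) :
    smallOp A (swapFock ψ) = swapFock (smallOp A ψ) := by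
  refine ext_val ?_
  filter_upwards [val_smallOp A (swapFock ψ), val_swapFock (smallOp A ψ), val_swapFock ψ,
    ae_swap (val_smallOp A ψ)] with z h1 h2 h3 h4
  rw [h1, h2, h3]
  exact h4.symm

lemma swapFock_swapFock (ψ : Hil ι) : swapFock (swapFock ψ) = ψ := by
  refine ext_val ?_
  filter_upwards [val_swapFock (swapFock ψ), ae_swap (val_swapFock ψ)] with z h1 h2
  exact h1.trans h2

lemma swapFock_vac (u : KK ι) : swapFock (vac u) = vac u := by
  refine ext_val ?_
  filter_upwards [val_swapFock (vac u), val_vac u, ae_swap (val_vac u)] with z h1 h2 h3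
  refine h1.trans (Eq.trans h3 (Eq.trans ?_ h2.symm))
  have : z.swap ∈ vacSet ↔ z ∈ vacSet := and_comm
  by_cases hz : z ∈ vacSet
  · rw [Set.indicator_of_mem hz, Set.indicator_of_mem (this.2 hz)]
  · rw [Set.indicator_of_notMem hz, Set.indicator_of_notMem (mt this.1 hz)]

lemma inner_swapFock (a b : Hil ι) : ⟪swapFock a, b⟫_ℂ = ⟪a, swapFock b⟫_ℂ := by
  rw [inner_eq_integral, inner_eq_integral,
    ← integral_prod_swap]
  refine integral_congr_ae ?_
  filter_upwards [ae_swap (val_swapFock a), val_swapFock b] with z h1 h2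
  simp only [Prod.fst_swap, Prod.snd_swap] at h1
  simp only [Prod.fst_swap, Prod.snd_swap, h1, h2]

/-- The vector `u ⊗ Ω ⊗ f`. -/
def oneR (f : R3 → ℂ) (hf : MemLp f 2 volume) (u : KK ι) : Hil ι := swapFock (oneL f hf u)

lemma val_oneR (f : R3 → ℂ) (hf : MemLp f 2 volume) (u : KK ι) :
    ∀ᵐ z ∂confVol.prod confVol,
      val (oneR f hf u) z.1 z.2 = leftFun (fun k => f k • u) z.swap := by
  filter_upwards [val_swapFock (oneL f hf u), ae_swap (val_oneL f hf u)] with z h1 h2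
  exact h1.trans h2

lemma swapFock_oneL (f : R3 → ℂ) (hf : MemLp f 2 volume) (u : KK ι) :
    swapFock (oneL f hf u) = oneR f hf u := rfl

lemma swapFock_oneR (f : R3 → ℂ) (hf : MemLp f 2 volume) (u : KK ι) :
    swapFock (oneR f hf u) = oneL f hf u := swapFock_swapFock _

lemma oneR_comb (a b : ℂ) (f f' h : R3 → ℂ) (hf : MemLp f 2 volume) (hf' : MemLp f' 2 volume)
    (hh : MemLp h 2 volume) (e : ∀ k, h k = a * f k + b * f' k) (u : KK ι) :
    a • oneR f hf u + b • oneR f' hf' u = oneR h hh u := by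
  simp only [oneR, ← map_smul, ← map_add]
  rw [oneL_comb a b f f' h hf hf' hh e]

lemma inner_oneR_oneR (f f' : R3 → ℂ) (hf : MemLp f 2 volume) (hf' : MemLp f' 2 volume)
    (u u' : KK ι) :
    ⟪oneR f hf u, oneR f' hf' u'⟫_ℂ = (∫ k, conj (f k) * f' k) * ⟪u, u'⟫_ℂ := by
  rw [oneR, inner_swapFock, swapFock_oneR, inner_oneL_oneL]

lemma inner_oneL_oneR (f f' : R3 → ℂ) (hf : MemLp f 2 volume) (hf' : MemLp f' 2 volume)
    (u u' : KK ι) : ⟪oneL f hf u, oneR f' hf' u'⟫_ℂ = 0 := by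
  rw [inner_oneL]
  refine integral_eq_zero_of_ae ?_
  filter_upwards [ae_leftConf (val_oneR f' hf' u')] with k hk
  rw [hk, leftFun_of_notMem _ fun h => absurd h.1 (by simp [leftConf, emptyConf]),
    inner_zero_right, Pi.zero_apply]

lemma inner_oneR_oneL (f f' : R3 → ℂ) (hf : MemLp f 2 volume) (hf' : MemLp f' 2 volume)
    (u u' : KK ι) : ⟪oneR f hf u, oneL f' hf' u'⟫_ℂ = 0 := by
  rw [oneR, inner_swapFock, swapFock_oneL, inner_oneL_oneR]

lemma inner_vac_oneL (f : R3 → ℂ) (hf : MemLp f 2 volume) (u u' : KK ι) :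
    ⟪vac u', oneL f hf u⟫_ℂ = 0 := by
  rw [inner_vac, ae_emptyConf (val_oneL f hf u),
    leftFun_of_notMem _ fun h => absurd h.1 (by simp [emptyConf]), inner_zero_right]

lemma inner_vac_oneR (f : R3 → ℂ) (hf : MemLp f 2 volume) (u u' : KK ι) :
    ⟪vac u', oneR f hf u⟫_ℂ = 0 := by
  rw [oneR, ← inner_swapFock, swapFock_vac, inner_vac_oneL]

lemma inner_vac_vac (u u' : KK ι) : ⟪vac u, vac u'⟫_ℂ = ⟪u, u'⟫_ℂ := by
  have h : (emptyConf, emptyConf) ∈ vacSet := ⟨rfl, rfl⟩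
  rw [inner_vac, ae_emptyConf (val_vac u'), Set.indicator_of_mem h]

lemma vac_injective : Function.Injective (vac : KK ι →ₗ[ℂ] Hil ι) := by
  rw [← LinearMap.ker_eq_bot, LinearMap.ker_eq_bot']
  intro u hu
  have := inner_vac_vac u u
  rw [hu, inner_zero_left] at this
  exact inner_self_eq_zero.1 this.symm

lemma inner_JS (a b : KK ι) : ⟪a, JS b⟫_ℂ = ⟪b, JS a⟫_ℂ := by
  simp only [PiLp.inner_apply, JS, ContinuousLinearMap.coe_mk', LinearMap.coe_mk, AddHom.coe_mk]
  rw [← (Equiv.prodComm ι ι).sum_comp]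
  refine Finset.sum_congr rfl fun q _ => ?_
  obtain ⟨i, j⟩ := q
  simp [mul_comm]

/-- Antiunitarity together with `J² = 1`: exchanging the two configurations reduces the identity to
`inner_JS` for the values. -/
lemma inner_J (a b : Hil ι) : ⟪a, J b⟫_ℂ = ⟪b, J a⟫_ℂ := by
  rw [inner_eq_integral, inner_eq_integral, ← integral_prod_swap]
  refine integral_congr_ae ?_
  filter_upwards [ae_swap (val_J b), val_J a] with z h1 h2
  simp only [Prod.fst_swap, Prod.snd_swap] at h1
  simp only [Prod.fst_swap, Prod.snd_swap, h1, h2]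
  exact inner_JS _ _

lemma J_swapFock (ψ : Hil ι) : J (swapFock ψ) = swapFock (J ψ) :=
  smallOp_swapFock JS (swapFock ψ)

lemma J_oneL (f f' : R3 → ℂ) (hf : MemLp f 2 volume) (hf' : MemLp f' 2 volume)
    (e : ∀ k, f' k = conj (f k)) (u : KK ι) : J (oneL f hf u) = oneR f' hf' (JS u) := by
  refine ext_val ?_
  filter_upwards [val_J (oneL f hf u), ae_swap (val_oneL f hf u), val_oneR f' hf' (JS u)]
    with z h1 h2 h3
  refine h1.trans (Eq.trans (congrArg JS h2) (Eq.trans ?_ h3.symm))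
  by_cases hz : z.swap ∈ leftSet
  · obtain ⟨k, hk⟩ := exists_leftConf hz
    rw [hk, leftFun_leftConf, leftFun_leftConf, e, map_smulₛₗ]
  · rw [leftFun_of_notMem _ hz, leftFun_of_notMem _ hz, map_zero]

lemma J_oneR (f f' : R3 → ℂ) (hf : MemLp f 2 volume) (hf' : MemLp f' 2 volume)
    (e : ∀ k, f' k = conj (f k)) (u : KK ι) : J (oneR f hf u) = oneL f' hf' (JS u) := by
  rw [oneR, J_swapFock, J_oneL f f' hf hf' e, swapFock_oneR]

lemma J_vac (u : KK ι) : J (vac u) = vac (JS u) := by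
  refine ext_val ?_
  filter_upwards [val_J (vac u), ae_swap (val_vac u), val_vac (JS u)] with z h1 h2 h3
  refine h1.trans (Eq.trans (congrArg JS h2) (Eq.trans ?_ h3.symm))
  have : z.swap ∈ vacSet ↔ z ∈ vacSet := and_comm
  by_cases hz : z ∈ vacSet
  · rw [Set.indicator_of_mem hz, Set.indicator_of_mem (this.2 hz)]
  · rw [Set.indicator_of_notMem hz, Set.indicator_of_notMem (mt this.1 hz), map_zero]

end Vectors

/-! ### Creation operators on vectors with boundedly many particles -/

section Creation

variable {ι : Type} [Fintype ι]

lemma prod_restrict_sector (n : ℕ) :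
    (confVol.prod confVol).restrict {z : Conf × Conf | z.1.1 = n} =
      ((volume : Measure (Fin n → R3)).prod confVol).map
        (Prod.map (fun x => (⟨n, x⟩ : Conf)) id) := by
  have h : {z : Conf × Conf | z.1.1 = n} = {x : Conf | x.1 = n} ×ˢ Set.univ := by
    ext z; simp
  rw [h, ← Measure.prod_restrict, confVol_restrict_sector, Measure.restrict_univ,
    ← Measure.map_prod_map _ _ (measurable_sigmaMk n) measurable_id, Measure.map_id]

lemma measurableSet_sector_fst (n : ℕ) : MeasurableSet {z : Conf × Conf | z.1.1 = n} :=
  measurable_fst (measurableSet_sector n)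

lemma memLp_sector_iff {X : Type*} [NormedAddCommGroup X] {F : Conf × Conf → X} (n : ℕ) :
    MemLp F 2 ((confVol.prod confVol).restrict {z : Conf × Conf | z.1.1 = n}) ↔
      MemLp (fun w : (Fin n → R3) × Conf => F (⟨n, w.1⟩, w.2)) 2 (volume.prod confVol) := by
  rw [prod_restrict_sector,
    ((measurableEmbedding_sigmaMk n).prodMap MeasurableEmbedding.id).memLp_map_measure_iff]
  rfl

/-- With boundedly many particles `F` is a finite sum of its sector components, so no summability
over `n` is at stake. -/
lemma memLp_of_sectors {X : Type*} [NormedAddCommGroup X] {F : Conf × Conf → X} (N : ℕ)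
    (h : ∀ n, MemLp (fun w : (Fin n → R3) × Conf => F (⟨n, w.1⟩, w.2)) 2 (volume.prod confVol))
    (h0 : ∀ᵐ z ∂confVol.prod confVol, N < z.1.1 → F z = 0) :
    MemLp F 2 (confVol.prod confVol) := by
  have h1 : MemLp (fun z => ∑ n ∈ Finset.range (N + 1),
      {z : Conf × Conf | z.1.1 = n}.indicator F z) 2 (confVol.prod confVol) :=
    memLp_finsetSum _ fun n _ =>
      (memLp_indicator_iff_restrict (measurableSet_sector_fst n)).2 ((memLp_sector_iff n).2 (h n))
  refine h1.ae_eq ?_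
  filter_upwards [h0] with z hz
  by_cases hN : N < z.1.1
  · rw [hz hN]
    refine Finset.sum_eq_zero fun n hn => Set.indicator_of_notMem (fun he => ?_) _
    have he' : z.1.1 = n := he
    rw [Finset.mem_range] at hn
    omega
  · rw [Finset.sum_eq_single z.1.1]
    · exact Set.indicator_of_mem (s := {w : Conf × Conf | w.1.1 = z.1.1}) rfl F
    · intro n _ hn
      exact Set.indicator_of_notMem (s := {w : Conf × Conf | w.1.1 = n})
        (fun he => hn (Eq.symm he)) F
    · intro hn
      rw [Finset.mem_range] at hn
      omega

lemma memLp_smul_prod {X Y : Type*} [MeasurableSpace X] [MeasurableSpace Y] {μ : Measure X}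
    {ν : Measure Y} [SFinite μ] [SFinite ν] {f : X → ℂ} {φ : Y → KK ι}
    (hf : MemLp f 2 μ) (hφ : MemLp φ 2 ν) :
    MemLp (fun q : X × Y => f q.1 • φ q.2) 2 (μ.prod ν) := by
  have hm : AEStronglyMeasurable (fun q : X × Y => f q.1 • φ q.2) (μ.prod ν) :=
    hf.1.comp_fst.smul hφ.1.comp_snd
  rw [memLp_two_iff_integrable_sq_norm hm]
  refine (((memLp_two_iff_integrable_sq_norm hf.1).1 hf).mul_prod
    ((memLp_two_iff_integrable_sq_norm hφ.1).1 hφ)).congr (ae_of_all _ fun q => ?_)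
  simp only [norm_smul, mul_pow]

lemma measurePreserving_removeNth {n : ℕ} (j : Fin (n + 1)) :
    MeasurePreserving (fun w : (Fin (n + 1) → R3) × Conf => (w.1 j, (j.removeNth w.1, w.2)))
      (volume.prod confVol) (volume.prod (volume.prod confVol)) :=
  (measurePreserving_prodAssoc volume volume confVol).comp
    ((volume_preserving_piFinSuccAbove (fun _ : Fin (n + 1) => R3) j).prod
      (MeasurePreserving.id confVol))

/-- In a fixed sector each term is a product of `f` in one variable and `φ` in the others, after a
measure preserving rearrangement. The bound `N` leaves finitely many sectors, so no estimate uniform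
in `n` is required. -/
lemma memLp_creation {f : R3 → ℂ} (hf : MemLp f 2 volume) {φ : Conf × Conf → KK ι}
    (hφ : MemLp φ 2 (confVol.prod confVol)) {N : ℕ}
    (hN : ∀ᵐ z ∂confVol.prod confVol, N < z.1.1 → φ z = 0) :
    MemLp (fun z => creation f (fun x => φ (x, z.2)) z.1) 2 (confVol.prod confVol) := by
  refine memLp_of_sectors (N + 1) (fun n => ?_) ?_
  · cases n with
    | zero => exact MemLp.zero
    | succ n =>
      refine MemLp.const_smul (f := fun w : (Fin (n + 1) → R3) × Conf =>
        ∑ j, f (w.1 j) • φ (⟨n, j.removeNth w.1⟩, w.2)) ?_ (((√((n : ℝ) + 1) : ℝ) : ℂ)⁻¹)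
      refine memLp_finsetSum _ fun j _ => ?_
      have h := memLp_smul_prod hf ((memLp_sector_iff n).1 (hφ.restrict {z | z.1.1 = n}))
      exact h.comp_measurePreserving (measurePreserving_removeNth j)
  -- The vanishing of `φ` holds only almost everywhere, while `creation` evaluates `φ` with one
  -- particle removed. A truncation that vanishes identically above `N` replaces `φ`, by
  -- `ae_creation`.
  · have h1 : ∀ᵐ z ∂confVol.prod confVol,
        φ z = (fun z : Conf × Conf => if N < z.1.1 then 0 else φ z) z := by
      filter_upwards [hN] with z hz
      by_cases h : N < z.1.1 <;> simp [h, hz]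
    filter_upwards [ae_creation f h1] with z hz hlt
    rw [hz]
    obtain ⟨⟨n, x⟩, y⟩ := z
    cases n with
    | zero => rfl
    | succ n =>
      have : N < n := by simpa using hlt
      simp [creation, this]

/-- A permutation carries the complement of `j` onto the complement of `σ j`; `s` is the induced
relabelling of the remaining particles. -/
lemma exists_perm_succAbove {n : ℕ} (σ : Equiv.Perm (Fin (n + 1))) (j : Fin (n + 1)) :
    ∃ s : Equiv.Perm (Fin n), ∀ i, σ (j.succAbove i) = (σ j).succAbove (s i) := by
  have h : ∀ i, ∃ i', (σ j).succAbove i' = σ (j.succAbove i) := fun i =>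
    Fin.exists_succAbove_eq fun e => Fin.succAbove_ne j i (σ.injective e)
  choose s hs using h
  have hinj : Function.Injective s := fun a b hab => by
    have := (hs a).symm.trans ((congrArg _ hab).trans (hs b))
    exact Fin.succAbove_right_injective (σ.injective this)
  exact ⟨Equiv.ofBijective s (Finite.injective_iff_bijective.1 hinj), fun i => (hs i).symm⟩

/-- Relabelling permutes the terms of the creation sum: removing particle `j` after relabelling
amounts to removing particle `σ j` and relabelling the rest, which the symmetry of `ψ` absorbs. -/
lemma creation_symm (f : R3 → ℂ) (ψ : Hil ι) (σ τ : ∀ n, Equiv.Perm (Fin n)) :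
    ∀ᵐ z ∂confVol.prod confVol,
      creation f (fun x => val ψ x (permPair σ τ z).2) (permPair σ τ z).1 =
        creation f (fun x => val ψ x z.2) z.1 := by
  rw [ae_sector]
  intro n
  cases n with
  | zero => exact ae_of_all _ fun w => rfl
  | succ n =>
    have key : ∀ j : Fin (n + 1), ∀ᵐ w ∂(volume : Measure (Fin (n + 1) → R3)).prod confVol,
        val ψ ⟨n, j.removeNth (w.1 ∘ σ (n + 1))⟩ (permConf τ w.2) =
          val ψ ⟨n, (σ (n + 1) j).removeNth w.1⟩ w.2 := by
      intro j
      obtain ⟨s, hs⟩ := exists_perm_succAbove (σ (n + 1)) j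
      -- The symmetry of `ψ` speaks of one permutation per sector, so `s` is extended by the
      -- identity.
      let s' : ∀ m, Equiv.Perm (Fin m) := fun m => if h : n = m then h ▸ s else 1
      have hs' : s' n = s := by simp [s']
      have h1 := ae_sector.1 (ψ.2 s' τ) n
      have h2 := (Measure.quasiMeasurePreserving_snd.comp
        (measurePreserving_removeNth (σ (n + 1) j)).quasiMeasurePreserving).ae h1
      filter_upwards [h2] with w hw
      refine Eq.trans ?_ hw
      have e : j.removeNth (w.1 ∘ σ (n + 1)) = (σ (n + 1) j).removeNth w.1 ∘ s' n := by
        rw [hs']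
        funext i
        exact congrArg w.1 (hs i)
      rw [e]
      rfl
    filter_upwards [ae_all_iff.2 key] with w hw
    refine congrArg (_ • ·) ?_
    rw [← Equiv.sum_comp (σ (n + 1)) fun j => f (w.1 j) • val ψ ⟨n, j.removeNth w.1⟩ w.2]
    exact Finset.sum_congr rfl fun j _ => congrArg _ (hw j)

/-- Vectors with boundedly many particles in the first Fock factor are in the domain of
`a*(f) ⊗ 𝟙`. -/
lemma exists_creL {f : R3 → ℂ} (hf : MemLp f 2 volume) (ψ : Hil ι) {N : ℕ}
    (hN : ∀ᵐ z ∂confVol.prod confVol, N < z.1.1 → val ψ z.1 z.2 = 0) :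
    ∃ φ, MapsTo (creL f) ψ φ := by
  refine ⟨mkHil (fun z => creation f (fun x => val ψ x z.2) z.1)
    (memLp_creation hf (Lp.memLp (ψ : FullSpace ι)) hN) (creation_symm f ψ),
    mapsTo_of_mem_graph ?_⟩
  rw [graph_creL]
  exact val_mkHil _ _ (creation_symm f ψ)

lemma exists_creL_oneL {f h : R3 → ℂ} (hf : MemLp f 2 volume) (hh : MemLp h 2 volume) (u : KK ι) :
    ∃ φ, MapsTo (creL f) (oneL h hh u) φ := by
  refine exists_creL hf _ (N := 1) ?_
  filter_upwards [val_oneL h hh u] with z hz hlt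
  rw [hz, leftFun_of_notMem _ fun h => by have := h.1; omega]

lemma exists_creL_oneR {f h : R3 → ℂ} (hf : MemLp f 2 volume) (hh : MemLp h 2 volume) (u : KK ι) :
    ∃ φ, MapsTo (creL f) (oneR h hh u) φ := by
  refine exists_creL hf _ (N := 1) ?_
  filter_upwards [val_oneR h hh u] with z hz hlt
  rw [hz, leftFun_of_notMem _ fun h => by have : z.1.1 = 0 := h.2; omega]

lemma creL_vac {f : R3 → ℂ} (hf : MemLp f 2 volume) (u : KK ι) :
    MapsTo (creL f) (vac u) (oneL f hf u) := by
  refine mapsTo_of_mem_graph ?_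
  rw [graph_creL]
  filter_upwards [val_oneL f hf u, ae_creation f (val_vac u)] with z h1 h2
  refine h1.trans (Eq.trans ?_ h2.symm)
  obtain ⟨⟨n, x⟩, ⟨m, y⟩⟩ := z
  match n, m with
  | 0, _ => exact leftFun_of_notMem _ fun h => absurd h.1 (by simp)
  | 1, 0 =>
    have : (((⟨0, Fin.tail x⟩ : Conf), (⟨0, y⟩ : Conf)) : Conf × Conf) ∈ vacSet := ⟨rfl, rfl⟩
    simp [creation, leftFun, Set.indicator_of_mem this]
  | 1, m + 1 =>
    rw [leftFun_of_notMem _ fun h => absurd h.2 (by simp)]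
    simp [creation, vacSet]
  | n + 2, m =>
    rw [leftFun_of_notMem _ fun h => absurd h.1 (by simp)]
    simp [creation, vacSet]

/-- A created vector has no vacuum component; this is the formal identity `a(f) Ω = 0`. -/
lemma hasAdj_creL_vac (f : R3 → ℂ) (u : KK ι) : HasAdj (creL f) (vac u) 0 := by
  intro ψ φ h
  have h1 := h.mem_graph
  rw [graph_creL] at h1
  have h2 : val φ emptyConf emptyConf = 0 := ae_emptyConf h1
  rw [inner_vac, h2, inner_zero_right, inner_zero_left]

end Creation

/-! ### Annihilation operators -/

section Annihilation

variable {ι : Type} [Fintype ι]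

/-- Permits integrability and value to be checked on an explicit representative `F` in place of the
one chosen by `Lp`. -/
lemma mapsTo_annL_of_ae {f : R3 → ℂ} {ψ φ : Hil ι} {F : Conf × Conf → KK ι}
    (hF : ∀ᵐ z ∂confVol.prod confVol, val ψ z.1 z.2 = F z)
    (hint : ∀ z : Conf × Conf, Integrable (annIntegrand f (fun x => F (x, z.2)) z.1))
    (hval : ∀ᵐ z ∂confVol.prod confVol,
      val φ z.1 z.2 = annihilation f (fun x => F (x, z.2)) z.1) :
    MapsTo (annL f) ψ φ := by
  refine mapsTo_of_mem_graph ?_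
  rw [graph_annL]
  filter_upwards [ae_annIntegrand f hF, hval] with z h1 h2
  refine ⟨(hint z).congr h1.symm, h2.trans ?_⟩
  exact congrArg (_ • ·) (integral_congr_ae h1.symm)

/-- The integrand sees `ψ` only at configurations with at least one left particle. Truncating `ψ`
there makes it vanish identically. -/
lemma annL_eq_zero {f : R3 → ℂ} {ψ : Hil ι}
    (h : ∀ᵐ z ∂confVol.prod confVol, z.1.1 ≠ 0 → val ψ z.1 z.2 = 0) : MapsTo (annL f) ψ 0 := by
  have e : ∀ z : Conf × Conf, annIntegrand f (fun x => (fun z : Conf × Conf =>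
      if z.1.1 = 0 then val ψ z.1 z.2 else 0) (x, z.2)) z.1 = 0 := by
    intro z; funext k; simp [annIntegrand]
  refine mapsTo_annL_of_ae (F := fun z => if z.1.1 = 0 then val ψ z.1 z.2 else 0) ?_ ?_ ?_
  · filter_upwards [h] with z hz
    by_cases h0 : z.1.1 = 0 <;> simp [h0, hz]
  · intro z
    rw [e]
    exact integrable_zero _ _ _
  · filter_upwards [Lp.coeFn_zero (KK ι) 2 (confVol.prod confVol)] with z hz
    refine Eq.trans hz ?_
    unfold annihilation
    rw [e]
    simp

lemma annL_vac (f : R3 → ℂ) (u : KK ι) : MapsTo (annL f) (vac u) 0 := by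
  refine annL_eq_zero ?_
  filter_upwards [val_vac u] with z hz h0
  rw [hz, Set.indicator_of_notMem fun h => h0 h.1]

lemma annL_oneR (f : R3 → ℂ) {h : R3 → ℂ} (hh : MemLp h 2 volume) (u : KK ι) :
    MapsTo (annL f) (oneR h hh u) 0 := by
  refine annL_eq_zero ?_
  filter_upwards [val_oneR h hh u] with z hz h0
  rw [hz, leftFun_of_notMem _ fun h => h0 h.2]

lemma annL_oneL {f h : R3 → ℂ} (hf : MemLp f 2 volume) (hh : MemLp h 2 volume) (u : KK ι) :
    MapsTo (annL f) (oneL h hh u) (vac ((∫ k, conj (f k) * h k) • u)) := by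
  have hint : Integrable fun k => conj (f k) * h k := by
    have := hf.star.integrable_mul hh
    exact this
  have e0 : ∀ z ∈ vacSet, annIntegrand f (fun x => leftFun (fun k => h k • u) (x, z.2)) z.1 =
      fun k => (conj (f k) * h k) • u := by
    rintro ⟨⟨n, x⟩, ⟨m, y⟩⟩ ⟨h1, h2⟩
    simp only at h1 h2
    subst h1 h2
    funext k
    simp [annIntegrand, leftFun, smul_smul]
  have e1 : ∀ z ∉ vacSet, annIntegrand f (fun x => leftFun (fun k => h k • u) (x, z.2)) z.1 =
      0 := by
    intro z hz
    funext k
    rw [annIntegrand, leftFun_of_notMem, smul_zero, Pi.zero_apply]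
    intro hm
    exact hz ⟨by simpa using hm.1, hm.2⟩
  refine mapsTo_annL_of_ae (val_oneL h hh u) ?_ ?_
  · intro z
    by_cases hz : z ∈ vacSet
    · rw [e0 z hz]
      exact hint.smul_const u
    · rw [e1 z hz]
      exact integrable_zero _ _ _
  · filter_upwards [val_vac ((∫ k, conj (f k) * h k) • u)] with z hv
    rw [hv]
    unfold annihilation
    by_cases hz : z ∈ vacSet
    · rw [e0 z hz, Set.indicator_of_mem hz, integral_smul_const, hz.1]
      simp
    · rw [e1 z hz, Set.indicator_of_notMem hz]
      simp

/-- At the vacuum configuration the annihilation integral is the pairing of `f` with the left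
one-particle component. The graph of `annL` includes integrability, which lets the inner product
pass under the integral. -/
lemma hasAdj_annL_vac {f : R3 → ℂ} (hf : MemLp f 2 volume) (u : KK ι) :
    HasAdj (annL f) (vac u) (oneL f hf u) := by
  intro ψ φ h
  have h1 := h.mem_graph
  rw [graph_annL] at h1
  obtain ⟨hi, hv⟩ := ae_emptyConf h1
  rw [inner_vac, inner_oneL]
  have e : annIntegrand f (fun x => val ψ x emptyConf) emptyConf =
      fun k => conj (f k) • val ψ (leftConf k).1 (leftConf k).2 := by
    funext k
    have : (⟨emptyConf.1 + 1, Fin.cons k emptyConf.2⟩ : Conf) = (leftConf k).1 := by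
      refine congrArg (Sigma.mk 1) ?_
      funext i
      rw [Subsingleton.elim (α := Fin 1) i 0]
      rfl
    simp only [annIntegrand, this]
    rfl
  simp only at hi hv
  rw [hv]
  unfold annihilation
  rw [e] at hi ⊢
  have : ((√((emptyConf.1 : ℝ) + 1) : ℝ) : ℂ) = 1 := by simp [emptyConf]
  rw [this, one_smul, ← integral_inner hi]
  refine integral_congr_ae (ae_of_all _ fun k => ?_)
  simp only [inner_smul_left, inner_smul_right]

end Annihilation

/-! ### The thermal field and the interaction -/

section Kronecker

variable {κ : Type} [DecidableEq κ]

lemma isHermitian_kronecker_one {G : Matrix κ κ ℂ} (hG : G.IsHermitian) :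
    (G ⊗ₖ (1 : Matrix κ κ ℂ)).IsHermitian := by
  rw [Matrix.IsHermitian, Matrix.conjTranspose_kronecker, hG.eq, Matrix.conjTranspose_one]

lemma isHermitian_one_kronecker {G : Matrix κ κ ℂ} (hG : G.IsHermitian) :
    ((1 : Matrix κ κ ℂ) ⊗ₖ G.map conj).IsHermitian := by
  have h : (G.map conj).IsHermitian := by
    ext i j
    exact congrArg conj (hG.apply i j)
  rw [Matrix.IsHermitian, Matrix.conjTranspose_kronecker, h.eq, Matrix.conjTranspose_one]

end Kronecker

section Field

variable {ι : Type} [Fintype ι]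

lemma MapsTo.onRight {A : Hil ι →ₗ.[ℂ] Hil ι} {ψ φ : Hil ι} (h : MapsTo A (swapFock ψ) φ) :
    MapsTo (onRight A) ψ (swapFock φ) :=
  MapsTo.compPMap (MapsTo.pcomp (mapsTo_toPMap_top (swapFock (ι := ι)).toLinearMap ψ) h) _

lemma HasAdj.onRight {A : Hil ι →ₗ.[ℂ] Hil ι} {x y : Hil ι} (h : HasAdj A (swapFock x) y) :
    HasAdj (onRight A) x (swapFock y) :=
  HasAdj.compPMap (HasAdj.pcomp_toPMap h fun ψ => (inner_swapFock y ψ).symm)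
    fun φ => (inner_swapFock x φ).symm

lemma MapsTo.conjJ {A : Hil ι →ₗ.[ℂ] Hil ι} {ψ φ : Hil ι} (h : MapsTo A (J ψ) φ) :
    MapsTo (conjJ A) ψ (J φ) := by
  have h1 : MapsTo (LevelShift.pcomp A ((J (ι := ι)).toLinearMap.toPMap ⊤) :
      Hil ι →ₛₗ.[starRingEnd ℂ] Hil ι) ψ φ :=
    MapsTo.pcomp (mapsTo_toPMap_top (J (ι := ι)).toLinearMap ψ) h
  exact MapsTo.compPMap h1 _

/-- Formally `(J A J)* = J A* J`. As `J` is antilinear, `HasAdj.compPMap` does not apply; `inner_J`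
is used twice, with complex conjugation in between. -/
lemma HasAdj.conjJ {A : Hil ι →ₗ.[ℂ] Hil ι} {x y : Hil ι} (h : HasAdj A (J x) y) :
    HasAdj (conjJ A) x (J y) := by
  rintro ψ φ ⟨hψ, rfl⟩
  obtain ⟨χ, h1, h2⟩ := exists_mapsTo_of_pcomp (ρ := starRingEnd ℂ) (A := (J (ι := ι)).toLinearMap.toPMap ⊤)
    (B := A) ⟨hψ, rfl⟩
  obtain rfl := h1.unique (mapsTo_toPMap_top (J (ι := ι)).toLinearMap ψ)
  have h3 := h _ _ h2
  have key : ∀ χ : Hil ι, ⟪J x, χ⟫_ℂ = ⟪y, J ψ⟫_ℂ → ⟪x, J χ⟫_ℂ = ⟪J y, ψ⟫_ℂ := fun χ hχ => by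
    rw [inner_J, ← inner_conj_symm (𝕜 := ℂ) χ (J x), hχ, ← inner_conj_symm (𝕜 := ℂ) (J y) ψ,
      inner_J ψ y]
  exact key _ h3

variable {β : ℝ} {g : R3 → ℂ}

/-- The vector `φ_β(g) (u ⊗ Φ_β)`. -/
def fieldVac (hP : MemLp (gPlus β g) 2 volume) (hM : MemLp (gMinus β g) 2 volume) (u : KK ι) :
    Hil ι :=
  ((√2 : ℝ) : ℂ)⁻¹ • (oneL (gPlus β g) hP u + oneR (gMinus β g) hM u)

lemma thermalField_vac (hP : MemLp (gPlus β g) 2 volume) (hM : MemLp (gMinus β g) 2 volume)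
    (u : KK ι) : MapsTo (thermalField β g) (vac u) (fieldVac hP hM u) := by
  have h1 := creL_vac hP u
  have h2 : MapsTo (annR (gMinus β g)) (vac u) (swapFock 0) :=
    MapsTo.onRight ((swapFock_vac u).symm ▸ annL_vac _ u)
  have h3 := annL_vac (gPlus β g) u
  have h4 : MapsTo (creR (gMinus β g)) (vac u) (swapFock (oneL (gMinus β g) hM u)) :=
    MapsTo.onRight ((swapFock_vac u).symm ▸ creL_vac hM u)
  have h5 := (((h1.add h2).add (h3.add h4)).smul (((√2 : ℝ) : ℂ)⁻¹)).closure
  rw [map_zero, add_zero, zero_add] at h5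
  exact h5

/-- Passing to adjoints exchanges the roles of the summands: the annihilation parts now yield the
one-particle vectors and the creation parts yield zero. The outcome is the same vector as in
`thermalField_vac`, which is the symmetry of the field at the vacuum. -/
lemma hasAdj_thermalField_vac (hP : MemLp (gPlus β g) 2 volume)
    (hM : MemLp (gMinus β g) 2 volume) (u : KK ι) :
    HasAdj (thermalField β g) (vac u) (fieldVac hP hM u) := by
  have h1 := hasAdj_creL_vac (gPlus β g) u
  have h2 : HasAdj (annR (gMinus β g)) (vac u) (swapFock (oneL (gMinus β g) hM u)) :=
    HasAdj.onRight ((swapFock_vac u).symm ▸ hasAdj_annL_vac hM u)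
  have h3 := hasAdj_annL_vac hP u
  have h4 : HasAdj (creR (gMinus β g)) (vac u) (swapFock 0) :=
    HasAdj.onRight ((swapFock_vac u).symm ▸ hasAdj_creL_vac _ u)
  have h5 := (((h1.add h2).add (h3.add h4)).smul (((√2 : ℝ) : ℂ)⁻¹)).closure
  rw [map_zero, add_zero, zero_add, map_inv₀, Complex.conj_ofReal,
    add_comm (swapFock _)] at h5
  exact h5

/-- Only membership in the domain matters. The value, with its two-particle part, is never needed
because matrix elements are evaluated by moving the field onto the vacuum. -/
lemma exists_thermalField_oneL (hP : MemLp (gPlus β g) 2 volume)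
    (hM : MemLp (gMinus β g) 2 volume) {h : R3 → ℂ} (hh : MemLp h 2 volume) (u : KK ι) :
    ∃ φ, MapsTo (thermalField β g) (oneL h hh u) φ := by
  obtain ⟨φ₁, h1⟩ := exists_creL_oneL hP hh u
  obtain ⟨φ₂, h2⟩ := exists_creL_oneR hM hh u
  have h3 : MapsTo (annR (gMinus β g)) (oneL h hh u) _ := MapsTo.onRight (annL_oneR _ hh u)
  have h4 : MapsTo (creR (gMinus β g)) (oneL h hh u) _ := MapsTo.onRight h2
  exact ⟨_, (((h1.add h3).add ((annL_oneL hP hh u).add h4)).smul _).closure⟩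

lemma exists_thermalField_oneR (hP : MemLp (gPlus β g) 2 volume)
    (hM : MemLp (gMinus β g) 2 volume) {h : R3 → ℂ} (hh : MemLp h 2 volume) (u : KK ι) :
    ∃ φ, MapsTo (thermalField β g) (oneR h hh u) φ := by
  obtain ⟨φ₁, h1⟩ := exists_creL_oneR hP hh u
  obtain ⟨φ₂, h2⟩ := exists_creL_oneL hM hh u
  have h3 : MapsTo (annR (gMinus β g)) (oneR h hh u) _ :=
    MapsTo.onRight ((swapFock_oneR h hh u).symm ▸ annL_oneL hM hh u)
  have h4 : MapsTo (creR (gMinus β g)) (oneR h hh u) _ :=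
    MapsTo.onRight ((swapFock_oneR h hh u).symm ▸ h2)
  exact ⟨_, (((h1.add h3).add ((annL_oneR _ hh u).add h4)).smul _).closure⟩

lemma smallOp_fieldVac (hP : MemLp (gPlus β g) 2 volume) (hM : MemLp (gMinus β g) 2 volume)
    (A : KK ι →L[ℂ] KK ι) (u : KK ι) :
    smallOp A (fieldVac hP hM u) = fieldVac hP hM (A u) := by
  simp only [fieldVac, map_smul, map_add, oneR, smallOp_swapFock, smallOp_oneL]

/-- The vector `J φ_β(g) J (u ⊗ Φ_β)`. -/
def fieldVacConj (hP : MemLp (gPlus β g) 2 volume) (hM : MemLp (gMinus β g) 2 volume) (u : KK ι) :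
    Hil ι :=
  ((√2 : ℝ) : ℂ)⁻¹ • (oneR (fun k => conj (gPlus β g k)) hP.star u +
    oneL (fun k => conj (gMinus β g k)) hM.star u)

lemma J_fieldVac (hP : MemLp (gPlus β g) 2 volume) (hM : MemLp (gMinus β g) 2 volume) (u : KK ι) :
    J (fieldVac hP hM u) = fieldVacConj hP hM (JS u) := by
  rw [fieldVac, map_smulₛₗ, map_add, J_oneL _ _ hP hP.star (fun _ => rfl),
    J_oneR _ _ hM hM.star (fun _ => rfl), map_inv₀, Complex.conj_ofReal]
  rfl

variable [DecidableEq ι]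

lemma matOp_apply (A : Matrix (ι × ι) (ι × ι) ℂ) (u : KK ι) (q : ι × ι) :
    matOp A u q = ∑ q', A q q' * u q' := rfl

lemma inner_matOp {A : Matrix (ι × ι) (ι × ι) ℂ} (hA : A.IsHermitian) (u w : KK ι) :
    ⟪u, matOp A w⟫_ℂ = ⟪matOp A u, w⟫_ℂ := by
  have h : matOp A = ContinuousLinearMap.adjoint (matOp A) := by
    rw [← ContinuousLinearMap.star_eq_adjoint, matOp, ← map_star]
    exact congrArg _ hA.symm
  conv_rhs => rw [h]
  rw [ContinuousLinearMap.adjoint_inner_left]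

lemma JS_matOp_JS (G : Matrix ι ι ℂ) (u : KK ι) :
    JS (matOp (G ⊗ₖ (1 : Matrix ι ι ℂ)) (JS u)) = matOp ((1 : Matrix ι ι ℂ) ⊗ₖ G.map conj) u := by
  ext q
  have h : ∀ (v : KK ι) (q : ι × ι), JS v q = conj (v (q.2, q.1)) := fun _ _ => rfl
  rw [h, matOp_apply, matOp_apply, map_sum, ← Equiv.sum_comp (Equiv.prodComm ι ι)]
  refine Finset.sum_congr rfl fun q' _ => ?_
  simp only [h, Equiv.prodComm_apply, Prod.fst_swap, Prod.snd_swap, map_mul,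
    Matrix.kroneckerMap_apply, Matrix.map_apply, Complex.conj_conj, Matrix.one_apply,
    apply_ite conj, map_one, map_zero]
  rw [mul_comm (conj _)]

variable {G : Matrix ι ι ℂ}

lemma MapsTo.V {ψ φ : Hil ι} (h : MapsTo (thermalField β g) ψ φ) :
    MapsTo (V G β g) ψ (smallOp (matOp (G ⊗ₖ (1 : Matrix ι ι ℂ))) φ) :=
  (h.compPMap (smallOp (matOp (G ⊗ₖ (1 : Matrix ι ι ℂ)))).toLinearMap).closure

lemma V_vac (hP : MemLp (gPlus β g) 2 volume) (hM : MemLp (gMinus β g) 2 volume) (u : KK ι) :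
    MapsTo (V G β g) (vac u) (fieldVac hP hM (matOp (G ⊗ₖ (1 : Matrix ι ι ℂ)) u)) := by
  rw [← smallOp_fieldVac]
  exact (thermalField_vac hP hM u).V

lemma hasAdj_V_vac (hG : G.IsHermitian) (hP : MemLp (gPlus β g) 2 volume)
    (hM : MemLp (gMinus β g) 2 volume) (u : KK ι) :
    HasAdj (V G β g) (vac u) (fieldVac hP hM (matOp (G ⊗ₖ (1 : Matrix ι ι ℂ)) u)) := by
  refine HasAdj.closure (HasAdj.compPMap (hasAdj_thermalField_vac hP hM _) fun φ => ?_)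
  have h := ae_emptyConf (val_smallOp (matOp (G ⊗ₖ (1 : Matrix ι ι ℂ))) φ)
  rw [inner_vac, inner_vac]
  refine (congrArg (inner ℂ u) h).trans ?_
  exact inner_matOp (isHermitian_kronecker_one hG) _ _

/-- The vector `I (u ⊗ Φ_β)`. -/
def intVac (G : Matrix ι ι ℂ) (hP : MemLp (gPlus β g) 2 volume)
    (hM : MemLp (gMinus β g) 2 volume) (u : KK ι) : Hil ι :=
  fieldVac hP hM (matOp (G ⊗ₖ (1 : Matrix ι ι ℂ)) u) -
    fieldVacConj hP hM (matOp ((1 : Matrix ι ι ℂ) ⊗ₖ G.map conj) u)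

lemma interaction_vac (hP : MemLp (gPlus β g) 2 volume) (hM : MemLp (gMinus β g) 2 volume)
    (u : KK ι) : MapsTo (interaction G β g) (vac u) (intVac G hP hM u) := by
  refine (V_vac hP hM u).sub ?_
  rw [← JS_matOp_JS, ← J_fieldVac]
  refine MapsTo.conjJ ?_
  rw [J_vac]
  exact V_vac hP hM _

lemma hasAdj_interaction_vac (hG : G.IsHermitian) (hP : MemLp (gPlus β g) 2 volume)
    (hM : MemLp (gMinus β g) 2 volume) (u : KK ι) :
    HasAdj (interaction G β g) (vac u) (intVac G hP hM u) := by
  refine (hasAdj_V_vac hG hP hM u).sub ?_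
  rw [← JS_matOp_JS, ← J_fieldVac]
  refine HasAdj.conjJ ?_
  rw [J_vac]
  exact hasAdj_V_vac hG hP hM _

lemma exists_interaction_oneL (hP : MemLp (gPlus β g) 2 volume)
    (hM : MemLp (gMinus β g) 2 volume) {h : R3 → ℂ} (hh : MemLp h 2 volume) (u : KK ι) :
    ∃ φ, MapsTo (interaction G β g) (oneL h hh u) φ := by
  obtain ⟨φ₁, h1⟩ := exists_thermalField_oneL hP hM hh u
  obtain ⟨φ₂, h2⟩ := exists_thermalField_oneR hP hM (h := fun k => conj (h k)) hh.star (JS u)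
  rw [← J_oneL h (fun k => conj (h k)) hh hh.star (fun _ => rfl)] at h2
  exact ⟨_, h1.V.sub h2.V.conjJ⟩

lemma exists_interaction_oneR (hP : MemLp (gPlus β g) 2 volume)
    (hM : MemLp (gMinus β g) 2 volume) {h : R3 → ℂ} (hh : MemLp h 2 volume) (u : KK ι) :
    ∃ φ, MapsTo (interaction G β g) (oneR h hh u) φ := by
  obtain ⟨φ₁, h1⟩ := exists_thermalField_oneR hP hM hh u
  obtain ⟨φ₂, h2⟩ := exists_thermalField_oneL hP hM (h := fun k => conj (h k)) hh.star (JS u)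
  rw [← J_oneR h (fun k => conj (h k)) hh hh.star (fun _ => rfl)] at h2
  exact ⟨_, h1.V.sub h2.V.conjJ⟩

end Field

/-! ### The Liouville operator and its reduced resolvent -/

section Liouville

variable {ι : Type} [Fintype ι]

lemma hil_inner_smul_left (c : ℂ) (a b : Hil ι) : ⟪c • a, b⟫_ℂ = conj c * ⟪a, b⟫_ℂ :=
  inner_smul_left a b c

lemma hil_inner_smul_right (c : ℂ) (a b : Hil ι) : ⟪a, c • b⟫_ℂ = c * ⟪a, b⟫_ℂ :=
  inner_smul_right a b c

lemma energy_emptyConf : energy emptyConf = 0 := by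
  have : (∑ j : Fin 0, ‖(Fin.elim0 j : R3)‖) = 0 := by simp
  exact this

lemma energy_leftConf (k : R3) : energy (leftConf k).1 = ‖k‖ := by
  have : (∑ j : Fin 1, ‖(fun _ : Fin 1 => k) j‖) = ‖k‖ := by simp
  exact this

lemma LR_oneL {h h' : R3 → ℂ} (hh : MemLp h 2 volume) (hh' : MemLp h' 2 volume)
    (e : ∀ k, h' k = (‖k‖ : ℂ) * h k) (u : KK ι) : MapsTo LR (oneL h hh u) (oneL h' hh' u) := by
  refine mapsTo_of_mem_graph ?_
  rw [graph_LR]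
  filter_upwards [val_oneL h hh u, val_oneL h' hh' u] with z h1 h2
  refine h2.trans (Eq.trans ?_ (congrArg (_ • ·) h1.symm))
  by_cases hz : z ∈ leftSet
  · obtain ⟨k, rfl⟩ := exists_leftConf hz
    have h0 : energy (leftConf k).2 = 0 := energy_emptyConf
    simp only [leftFun_leftConf, energy_leftConf, h0, sub_zero, e, smul_smul]
  · simp only [leftFun_of_notMem _ hz, smul_zero]

lemma LR_oneR {h h' : R3 → ℂ} (hh : MemLp h 2 volume) (hh' : MemLp h' 2 volume)
    (e : ∀ k, h' k = -(‖k‖ : ℂ) * h k) (u : KK ι) : MapsTo LR (oneR h hh u) (oneR h' hh' u) := by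
  refine mapsTo_of_mem_graph ?_
  rw [graph_LR]
  filter_upwards [val_oneR h hh u, val_oneR h' hh' u] with z h1 h2
  refine h2.trans (Eq.trans ?_ (congrArg (_ • ·) h1.symm))
  by_cases hz : z.swap ∈ leftSet
  · obtain ⟨k, hk⟩ := exists_leftConf hz
    have h0 : energy z.1 = 0 := by
      have : z.1 = emptyConf := congrArg Prod.snd hk
      rw [this, energy_emptyConf]
    have h3 : energy z.2 = ‖k‖ := by
      have : z.2 = (leftConf k).1 := congrArg Prod.fst hk
      rw [this, energy_leftConf]
    rw [hk]
    simp only [leftFun_leftConf, h3, h0, zero_sub, e, smul_smul, Complex.ofReal_neg]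
  · simp only [leftFun_of_notMem _ hz, smul_zero]

/-- `LR` multiplies by a real function. -/
lemma inner_LR_self {ψ φ : Hil ι} (h : MapsTo LR ψ φ) : ⟪ψ, φ⟫_ℂ = ⟪φ, ψ⟫_ℂ := by
  have h1 := h.mem_graph
  rw [graph_LR] at h1
  rw [inner_eq_integral, inner_eq_integral]
  refine integral_congr_ae ?_
  filter_upwards [h1] with z hz
  have hz' : val φ z.1 z.2 = ((energy z.1 - energy z.2 : ℝ) : ℂ) • val ψ z.1 z.2 := hz
  rw [hz', inner_smul_left, inner_smul_right, Complex.conj_ofReal]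

variable [DecidableEq ι] (e : ℝ)

lemma LS_const : LS (fun _ : ι => e) = 0 := by
  have h : ham (fun _ : ι => e) = (e : ℂ) • (1 : Matrix ι ι ℂ) := by
    rw [Matrix.smul_one_eq_diagonal]
    rfl
  rw [LS, h, Matrix.smul_kronecker, Matrix.kronecker_smul, sub_self, matOp, map_zero]

lemma eigS_const : eigS (fun _ : ι => e) 0 = ⊤ := by
  rw [eigS, LS_const]
  ext v
  simp

lemma L0_const {ψ φ : Hil ι} (h : MapsTo LR ψ φ) : MapsTo (L0 (fun _ : ι => e)) ψ φ := by
  have h1 := (mapsTo_toPMap_top (smallOp (LS fun _ : ι => e)).toLinearMap ψ).add h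
  have h2 : smallOp (LS fun _ : ι => e) ψ = 0 := by
    refine ext_val ?_
    rw [LS_const]
    filter_upwards [val_smallOp (0 : KK ι →L[ℂ] KK ι) ψ,
      Lp.coeFn_zero (KK ι) 2 (confVol.prod confVol)] with z h3 h4
    exact h3.trans h4.symm
  have h5 : (smallOp (LS fun _ : ι => e)).toLinearMap ψ + φ = φ := by
    exact (congrArg (· + φ) h2).trans (zero_add φ)
  rw [h5] at h1
  exact h1

lemma P_const : P (fun _ : ι => e) 0 = (LinearMap.range (vac (ι := ι))).starProjection := by
  have h : (eigS (fun _ : ι => e) 0).map vac = LinearMap.range (vac (ι := ι)) := by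
    rw [eigS_const, Submodule.map_top]
  unfold P
  congr 1

lemma P_vac (u : KK ι) : P (fun _ : ι => e) 0 (vac u) = vac u := by
  rw [P_const]
  exact Submodule.starProjection_eq_self_iff.2 ⟨u, rfl⟩

lemma exists_P_eq_vac (ψ : Hil ι) : ∃ u, P (fun _ : ι => e) 0 ψ = vac u := by
  have h := Submodule.starProjection_apply_mem (LinearMap.range (vac (ι := ι))) ψ
  rw [← P_const e] at h
  obtain ⟨u, hu⟩ := h
  exact ⟨u, hu.symm⟩

lemma inner_P (a b : Hil ι) :
    ⟪P (fun _ : ι => e) 0 a, b⟫_ℂ = ⟪a, P (fun _ : ι => e) 0 b⟫_ℂ := by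
  rw [P_const]
  exact Submodule.inner_starProjection_left_eq_right _ a b

lemma P_eq_zero {ψ : Hil ι} (h : ∀ u, ⟪vac u, ψ⟫_ℂ = 0) : P (fun _ : ι => e) 0 ψ = 0 := by
  rw [P_const, Submodule.starProjection_apply_eq_zero_iff, Submodule.mem_orthogonal]
  rintro _ ⟨u, rfl⟩
  exact h u

lemma Pbar_eq_self {ψ : Hil ι} (h : ∀ u, ⟪vac u, ψ⟫_ℂ = 0) : Pbar (fun _ : ι => e) 0 ψ = ψ := by
  have : Pbar (fun _ : ι => e) 0 ψ = ψ - P (fun _ : ι => e) 0 ψ := rfl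
  rw [this, P_eq_zero e h, sub_zero]

lemma inner_Pbar (a b : Hil ι) :
    ⟪Pbar (fun _ : ι => e) 0 a, b⟫_ℂ = ⟪a, Pbar (fun _ : ι => e) 0 b⟫_ℂ := by
  have h : ∀ ψ, Pbar (fun _ : ι => e) 0 ψ = ψ - P (fun _ : ι => e) 0 ψ := fun _ => rfl
  rw [h, h, inner_sub_left, inner_sub_right, inner_P]

lemma Pbar_Pbar (ψ : Hil ι) :
    Pbar (fun _ : ι => e) 0 (Pbar (fun _ : ι => e) 0 ψ) = Pbar (fun _ : ι => e) 0 ψ := by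
  refine Pbar_eq_self e fun u => ?_
  rw [← inner_Pbar]
  have : Pbar (fun _ : ι => e) 0 (vac u) = vac u - P (fun _ : ι => e) 0 (vac u) := rfl
  rw [this, P_vac, sub_self, inner_zero_left]

lemma finrank_range_P :
    Module.finrank ℂ (LinearMap.range (P (fun _ : ι => e) 0).toLinearMap) =
      Fintype.card ι * Fintype.card ι := by
  have h : LinearMap.range (P (fun _ : ι => e) 0).toLinearMap = LinearMap.range (vac (ι := ι)) := by
    apply le_antisymm
    · rintro _ ⟨ψ, rfl⟩
      obtain ⟨u, hu⟩ := exists_P_eq_vac e ψ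
      exact ⟨u, hu.symm⟩
    · rintro _ ⟨u, rfl⟩
      exact ⟨vac u, P_vac e u⟩
  rw [h, LinearMap.finrank_range_of_inj vac_injective, finrank_euclideanSpace, Fintype.card_prod]

lemma mapsTo_L0_const_inner {ψ φ : Hil ι} (h : MapsTo (L0 (fun _ : ι => e)) ψ φ) :
    ⟪ψ, φ⟫_ℂ = ⟪φ, ψ⟫_ℂ := by
  have h1 : MapsTo LR ψ (LR ⟨ψ, h.1.2⟩) := ⟨h.1.2, rfl⟩
  rw [h.unique (L0_const e h1)]
  exact inner_LR_self h1

/-- A symmetric operator has no nonreal eigenvalue: pairing the eigenvalue equation with `ψ` gives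
`2iε ‖ψ‖² = 0`. Injectivity is what makes `LinearPMap.inverse` a genuine inverse. -/
lemma ker_L0bar_sub {ε : ℝ} (hε : ε ≠ 0) :
    LinearMap.ker (L0bar (fun _ : ι => e) 0 - ((((0 : ℝ) : ℂ) + Complex.I * ε) •
      (LinearMap.id : Hil ι →ₗ[ℂ] Hil ι)).toPMap ⊤).toFun = ⊥ := by
  rw [LinearMap.ker_eq_bot']
  rintro ⟨ψ, ⟨hψ, hL'⟩, hT⟩ h0
  have hL : ψ ∈ (L0 (fun _ : ι => e)).domain := hL'
  have h2 : Pbar (fun _ : ι => e) 0 (L0 (fun _ : ι => e) ⟨ψ, hL⟩) =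
      (((0 : ℝ) : ℂ) + Complex.I * ε) • ψ := sub_eq_zero.1 h0
  obtain ⟨χ, hχ⟩ := hψ
  have h3 : Pbar (fun _ : ι => e) 0 ψ = ψ := by
    rw [← hχ]
    exact Pbar_Pbar e χ
  have h4 := mapsTo_L0_const_inner e (⟨hL, rfl⟩ : MapsTo (L0 (fun _ : ι => e)) ψ _)
  have h5 : ⟪ψ, (((0 : ℝ) : ℂ) + Complex.I * ε) • ψ⟫_ℂ =
      ⟪(((0 : ℝ) : ℂ) + Complex.I * ε) • ψ, ψ⟫_ℂ := by
    -- Since `ψ` lies in the range of the projection, the projection can be dropped from both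
    -- pairings.
    rw [← h2, ← inner_Pbar, inner_Pbar e _ ψ, h3]
    exact h4
  rw [hil_inner_smul_left, hil_inner_smul_right] at h5
  have h6 : (2 * Complex.I * ε) * ⟪ψ, ψ⟫_ℂ = 0 := by
    simp only [map_add, map_mul, Complex.conj_ofReal, Complex.conj_I] at h5
    linear_combination h5
  have h7 : ⟪ψ, ψ⟫_ℂ = 0 := by
    refine (mul_eq_zero.1 h6).resolve_left ?_
    simp [hε]
  exact Subtype.ext (inner_self_eq_zero.1 h7)

/-- By injectivity it is enough to exhibit a solution `χ` of `(L_R - iε) χ = f`. The orthogonality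
conditions make the projections in `L0bar` act trivially. -/
lemma redResolvent_of_L0 {ε : ℝ} (hε : ε ≠ 0) {χ φ f : Hil ι}
    (hχ : ∀ u, ⟪vac u, χ⟫_ℂ = 0) (hφ : ∀ u, ⟪vac u, φ⟫_ℂ = 0) (h : MapsTo LR χ φ)
    (hf : φ - (((0 : ℝ) : ℂ) + Complex.I * ε) • χ = f) :
    MapsTo (redResolvent (fun _ : ι => e) 0 (((0 : ℝ) : ℂ) + Complex.I * ε)) f χ := by
  have h1 := (L0_const e h).compPMap (Pbar (fun _ : ι => e) 0).toLinearMap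
  have h2 := h1.domRestrict (S := LinearMap.range (Pbar (fun _ : ι => e) 0).toLinearMap)
    ⟨χ, Pbar_eq_self e hχ⟩
  have h3 := h2.sub (mapsTo_toPMap_top ((((0 : ℝ) : ℂ) + Complex.I * ε) •
      (LinearMap.id : Hil ι →ₗ[ℂ] Hil ι)) χ)
  have h4 := MapsTo.inverse h3 (ker_L0bar_sub e hε)
  have h5 : (Pbar (fun _ : ι => e) 0).toLinearMap φ -
      ((((0 : ℝ) : ℂ) + Complex.I * ε) • (LinearMap.id : Hil ι →ₗ[ℂ] Hil ι)) χ = f := by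
    rw [← hf]
    exact congrArg (· - _) (Pbar_eq_self e hφ)
  rw [h5] at h4
  exact h4

/-- `f(k) / (s |k| - iε)`. -/
def resolved (s ε : ℝ) (f : R3 → ℂ) (k : R3) : ℂ := f k / ((s * ‖k‖ : ℝ) - Complex.I * ε)

lemma denominator_ne_zero (r : ℝ) {ε : ℝ} (hε : ε ≠ 0) : (r : ℂ) - Complex.I * ε ≠ 0 := by
  intro h
  have := congrArg Complex.im h
  simp at this
  exact hε this

lemma memLp_resolved (s : ℝ) {ε : ℝ} (hε : ε ≠ 0) {f : R3 → ℂ} (hf : MemLp f 2 volume) :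
    MemLp (resolved s ε f) 2 volume := by
  refine hf.of_le_mul (c := |ε|⁻¹) ?_ (ae_of_all _ fun k => ?_)
  · refine (hf.1.aemeasurable.div (Measurable.aemeasurable ?_)).aestronglyMeasurable
    fun_prop
  · have h1 : |ε| ≤ ‖((s * ‖k‖ : ℝ) : ℂ) - Complex.I * ε‖ := by
      have := Complex.abs_im_le_norm (((s * ‖k‖ : ℝ) : ℂ) - Complex.I * ε)
      simpa using this
    have h2 : 0 < |ε| := abs_pos.2 hε
    rw [resolved, norm_div, div_eq_inv_mul]
    gcongr

lemma redResolvent_oneL {ε : ℝ} (hε : ε ≠ 0) {f : R3 → ℂ} (hf : MemLp f 2 volume) (u : KK ι) :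
    MapsTo (redResolvent (fun _ : ι => e) 0 (((0 : ℝ) : ℂ) + Complex.I * ε)) (oneL f hf u)
      (oneL (resolved 1 ε f) (memLp_resolved 1 hε hf) u) := by
  have hr := memLp_resolved 1 hε hf
  -- This function equals `|k|` times the resolved one. Written as `f + iε · resolved` it is visibly
  -- square integrable, although `|k|` is unbounded.
  have hr' : MemLp (fun k => f k + (Complex.I * ε) * resolved 1 ε f k) 2 volume :=
    hf.add (hr.const_mul _)
  refine redResolvent_of_L0 e hε (fun v => inner_vac_oneL _ _ _ _)
    (fun v => inner_vac_oneL _ hr' u v) (LR_oneL hr hr' (fun k => ?_) u) ?_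
  · have := denominator_ne_zero (1 * ‖k‖) hε
    rw [resolved]
    generalize hd : (((1 * ‖k‖ : ℝ) : ℂ) - Complex.I * ε) = d at this
    have hk : (‖k‖ : ℂ) = 1 * (d + Complex.I * ε) := by
      rw [← hd]; push_cast; ring
    rw [hk]
    field_simp
  · rw [sub_eq_add_neg, ← neg_smul, ← one_smul ℂ (oneL _ hr' u)]
    exact oneL_comb _ _ _ _ _ hr' hr hf (fun k => by push_cast; ring) u

lemma redResolvent_oneR {ε : ℝ} (hε : ε ≠ 0) {f : R3 → ℂ} (hf : MemLp f 2 volume) (u : KK ι) :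
    MapsTo (redResolvent (fun _ : ι => e) 0 (((0 : ℝ) : ℂ) + Complex.I * ε)) (oneR f hf u)
      (oneR (resolved (-1) ε f) (memLp_resolved (-1) hε hf) u) := by
  have hr := memLp_resolved (-1) hε hf
  have hr' : MemLp (fun k => f k + (Complex.I * ε) * resolved (-1) ε f k) 2 volume :=
    hf.add (hr.const_mul _)
  refine redResolvent_of_L0 e hε (fun v => inner_vac_oneR _ _ _ _)
    (fun v => inner_vac_oneR _ hr' u v) (LR_oneR hr hr' (fun k => ?_) u) ?_
  · have := denominator_ne_zero (-1 * ‖k‖) hε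
    rw [resolved]
    generalize hd : (((-1 * ‖k‖ : ℝ) : ℂ) - Complex.I * ε) = d at this
    have hk : (‖k‖ : ℂ) = -1 * (d + Complex.I * ε) := by
      rw [← hd]; push_cast; ring
    rw [hk]
    field_simp
  · rw [sub_eq_add_neg, ← neg_smul, ← one_smul ℂ (oneR _ hr' u)]
    exact oneR_comb _ _ _ _ _ hr' hr hf (fun k => by push_cast; ring) u

end Liouville

/-! ### The regularized level shift operator -/

section LevelShiftForm

variable {ι : Type} [Fintype ι] [DecidableEq ι] (e : ℝ) {G : Matrix ι ι ℂ} {β : ℝ} {g : R3 → ℂ}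

/-- The vector `(L̄₀ - iε)⁻¹ I (u ⊗ Φ_β)`. -/
def resIntVac (G : Matrix ι ι ℂ) (hP : MemLp (gPlus β g) 2 volume)
    (hM : MemLp (gMinus β g) 2 volume) {ε : ℝ} (hε : ε ≠ 0) (u : KK ι) : Hil ι :=
  ((√2 : ℝ) : ℂ)⁻¹ • (oneL _ (memLp_resolved 1 hε hP) (matOp (G ⊗ₖ (1 : Matrix ι ι ℂ)) u) +
      oneR _ (memLp_resolved (-1) hε hM) (matOp (G ⊗ₖ (1 : Matrix ι ι ℂ)) u)) +
    (-1 : ℂ) • ((√2 : ℝ) : ℂ)⁻¹ •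
      (oneR _ (memLp_resolved (-1) hε hP.star) (matOp ((1 : Matrix ι ι ℂ) ⊗ₖ G.map conj) u) +
      oneL _ (memLp_resolved 1 hε hM.star) (matOp ((1 : Matrix ι ι ℂ) ⊗ₖ G.map conj) u))

lemma redResolvent_intVac (hP : MemLp (gPlus β g) 2 volume) (hM : MemLp (gMinus β g) 2 volume)
    {ε : ℝ} (hε : ε ≠ 0) (u : KK ι) :
    MapsTo (redResolvent (fun _ : ι => e) 0 (((0 : ℝ) : ℂ) + Complex.I * ε))
      (intVac G hP hM u) (resIntVac G hP hM hε u) := by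
  have h := (((redResolvent_oneL e hε hP (matOp (G ⊗ₖ (1 : Matrix ι ι ℂ)) u)).add_vec
    (redResolvent_oneR e hε hM (matOp (G ⊗ₖ (1 : Matrix ι ι ℂ)) u))).smul_vec
      (((√2 : ℝ) : ℂ)⁻¹)).add_vec
    ((((redResolvent_oneR e hε hP.star (matOp ((1 : Matrix ι ι ℂ) ⊗ₖ G.map conj) u)).add_vec
    (redResolvent_oneL e hε hM.star (matOp ((1 : Matrix ι ι ℂ) ⊗ₖ G.map conj) u))).smul_vec
      (((√2 : ℝ) : ℂ)⁻¹)).smul_vec (-1))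
  rw [intVac, sub_eq_add_neg, ← neg_one_smul ℂ (fieldVacConj hP hM _)]
  exact h

lemma exists_interaction_resIntVac (hP : MemLp (gPlus β g) 2 volume)
    (hM : MemLp (gMinus β g) 2 volume) {ε : ℝ} (hε : ε ≠ 0) (u : KK ι) :
    ∃ φ, MapsTo (interaction G β g) (resIntVac G hP hM hε u) φ := by
  obtain ⟨φ₁, h1⟩ := exists_interaction_oneL (G := G) hP hM (memLp_resolved 1 hε hP)
    (matOp (G ⊗ₖ (1 : Matrix ι ι ℂ)) u)
  obtain ⟨φ₂, h2⟩ := exists_interaction_oneR (G := G) hP hM (memLp_resolved (-1) hε hM)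
    (matOp (G ⊗ₖ (1 : Matrix ι ι ℂ)) u)
  obtain ⟨φ₃, h3⟩ := exists_interaction_oneR (G := G) hP hM (memLp_resolved (-1) hε hP.star)
    (matOp ((1 : Matrix ι ι ℂ) ⊗ₖ G.map conj) u)
  obtain ⟨φ₄, h4⟩ := exists_interaction_oneL (G := G) hP hM (memLp_resolved 1 hε hM.star)
    (matOp ((1 : Matrix ι ι ℂ) ⊗ₖ G.map conj) u)
  exact ⟨_, ((h1.add_vec h2).smul_vec _).add_vec (((h3.add_vec h4).smul_vec _).smul_vec _)⟩

/-- `I` maps the vacuum space into the one-particle sectors, so `P̄_0` acts trivially on the image.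
-/
lemma inner_vac_intVac (hP : MemLp (gPlus β g) 2 volume) (hM : MemLp (gMinus β g) 2 volume)
    (u v : KK ι) : ⟪vac v, intVac G hP hM u⟫_ℂ = 0 := by
  simp only [intVac, fieldVac, fieldVacConj, inner_sub_right, hil_inner_smul_right, inner_add_right,
    inner_vac_oneL, inner_vac_oneR]
  simp

lemma inner_vac_resIntVac (hP : MemLp (gPlus β g) 2 volume) (hM : MemLp (gMinus β g) 2 volume)
    {ε : ℝ} (hε : ε ≠ 0) (u v : KK ι) : ⟪vac v, resIntVac G hP hM hε u⟫_ℂ = 0 := by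
  simp only [resIntVac, hil_inner_smul_right, inner_add_right, inner_vac_oneL, inner_vac_oneR]
  simp

/-- Every factor is followed explicitly up to the last `I`, whose value is only known to exist; its
vacuum components come from `hasAdj_interaction_vac`. Allowing any `ψ` with projection `vac w`
covers the full domain as well as the matrix elements. -/
lemma exists_Lam (hG : G.IsHermitian) (hP : MemLp (gPlus β g) 2 volume)
    (hM : MemLp (gMinus β g) 2 volume) {ε : ℝ} (hε : ε ≠ 0) {ψ : Hil ι} {w : KK ι}
    (hw : P (fun _ : ι => e) 0 ψ = vac w) :
    ∃ φ, MapsTo (Lam (fun _ : ι => e) G β g 0 ε) ψ φ ∧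
      ∀ u, ⟪vac u, φ⟫_ℂ = ⟪intVac G hP hM u, resIntVac G hP hM hε w⟫_ℂ := by
  obtain ⟨φ, hφ⟩ := exists_interaction_resIntVac (G := G) hP hM hε w
  refine ⟨P (fun _ : ι => e) 0 φ, ?_, fun u => ?_⟩
  · have h1 := mapsTo_toPMap_top (P (fun _ : ι => e) 0).toLinearMap ψ
    have h1' : MapsTo ((P (fun _ : ι => e) 0).toLinearMap.toPMap ⊤) ψ (vac w) := hw ▸ h1
    have h2 : MapsTo (LevelShift.pcomp (interaction G β g)
        ((P (fun _ : ι => e) 0).toLinearMap.toPMap ⊤) : Hil ι →ₗ.[ℂ] Hil ι) ψ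
        (intVac G hP hM w) := h1'.pcomp (interaction_vac hP hM w)
    have h3 : MapsTo ((Pbar (fun _ : ι => e) 0).toLinearMap.compPMap
        (LevelShift.pcomp (interaction G β g)
        ((P (fun _ : ι => e) 0).toLinearMap.toPMap ⊤) : Hil ι →ₗ.[ℂ] Hil ι) :
          Hil ι →ₗ.[ℂ] Hil ι) ψ (Pbar (fun _ : ι => e) 0 (intVac G hP hM w)) :=
      h2.compPMap _
    rw [Pbar_eq_self e fun v => inner_vac_intVac hP hM w v] at h3
    have h4 := MapsTo.pcomp (ρ := RingHom.id ℂ) h3 (redResolvent_intVac e hP hM hε w)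
    have h5 := h4.compPMap (ρ := RingHom.id ℂ) (Pbar (fun _ : ι => e) 0).toLinearMap
    have h6 : (Pbar (fun _ : ι => e) 0).toLinearMap (resIntVac G hP hM hε w) =
        resIntVac G hP hM hε w := Pbar_eq_self e fun v => inner_vac_resIntVac hP hM hε w v
    rw [h6] at h5
    have h7 := MapsTo.pcomp (ρ := RingHom.id ℂ) h5 hφ
    exact h7.compPMap (P (fun _ : ι => e) 0).toLinearMap
  · rw [← inner_P, P_vac]
    exact hasAdj_interaction_vac hG hP hM u _ _ hφ

lemma Lam_domain (hG : G.IsHermitian) (hP : MemLp (gPlus β g) 2 volume)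
    (hM : MemLp (gMinus β g) 2 volume) {ε : ℝ} (hε : ε ≠ 0) :
    (Lam (fun _ : ι => e) G β g 0 ε).domain = ⊤ := by
  rw [eq_top_iff]
  intro ψ _
  obtain ⟨w, hw⟩ := exists_P_eq_vac e ψ
  obtain ⟨φ, ⟨h, _⟩, _⟩ := exists_Lam e hG hP hM hε hw
  exact h

lemma lamForm_eq_inner (hG : G.IsHermitian) (hP : MemLp (gPlus β g) 2 volume)
    (hM : MemLp (gMinus β g) 2 volume) {ε : ℝ} (hε : ε ≠ 0) (u w : KK ι) :
    lamForm (fun _ : ι => e) G β g 0 ε u w =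
      ⟪intVac G hP hM u, resIntVac G hP hM hε w⟫_ℂ := by
  obtain ⟨φ, ⟨h, rfl⟩, h2⟩ := exists_Lam e hG hP hM hε (P_vac e w)
  rw [lamForm, dif_pos h, h2]

end LevelShiftForm

/-! ### The matrix elements as integrals -/

section Coefficients

variable {β : ℝ} {g : R3 → ℂ}

lemma rho_nonneg (hβ : 0 < β) (k : R3) : 0 ≤ rho β k :=
  inv_nonneg.2 (sub_nonneg.2 (Real.one_le_exp (by positivity)))

/-- `1 + 2ρ`. -/
def cothWeight (β : ℝ) (k : R3) : ℝ := 1 + 2 * rho β k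

/-- `2 √(ρ (1 + ρ))`. -/
def cschWeight (β : ℝ) (k : R3) : ℝ := 2 * (√(rho β k) * √(1 + rho β k))

/-- `∫ |g|² |k| / (|k|² + ε²)`. -/
def dispersiveIntegral (g : R3 → ℂ) (ε : ℝ) : ℝ :=
  ∫ k, ‖g k‖ ^ 2 * (‖k‖ / (‖k‖ ^ 2 + ε ^ 2))

/-- `∫ |g|² θ ε / (|k|² + ε²)`. -/
def absorptiveIntegral (g : R3 → ℂ) (θ : R3 → ℝ) (ε : ℝ) : ℝ :=
  ∫ k, ‖g k‖ ^ 2 * θ k * (ε / (‖k‖ ^ 2 + ε ^ 2))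

lemma sq_sqrt_rho (hβ : 0 < β) (k : R3) : ((√(rho β k) : ℝ) : ℂ) ^ 2 = rho β k := by
  rw [← Complex.ofReal_pow, Real.sq_sqrt (rho_nonneg hβ k)]

lemma sq_sqrt_one_add_rho (hβ : 0 < β) (k : R3) :
    ((√(1 + rho β k) : ℝ) : ℂ) ^ 2 = 1 + rho β k := by
  rw [← Complex.ofReal_pow, Real.sq_sqrt (by linarith [rho_nonneg hβ k])]
  push_cast
  rfl

lemma resolved_one {ε : ℝ} (hε : ε ≠ 0) (f : R3 → ℂ) (k : R3) :
    resolved 1 ε f k =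
      f k * ((‖k‖ + Complex.I * ε) * ((‖k‖ : ℂ) ^ 2 + (ε : ℂ) ^ 2)⁻¹) := by
  have h1 := denominator_ne_zero (1 * ‖k‖) hε
  have h2 : ((‖k‖ : ℂ) ^ 2 + (ε : ℂ) ^ 2) ≠ 0 := by
    have : ‖k‖ ^ 2 + ε ^ 2 ≠ 0 := by positivity
    exact_mod_cast this
  rw [resolved, div_eq_mul_inv]
  congr 1
  rw [inv_eq_iff_eq_inv, mul_inv, inv_inv, eq_comm, inv_mul_eq_iff_eq_mul₀]
  · push_cast
    linear_combination ((ε : ℂ) ^ 2) * Complex.I_sq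
  · intro h
    have h3 : (‖k‖ + Complex.I * ε) * (((1 * ‖k‖ : ℝ) : ℂ) - Complex.I * ε) = 0 := by
      rw [h, zero_mul]
    refine h2 ?_
    push_cast at h3
    linear_combination h3 + (ε : ℂ) ^ 2 * Complex.I_sq

lemma resolved_neg_one {ε : ℝ} (hε : ε ≠ 0) (f : R3 → ℂ) (k : R3) :
    resolved (-1) ε f k =
      f k * ((-‖k‖ + Complex.I * ε) * ((‖k‖ : ℂ) ^ 2 + (ε : ℂ) ^ 2)⁻¹) := by
  have e : resolved (-1) ε f k = -resolved 1 (-ε) f k := by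
    have h2 : (((-1 * ‖k‖ : ℝ) : ℂ) - Complex.I * ε) =
        -(((1 * ‖k‖ : ℝ) : ℂ) - Complex.I * ((-ε : ℝ) : ℂ)) := by
      push_cast; ring
    rw [resolved, resolved, h2, div_neg]
  rw [e, resolved_one (neg_ne_zero.2 hε)]
  push_cast
  ring

/-- The weights `1 + ρ` and `ρ` meet opposite energies `|k|` and `-|k|`. The real parts subtract,
`(1 + ρ) - ρ = 1`, so the temperature drops out of them; the imaginary parts add to `1 + 2ρ`. -/
lemma diagonal_coefficient (hβ : 0 < β) {ε : ℝ} (hε : ε ≠ 0) (k : R3) :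
    conj (gPlus β g k) * resolved 1 ε (gPlus β g) k +
        conj (gMinus β g k) * resolved (-1) ε (gMinus β g) k =
      ((‖g k‖ ^ 2 * (‖k‖ / (‖k‖ ^ 2 + ε ^ 2)) : ℝ) : ℂ) + Complex.I *
        ((‖g k‖ ^ 2 * cothWeight β k * (ε / (‖k‖ ^ 2 + ε ^ 2)) : ℝ) : ℂ) := by
  rw [resolved_one hε, resolved_neg_one hε]
  simp only [gPlus, gMinus, map_mul, Complex.conj_ofReal, Complex.conj_conj, cothWeight]
  push_cast
  generalize ((‖k‖ : ℂ) ^ 2 + (ε : ℂ) ^ 2) = d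
  simp only [div_eq_mul_inv]
  have hq := Complex.conj_mul' (g k)
  have ha := sq_sqrt_one_add_rho hβ k
  have hb := sq_sqrt_rho hβ k
  generalize ((√(1 + rho β k) : ℝ) : ℂ) = a at *
  generalize ((√(rho β k) : ℝ) : ℂ) = b at *
  linear_combination (d⁻¹ * (a ^ 2 * (‖k‖ + Complex.I * ε) + b ^ 2 * (-‖k‖ + Complex.I * ε))) * hq +
    ((‖g k‖ : ℂ) ^ 2 * d⁻¹ * (‖k‖ + Complex.I * ε)) * ha +
    ((‖g k‖ : ℂ) ^ 2 * d⁻¹ * (-‖k‖ + Complex.I * ε)) * hb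

/-- Conjugation by `J` exchanges the weights `1 + ρ` and `ρ`, which reverses the sign of the real
part only. -/
lemma diagonal_coefficient_conj (hβ : 0 < β) {ε : ℝ} (hε : ε ≠ 0) (k : R3) :
    conj (conj (gMinus β g k)) * resolved 1 ε (star (gMinus β g)) k +
        conj (conj (gPlus β g k)) * resolved (-1) ε (star (gPlus β g)) k =
      -((‖g k‖ ^ 2 * (‖k‖ / (‖k‖ ^ 2 + ε ^ 2)) : ℝ) : ℂ) + Complex.I *
        ((‖g k‖ ^ 2 * cothWeight β k * (ε / (‖k‖ ^ 2 + ε ^ 2)) : ℝ) : ℂ) := by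
  rw [resolved_one hε, resolved_neg_one hε]
  simp only [Pi.star_apply, ← starRingEnd_apply, gPlus, gMinus, map_mul, Complex.conj_ofReal,
    Complex.conj_conj, cothWeight]
  push_cast
  generalize ((‖k‖ : ℂ) ^ 2 + (ε : ℂ) ^ 2) = d
  simp only [div_eq_mul_inv]
  have hq := Complex.conj_mul' (g k)
  have ha := sq_sqrt_one_add_rho hβ k
  have hb := sq_sqrt_rho hβ k
  generalize ((√(1 + rho β k) : ℝ) : ℂ) = a at *
  generalize ((√(rho β k) : ℝ) : ℂ) = b at *
  linear_combination (d⁻¹ * (b ^ 2 * (‖k‖ + Complex.I * ε) + a ^ 2 * (-‖k‖ + Complex.I * ε))) * hq +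
    ((‖g k‖ : ℂ) ^ 2 * d⁻¹ * (-‖k‖ + Complex.I * ε)) * ha +
    ((‖g k‖ : ℂ) ^ 2 * d⁻¹ * (‖k‖ + Complex.I * ε)) * hb

/-- Both terms carry the weight `√(ρ(1+ρ))`, so the real parts cancel and the imaginary parts
double. -/
lemma mixed_coefficient {ε : ℝ} (hε : ε ≠ 0) (k : R3) :
    conj (gPlus β g k) * resolved 1 ε (star (gMinus β g)) k +
        conj (gMinus β g k) * resolved (-1) ε (star (gPlus β g)) k =
      Complex.I * ((‖g k‖ ^ 2 * cschWeight β k * (ε / (‖k‖ ^ 2 + ε ^ 2)) : ℝ) : ℂ) := by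
  rw [resolved_one hε, resolved_neg_one hε]
  simp only [Pi.star_apply, ← starRingEnd_apply, gPlus, gMinus, map_mul, Complex.conj_ofReal,
    Complex.conj_conj, cschWeight]
  push_cast
  generalize ((‖k‖ : ℂ) ^ 2 + (ε : ℂ) ^ 2) = d
  simp only [div_eq_mul_inv]
  have hq := Complex.conj_mul' (g k)
  generalize ((√(1 + rho β k) : ℝ) : ℂ) = a at *
  generalize ((√(rho β k) : ℝ) : ℂ) = b at *
  linear_combination (d⁻¹ * (a * b * (2 * Complex.I * ε))) * hq

lemma mixed_coefficient_conj {ε : ℝ} (hε : ε ≠ 0) (k : R3) :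
    conj (conj (gMinus β g k)) * resolved 1 ε (gPlus β g) k +
        conj (conj (gPlus β g k)) * resolved (-1) ε (gMinus β g) k =
      Complex.I * ((‖g k‖ ^ 2 * cschWeight β k * (ε / (‖k‖ ^ 2 + ε ^ 2)) : ℝ) : ℂ) := by
  rw [resolved_one hε, resolved_neg_one hε]
  simp only [gPlus, gMinus, map_mul, Complex.conj_ofReal,
    Complex.conj_conj, cschWeight]
  push_cast
  generalize ((‖k‖ : ℂ) ^ 2 + (ε : ℂ) ^ 2) = d
  simp only [div_eq_mul_inv]
  have hq := Complex.conj_mul' (g k)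
  generalize ((√(1 + rho β k) : ℝ) : ℂ) = a at *
  generalize ((√(rho β k) : ℝ) : ℂ) = b at *
  linear_combination (d⁻¹ * (a * b * (2 * Complex.I * ε))) * hq

end Coefficients

/-! ### The matrix elements as a form in three integrals -/

section Form

variable {ι : Type} [Fintype ι] [DecidableEq ι] {G : Matrix ι ι ℂ} {β : ℝ} {g : R3 → ℂ}

lemma integrable_conj_mul {f h : R3 → ℂ} (hf : MemLp f 2 volume) (hh : MemLp h 2 volume) :
    Integrable fun k => conj (f k) * h k :=
  hf.star.integrable_mul hh

lemma integral_add_eq {X : Type*} [MeasurableSpace X] {μ : Measure X} {f h F : X → ℂ}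
    (hf : Integrable f μ) (hh : Integrable h μ) (e : ∀ x, f x + h x = F x) :
    ∫ x, f x ∂μ + ∫ x, h x ∂μ = ∫ x, F x ∂μ :=
  (integral_add hf hh).symm.trans (integral_congr_ae (ae_of_all _ e))

lemma integral_ofReal_add_I_mul {X : Type*} [MeasurableSpace X] {μ : Measure X} {a b : X → ℝ}
    (ha : Integrable a μ) (hb : Integrable b μ) :
    ∫ x, ((a x : ℂ) + Complex.I * (b x : ℂ)) ∂μ =
      ((∫ x, a x ∂μ : ℝ) : ℂ) + Complex.I * ((∫ x, b x ∂μ : ℝ) : ℂ) := by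
  have ha' : Integrable (fun x => (a x : ℂ)) μ := ha.ofReal
  have hb' : Integrable (fun x => Complex.I * (b x : ℂ)) μ := hb.ofReal.const_mul Complex.I
  rw [integral_add ha' hb', integral_const_mul, integral_complex_ofReal, integral_complex_ofReal]

lemma measurable_rho : Measurable (rho β) := by
  unfold rho
  fun_prop

/-- The dispersive integrand is dominated by `|ε|⁻¹ |g|²`. -/
lemma integrable_dispersive (hg : MemLp g 2 volume) {ε : ℝ} (hε : ε ≠ 0) :
    Integrable fun k => ‖g k‖ ^ 2 * (‖k‖ / (‖k‖ ^ 2 + ε ^ 2)) := by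
  refine ((memLp_two_iff_integrable_sq_norm hg.1).1 hg).mul_bdd (c := |ε|⁻¹)
    (Measurable.aestronglyMeasurable (by fun_prop)) (ae_of_all _ fun k => ?_)
  have h1 : 0 < |ε| := abs_pos.2 hε
  rw [Real.norm_of_nonneg (by positivity), div_le_iff₀ (by positivity), ← sq_abs ε]
  field_simp
  nlinarith [sq_nonneg (‖k‖ - |ε|), norm_nonneg k]

lemma abs_poisson_le {ε : ℝ} (hε : ε ≠ 0) (r : ℝ) : |ε / (r ^ 2 + ε ^ 2)| ≤ |ε|⁻¹ := by
  have h1 : 0 < |ε| := abs_pos.2 hε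
  rw [abs_div, abs_of_pos (by positivity : 0 < r ^ 2 + ε ^ 2), div_le_iff₀ (by positivity),
    ← sq_abs ε]
  field_simp
  nlinarith [sq_nonneg r]

lemma integrable_absorptive {θ : R3 → ℝ} (hθ : Integrable fun k => ‖g k‖ ^ 2 * θ k) {ε : ℝ}
    (hε : ε ≠ 0) : Integrable fun k => ‖g k‖ ^ 2 * θ k * (ε / (‖k‖ ^ 2 + ε ^ 2)) := by
  refine hθ.mul_bdd (c := |ε|⁻¹) (Measurable.aestronglyMeasurable (by fun_prop))
    (ae_of_all _ fun k => ?_)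
  rw [Real.norm_eq_abs]
  exact abs_poisson_le hε _

/-- Left and right particles are orthogonal, so eight inner products remain. They group into four
sums of two, evaluated by the coefficient identities; the factor `1/2` is the square of the
normalization `1/√2`. -/
lemma lamForm_eq (e : ℝ) (hG : G.IsHermitian) (hβ : 0 < β) (hg : MemLp g 2 volume)
    (hP : MemLp (gPlus β g) 2 volume) (hM : MemLp (gMinus β g) 2 volume)
    (h1 : Integrable fun k => ‖g k‖ ^ 2 * cothWeight β k) {ε : ℝ} (hε : ε ≠ 0) (u w : KK ι) :
    lamForm (fun _ : ι => e) G β g 0 ε u w = (1 / 2 : ℂ) *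
      ((dispersiveIntegral g ε + Complex.I * absorptiveIntegral g (cothWeight β) ε) *
          ⟪matOp (G ⊗ₖ (1 : Matrix ι ι ℂ)) u, matOp (G ⊗ₖ (1 : Matrix ι ι ℂ)) w⟫_ℂ +
        (-dispersiveIntegral g ε + Complex.I * absorptiveIntegral g (cothWeight β) ε) *
          ⟪matOp ((1 : Matrix ι ι ℂ) ⊗ₖ G.map conj) u,
            matOp ((1 : Matrix ι ι ℂ) ⊗ₖ G.map conj) w⟫_ℂ -
        Complex.I * absorptiveIntegral g (cschWeight β) ε *
          (⟪matOp (G ⊗ₖ (1 : Matrix ι ι ℂ)) u, matOp ((1 : Matrix ι ι ℂ) ⊗ₖ G.map conj) w⟫_ℂ +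
          ⟪matOp ((1 : Matrix ι ι ℂ) ⊗ₖ G.map conj) u,
            matOp (G ⊗ₖ (1 : Matrix ι ι ℂ)) w⟫_ℂ)) := by
  have hN := integrable_dispersive hg hε
  have hM1 := integrable_absorptive h1 hε
  have rp := memLp_resolved 1 hε hP
  have rm := memLp_resolved (-1) hε hM
  have rp' := memLp_resolved (-1) hε hP.star
  have rm' := memLp_resolved 1 hε hM.star
  have d1 : (∫ k, conj (gPlus β g k) * resolved 1 ε (gPlus β g) k) +
      (∫ k, conj (gMinus β g k) * resolved (-1) ε (gMinus β g) k) =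
      dispersiveIntegral g ε + Complex.I * absorptiveIntegral g (cothWeight β) ε :=
    (integral_add_eq (integrable_conj_mul hP rp) (integrable_conj_mul hM rm)
      (diagonal_coefficient hβ hε)).trans (integral_ofReal_add_I_mul hN hM1)
  have d2 : (∫ k, conj (conj (gMinus β g k)) * resolved 1 ε (star (gMinus β g)) k) +
      (∫ k, conj (conj (gPlus β g k)) * resolved (-1) ε (star (gPlus β g)) k) =
      -dispersiveIntegral g ε + Complex.I * absorptiveIntegral g (cothWeight β) ε := by
    refine (integral_add_eq (integrable_conj_mul hM.star rm') (integrable_conj_mul hP.star rp')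
      (diagonal_coefficient_conj hβ hε)).trans ?_
    simp only [← Complex.ofReal_neg]
    refine (integral_ofReal_add_I_mul hN.neg hM1).trans ?_
    rw [integral_neg']
    rfl
  have d3 : (∫ k, conj (gPlus β g k) * resolved 1 ε (star (gMinus β g)) k) +
      (∫ k, conj (gMinus β g k) * resolved (-1) ε (star (gPlus β g)) k) =
      Complex.I * absorptiveIntegral g (cschWeight β) ε := by
    refine (integral_add_eq (integrable_conj_mul hP rm') (integrable_conj_mul hM rp')
      (mixed_coefficient hε)).trans ?_
    rw [integral_const_mul, integral_complex_ofReal]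
    rfl
  have d4 : (∫ k, conj (conj (gMinus β g k)) * resolved 1 ε (gPlus β g) k) +
      (∫ k, conj (conj (gPlus β g k)) * resolved (-1) ε (gMinus β g) k) =
      Complex.I * absorptiveIntegral g (cschWeight β) ε := by
    refine (integral_add_eq (integrable_conj_mul hM.star rp) (integrable_conj_mul hP.star rm)
      (mixed_coefficient_conj hε)).trans ?_
    rw [integral_const_mul, integral_complex_ofReal]
    rfl
  have hc : (conj ((√2 : ℝ) : ℂ)⁻¹) * ((√2 : ℝ) : ℂ)⁻¹ = 1 / 2 := by
    rw [map_inv₀, Complex.conj_ofReal, ← mul_inv, ← Complex.ofReal_mul,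
      Real.mul_self_sqrt (by norm_num)]
    norm_num
  rw [lamForm_eq_inner e hG hP hM hε]
  simp only [intVac, resIntVac, fieldVac, fieldVacConj, hil_inner_smul_left, hil_inner_smul_right,
    inner_add_left, inner_add_right, inner_sub_left, inner_oneL_oneL, inner_oneR_oneR,
    inner_oneL_oneR, inner_oneR_oneL]
  generalize conj ((√2 : ℝ) : ℂ)⁻¹ = c' at *
  generalize ((√2 : ℝ) : ℂ)⁻¹ = c at *
  generalize (∫ k, conj (gPlus β g k) * resolved 1 ε (gPlus β g) k) = x₁ at *
  generalize (∫ k, conj (gMinus β g k) * resolved (-1) ε (gMinus β g) k) = x₂ at *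
  generalize (∫ k, conj (conj (gMinus β g k)) * resolved 1 ε (star (gMinus β g)) k) = y₁ at *
  generalize (∫ k, conj (conj (gPlus β g k)) * resolved (-1) ε (star (gPlus β g)) k) = y₂ at *
  generalize (∫ k, conj (gPlus β g k) * resolved 1 ε (star (gMinus β g)) k) = v₁ at *
  generalize (∫ k, conj (gMinus β g k) * resolved (-1) ε (star (gPlus β g)) k) = v₂ at *
  generalize (∫ k, conj (conj (gMinus β g k)) * resolved 1 ε (gPlus β g) k) = w₁ at *
  generalize (∫ k, conj (conj (gPlus β g k)) * resolved (-1) ε (gMinus β g) k) = w₂ at *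
  generalize ⟪matOp (G ⊗ₖ (1 : Matrix ι ι ℂ)) u, matOp (G ⊗ₖ (1 : Matrix ι ι ℂ)) w⟫_ℂ = A
  generalize ⟪matOp ((1 : Matrix ι ι ℂ) ⊗ₖ G.map conj) u,
    matOp ((1 : Matrix ι ι ℂ) ⊗ₖ G.map conj) w⟫_ℂ = B
  generalize ⟪matOp (G ⊗ₖ (1 : Matrix ι ι ℂ)) u, matOp ((1 : Matrix ι ι ℂ) ⊗ₖ G.map conj) w⟫_ℂ = C
  generalize ⟪matOp ((1 : Matrix ι ι ℂ) ⊗ₖ G.map conj) u, matOp (G ⊗ₖ (1 : Matrix ι ι ℂ)) w⟫_ℂ = D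
  linear_combination (A * (x₁ + x₂) + B * (y₁ + y₂) - C * (v₁ + v₂) - D * (w₁ + w₂)) * hc +
    (1 / 2) * A * d1 + (1 / 2) * B * d2 - (1 / 2) * C * d3 - (1 / 2) * D * d4

end Form

/-! ### Infrared behaviour of the form factor -/

section Infrared

variable {β p γ : ℝ} {g : R3 → ℂ}

lemma ae_ne_zero : ∀ᵐ k : R3, k ≠ 0 :=
  compl_mem_ae_iff.2 (measure_singleton (0 : R3))

lemma integrable_sq_norm (hg : MemLp g 2 volume) : Integrable fun k => ‖g k‖ ^ 2 :=
  (memLp_two_iff_integrable_sq_norm hg.1).1 hg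

lemma integrableOn_norm_rpow {s : ℝ} (hs : -3 < s) {δ : ℝ} (hδ : 0 < δ) :
    IntegrableOn (fun k : R3 => ‖k‖ ^ s) (Metric.ball 0 δ) := by
  rw [integrableOn_fun_norm_addHaar volume (f := fun y => y ^ s), finrank_euclideanSpace,
    Fintype.card_fin]
  have h : IntegrableOn (fun y : ℝ => y ^ (s + 2)) (Set.Ioo 0 δ) :=
    -- The Jacobian `r²` of polar coordinates turns the condition `s > -3` into `s + 2 > -1`.
    (intervalIntegral.integrableOn_Ioo_rpow_iff hδ).2 (by linarith)
  refine h.congr_fun (fun y hy => ?_) measurableSet_Ioo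
  have : y ^ (s + 2) = y ^ s * y ^ 2 := by
    rw [Real.rpow_add hy.1]
    norm_num
  simp only [this, smul_eq_mul, mul_comm]

lemma eventually_norm_le
    (hlim : Tendsto (fun k : R3 => ‖g k‖ / ‖k‖ ^ p) (𝓝[≠] 0) (𝓝 γ)) :
    ∃ δ > 0, ∀ k : R3, k ≠ 0 → ‖k‖ < δ → ‖g k‖ ≤ (γ + 1) * ‖k‖ ^ p := by
  have h := hlim.eventually (eventually_le_nhds (b := γ + 1) (by linarith))
  rw [eventually_nhdsWithin_iff, Metric.eventually_nhds_iff] at h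
  obtain ⟨δ, hδ, h⟩ := h
  refine ⟨δ, hδ, fun k hk hlt => ?_⟩
  have hk' : 0 < ‖k‖ := norm_pos_iff.2 hk
  have := h (y := k) (by simpa using hlt) hk
  rwa [div_le_iff₀ (by positivity)] at this

/-- Near the origin the integrand is at most `(γ+1)² |k|^(2p-a)`; away from it `|k|^(-a)` is bounded
and `g` is square integrable. The choices `a = 1` and `a = 2` produce the thresholds `p > -1` and `p
> -1/2`. -/
lemma integrable_sq_norm_mul_rpow (hg : MemLp g 2 volume)
    (hlim : Tendsto (fun k : R3 => ‖g k‖ / ‖k‖ ^ p) (𝓝[≠] 0) (𝓝 γ)) {a : ℝ} (ha : 0 ≤ a)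
    (hpa : -3 < 2 * p - a) : Integrable fun k => ‖g k‖ ^ 2 * ‖k‖ ^ (-a) := by
  obtain ⟨δ, hδ, hle⟩ := eventually_norm_le hlim
  have hm : AEStronglyMeasurable (fun k => ‖g k‖ ^ 2 * ‖k‖ ^ (-a)) volume :=
    (integrable_sq_norm hg).1.mul (Measurable.aestronglyMeasurable (by fun_prop))
  rw [← integrableOn_univ, ← Set.union_compl_self (Metric.ball (0 : R3) δ)]
  refine IntegrableOn.union ?_ ?_
  · refine ((integrableOn_norm_rpow hpa hδ).const_mul ((γ + 1) ^ 2)).mono' hm.restrict ?_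
    filter_upwards [ae_restrict_mem measurableSet_ball, ae_restrict_of_ae ae_ne_zero] with k hk hk0
    have hk' : 0 < ‖k‖ := norm_pos_iff.2 hk0
    have h1 := hle k hk0 (by simpa using hk)
    rw [Real.norm_of_nonneg (by positivity)]
    have h2 : ‖k‖ ^ (2 * p - a) = (‖k‖ ^ p) ^ 2 * ‖k‖ ^ (-a) := by
      rw [sub_eq_add_neg, Real.rpow_add hk', mul_comm 2 p, Real.rpow_mul hk'.le]
      norm_num
    rw [h2, ← mul_assoc, ← mul_pow]
    gcongr
  · refine Integrable.mono' ((integrable_sq_norm hg).mul_const (δ ^ (-a))).integrableOn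
      hm.restrict ?_
    filter_upwards [ae_restrict_mem measurableSet_ball.compl] with k hk
    have hk' : δ ≤ ‖k‖ := by simpa using hk
    rw [Real.norm_of_nonneg (by positivity)]
    gcongr ?_ * ?_
    exact Real.rpow_le_rpow_of_nonpos hδ hk' (by linarith)

lemma integrable_sq_norm_mul_inv (hg : MemLp g 2 volume)
    (hlim : Tendsto (fun k : R3 => ‖g k‖ / ‖k‖ ^ p) (𝓝[≠] 0) (𝓝 γ)) (hp : -1 < p) :
    Integrable fun k => ‖g k‖ ^ 2 * ‖k‖⁻¹ := by
  have := integrable_sq_norm_mul_rpow hg hlim (a := 1) (by norm_num) (by linarith)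
  simpa only [Real.rpow_neg_one] using this

lemma integrable_sq_norm_mul_inv_sq (hg : MemLp g 2 volume)
    (hlim : Tendsto (fun k : R3 => ‖g k‖ / ‖k‖ ^ p) (𝓝[≠] 0) (𝓝 γ)) (hp : -1 / 2 < p) :
    Integrable fun k => ‖g k‖ ^ 2 * (‖k‖ ^ 2)⁻¹ := by
  have := integrable_sq_norm_mul_rpow hg hlim (a := 2) (by norm_num) (by linarith)
  refine this.congr (ae_of_all _ fun k => ?_)
  simp only
  rw [Real.rpow_neg (norm_nonneg k)]
  norm_num

lemma rho_le (hβ : 0 < β) (k : R3) : rho β k ≤ β⁻¹ * ‖k‖⁻¹ := by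
  rw [rho, ← mul_inv]
  rcases (norm_nonneg k).eq_or_lt with h | h
  -- At `k = 0` both sides are `0`, by the convention `0⁻¹ = 0`.
  · simp [← h]
  · have : β * ‖k‖ ≤ Real.exp (β * ‖k‖) - 1 := by
      linarith [Real.add_one_le_exp (β * ‖k‖)]
    gcongr

lemma cothWeight_le (hβ : 0 < β) (k : R3) : cothWeight β k ≤ 1 + 2 * β⁻¹ * ‖k‖⁻¹ := by
  rw [cothWeight]
  linarith [rho_le hβ k]

lemma cschWeight_nonneg (k : R3) : 0 ≤ cschWeight β k := by
  rw [cschWeight]; positivity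

/-- Expand `(√ρ - √(1+ρ))² ≥ 0`. The lower bound for the imaginary part in the divergent case rests
on this inequality. -/
lemma cschWeight_le_cothWeight (hβ : 0 < β) (k : R3) : cschWeight β k ≤ cothWeight β k := by
  have h := rho_nonneg hβ k
  rw [cschWeight, cothWeight]
  have h1 := Real.sq_sqrt h
  have h2 := Real.sq_sqrt (by linarith : 0 ≤ 1 + rho β k)
  nlinarith [sq_nonneg (√(rho β k) - √(1 + rho β k))]

lemma cothWeight_nonneg (hβ : 0 < β) (k : R3) : 0 ≤ cothWeight β k :=
  (cschWeight_nonneg k).trans (cschWeight_le_cothWeight hβ k)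

lemma measurable_cothWeight : Measurable (cothWeight β) := by
  have := measurable_rho (β := β)
  unfold cothWeight
  fun_prop

lemma measurable_cschWeight : Measurable (cschWeight β) := by
  have := measurable_rho (β := β)
  unfold cschWeight
  fun_prop

lemma integrable_cothWeight (hβ : 0 < β) (hg : MemLp g 2 volume)
    (hlim : Tendsto (fun k : R3 => ‖g k‖ / ‖k‖ ^ p) (𝓝[≠] 0) (𝓝 γ)) (hp : -1 < p) :
    Integrable fun k => ‖g k‖ ^ 2 * cothWeight β k := by
  refine ((integrable_sq_norm hg).add
    ((integrable_sq_norm_mul_inv hg hlim hp).const_mul (2 * β⁻¹))).mono'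
    ((integrable_sq_norm hg).1.mul measurable_cothWeight.aestronglyMeasurable)
    (ae_of_all _ fun k => ?_)
  have h1 := cothWeight_le hβ k
  have h2 := cothWeight_nonneg hβ k
  rw [Real.norm_of_nonneg (by positivity), Pi.add_apply]
  calc ‖g k‖ ^ 2 * cothWeight β k ≤ ‖g k‖ ^ 2 * (1 + 2 * β⁻¹ * ‖k‖⁻¹) := by gcongr
    _ = _ := by ring

lemma integrable_cschWeight (hβ : 0 < β) (hg : MemLp g 2 volume)
    (h : Integrable fun k => ‖g k‖ ^ 2 * cothWeight β k) :
    Integrable fun k => ‖g k‖ ^ 2 * cschWeight β k := by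
  refine h.mono' ((integrable_sq_norm hg).1.mul measurable_cschWeight.aestronglyMeasurable)
    (ae_of_all _ fun k => ?_)
  have h2 := cschWeight_nonneg (β := β) k
  rw [Real.norm_of_nonneg (by positivity)]
  gcongr
  exact cschWeight_le_cothWeight hβ k

lemma memLp_gPlus (hβ : 0 < β) (hg : MemLp g 2 volume)
    (h : Integrable fun k => ‖g k‖ ^ 2 * cothWeight β k) : MemLp (gPlus β g) 2 volume := by
  have hr := measurable_rho (β := β)
  have hm : AEStronglyMeasurable (gPlus β g) volume :=
    AEStronglyMeasurable.mul (Measurable.aestronglyMeasurable (by fun_prop)) hg.1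
  rw [memLp_two_iff_integrable_sq_norm hm]
  -- Uses `1 + ρ = (1 + (1 + 2ρ)) / 2`.
  refine (((integrable_sq_norm hg).add h).div_const 2).congr (ae_of_all _ fun k => ?_)
  have h0 := rho_nonneg hβ k
  simp only [gPlus, norm_mul, mul_pow, Complex.norm_real, Real.norm_eq_abs, sq_abs, Pi.add_apply]
  rw [Real.sq_sqrt (by linarith), cothWeight]
  ring

lemma memLp_gMinus (hβ : 0 < β) (hg : MemLp g 2 volume)
    (h : Integrable fun k => ‖g k‖ ^ 2 * cothWeight β k) : MemLp (gMinus β g) 2 volume := by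
  have hr := measurable_rho (β := β)
  have hm : AEStronglyMeasurable (gMinus β g) volume :=
    AEStronglyMeasurable.mul (Measurable.aestronglyMeasurable (by fun_prop))
      (Complex.continuous_conj.comp_aestronglyMeasurable hg.1)
  rw [memLp_two_iff_integrable_sq_norm hm]
  refine ((h.sub (integrable_sq_norm hg)).div_const 2).congr (ae_of_all _ fun k => ?_)
  have h0 := rho_nonneg hβ k
  simp only [gMinus, norm_mul, mul_pow, Complex.norm_real, Real.norm_eq_abs, sq_abs, Pi.sub_apply,
    RCLike.norm_conj]
  rw [Real.sq_sqrt h0, cothWeight]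
  ring

lemma tendsto_norm_nhdsNE : Tendsto (fun k : R3 => ‖k‖) (𝓝[≠] 0) (𝓝[>] 0) := by
  refine tendsto_nhdsWithin_iff.2 ⟨?_, ?_⟩
  · exact (continuous_norm.tendsto' (0 : R3) 0 norm_zero).mono_left nhdsWithin_le_nhds
  · filter_upwards [self_mem_nhdsWithin] with k hk
    exact norm_pos_iff.2 hk

/-- With `x = β|k|` this is `x / (eˣ - 1) → 1`, the derivative of the exponential at `0`. -/
lemma tendsto_norm_mul_rho (hβ : 0 < β) :
    Tendsto (fun k : R3 => ‖k‖ * rho β k) (𝓝[≠] 0) (𝓝 β⁻¹) := by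
  have h1 := (Real.hasDerivAt_exp 0).tendsto_slope_zero
  simp only [zero_add, Real.exp_zero, smul_eq_mul] at h1
  have h2 : Tendsto (fun k : R3 => β * ‖k‖) (𝓝[≠] 0) (𝓝[≠] 0) := by
    refine tendsto_nhdsWithin_iff.2 ⟨?_, ?_⟩
    · have := (tendsto_nhdsWithin_iff.1 tendsto_norm_nhdsNE).1.const_mul β
      rwa [mul_zero] at this
    · filter_upwards [self_mem_nhdsWithin] with k hk
      have : 0 < ‖k‖ := norm_pos_iff.2 hk
      exact (mul_pos hβ this).ne'
  have h3 := ((h1.comp h2).inv₀ one_ne_zero).const_mul β⁻¹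
  rw [inv_one, mul_one] at h3
  refine h3.congr fun k => ?_
  simp only [Function.comp_apply, rho, mul_inv, inv_inv]
  field_simp

lemma tendsto_norm_mul_cothWeight (hβ : 0 < β) :
    Tendsto (fun k : R3 => ‖k‖ * cothWeight β k) (𝓝[≠] 0) (𝓝 (2 / β)) := by
  have h1 := (tendsto_nhdsWithin_iff.1 tendsto_norm_nhdsNE).1.add
    ((tendsto_norm_mul_rho hβ).const_mul 2)
  rw [zero_add, ← div_eq_mul_inv] at h1
  refine h1.congr fun k => ?_
  rw [cothWeight]
  ring

/-- Both `|k| ρ` and `|k| (1 + ρ)` tend to `β⁻¹`. The limit agrees with that for `cothWeight`, which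
is why a single `η` occurs in all terms of the level shift operator. -/
lemma tendsto_norm_mul_cschWeight (hβ : 0 < β) :
    Tendsto (fun k : R3 => ‖k‖ * cschWeight β k) (𝓝[≠] 0) (𝓝 (2 / β)) := by
  have h0 := tendsto_norm_mul_rho hβ
  have h1 := (tendsto_nhdsWithin_iff.1 tendsto_norm_nhdsNE).1.add h0
  have h2 := (h0.sqrt.mul h1.sqrt).const_mul 2
  rw [zero_add, Real.mul_self_sqrt (by positivity), ← div_eq_mul_inv] at h2
  refine h2.congr fun k => ?_
  have e : ‖k‖ + ‖k‖ * rho β k = ‖k‖ * (1 + rho β k) := by ring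
  rw [cschWeight, e, Real.sqrt_mul (norm_nonneg k), Real.sqrt_mul (norm_nonneg k)]
  linear_combination 2 * √(rho β k) * √(1 + rho β k) * Real.mul_self_sqrt (norm_nonneg k)

end Infrared

/-! ### Limits of the coefficient integrals -/

section Limits

variable {β p γ : ℝ} {g : R3 → ℂ}

/-- Dominated convergence with the majorant `|g|² / |k|`. -/
lemma tendsto_dispersiveIntegral (hg : MemLp g 2 volume)
    (h : Integrable fun k => ‖g k‖ ^ 2 * ‖k‖⁻¹) :
    Tendsto (dispersiveIntegral g) (𝓝[>] 0) (𝓝 (∫ k : R3, ‖g k / (√‖k‖ : ℝ)‖ ^ 2)) := by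
  have e : (∫ k : R3, ‖g k / (√‖k‖ : ℝ)‖ ^ 2) = ∫ k, ‖g k‖ ^ 2 * ‖k‖⁻¹ := by
    refine integral_congr_ae (ae_of_all _ fun k => ?_)
    simp only
    rw [norm_div, div_pow, Complex.norm_real, Real.norm_eq_abs, sq_abs,
      Real.sq_sqrt (norm_nonneg k), div_eq_mul_inv]
  rw [e]
  refine tendsto_integral_filter_of_dominated_convergence _ ?_ ?_ h ?_
  · filter_upwards [self_mem_nhdsWithin] with ε hε
    exact (integrable_dispersive hg (ne_of_gt hε)).1
  · filter_upwards [self_mem_nhdsWithin] with ε hε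
    filter_upwards [ae_ne_zero] with k hk
    have hk' : 0 < ‖k‖ := norm_pos_iff.2 hk
    rw [Real.norm_of_nonneg (by positivity)]
    gcongr
    rw [div_le_iff₀ (by positivity)]
    field_simp
    nlinarith [sq_nonneg ε]
  · filter_upwards [ae_ne_zero] with k hk
    have hk' : 0 < ‖k‖ := norm_pos_iff.2 hk
    have hc : ContinuousAt (fun ε : ℝ => ‖g k‖ ^ 2 * (‖k‖ / (‖k‖ ^ 2 + ε ^ 2))) 0 := by
      refine ContinuousAt.mul continuousAt_const (ContinuousAt.div continuousAt_const
        (by fun_prop) (by positivity))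
    have h2 := hc.tendsto.mono_left (nhdsWithin_le_nhds (s := Set.Ioi 0))
    have h3 : ‖g k‖ ^ 2 * (‖k‖ / (‖k‖ ^ 2 + 0 ^ 2)) = ‖g k‖ ^ 2 * ‖k‖⁻¹ := by
      field_simp
      ring
    rwa [h3] at h2

/-- The kernel `ε / (|k|² + ε²)` tends to `0` for `k ≠ 0` and is at most `1 / |k|`, so dominated
convergence applies. -/
lemma tendsto_absorptiveIntegral_zero {θ : R3 → ℝ} (hθ : Integrable fun k => ‖g k‖ ^ 2 * θ k)
    (hθ0 : ∀ k, 0 ≤ θ k) (h : Integrable fun k => ‖g k‖ ^ 2 * θ k * ‖k‖⁻¹) :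
    Tendsto (absorptiveIntegral g θ) (𝓝[>] 0) (𝓝 0) := by
  have h0 : (∫ _ : R3, (0 : ℝ)) = 0 := integral_zero _ _
  refine Eq.subst (motive := fun c => Tendsto (absorptiveIntegral g θ) (𝓝[>] 0) (𝓝 c)) h0 ?_
  refine tendsto_integral_filter_of_dominated_convergence _ ?_ ?_ h ?_
  · filter_upwards [self_mem_nhdsWithin] with ε hε
    exact (integrable_absorptive hθ (ne_of_gt hε)).1
  · filter_upwards [self_mem_nhdsWithin] with ε hε
    filter_upwards [ae_ne_zero] with k hk
    have hk' : 0 < ‖k‖ := norm_pos_iff.2 hk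
    have hε' : 0 < ε := hε
    have := hθ0 k
    rw [Real.norm_of_nonneg (by positivity)]
    gcongr
    rw [div_le_iff₀ (by positivity)]
    field_simp
    nlinarith [sq_nonneg (ε - ‖k‖)]
  · filter_upwards [ae_ne_zero] with k hk
    have hk' : 0 < ‖k‖ := norm_pos_iff.2 hk
    have hc : ContinuousAt (fun ε : ℝ => ‖g k‖ ^ 2 * θ k * (ε / (‖k‖ ^ 2 + ε ^ 2))) 0 := by
      refine ContinuousAt.mul continuousAt_const (ContinuousAt.div continuousAt_id
        (by fun_prop) (by positivity))
    have h2 := hc.tendsto.mono_left (nhdsWithin_le_nhds (s := Set.Ioi 0))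
    rwa [zero_div, mul_zero] at h2

lemma integrable_cothWeight_mul_inv (hβ : 0 < β) (hg : MemLp g 2 volume)
    (hlim : Tendsto (fun k : R3 => ‖g k‖ / ‖k‖ ^ p) (𝓝[≠] 0) (𝓝 γ)) (hp : -1 / 2 < p) :
    Integrable fun k => ‖g k‖ ^ 2 * cothWeight β k * ‖k‖⁻¹ := by
  refine ((integrable_sq_norm_mul_inv hg hlim (by linarith)).add
    ((integrable_sq_norm_mul_inv_sq hg hlim hp).const_mul (2 * β⁻¹))).mono'
    (((integrable_sq_norm hg).1.mul measurable_cothWeight.aestronglyMeasurable).mul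
      (Measurable.aestronglyMeasurable (by fun_prop)))
    (ae_of_all _ fun k => ?_)
  have h1 := cothWeight_le hβ k
  have h2 := cothWeight_nonneg hβ k
  rw [Real.norm_of_nonneg (by positivity), Pi.add_apply]
  calc ‖g k‖ ^ 2 * cothWeight β k * ‖k‖⁻¹ ≤ ‖g k‖ ^ 2 * (1 + 2 * β⁻¹ * ‖k‖⁻¹) * ‖k‖⁻¹ := by gcongr
    _ = _ := by
      rw [← inv_pow]; ring

lemma integrable_cschWeight_mul_inv (hβ : 0 < β) (hg : MemLp g 2 volume)
    (h : Integrable fun k => ‖g k‖ ^ 2 * cothWeight β k * ‖k‖⁻¹) :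
    Integrable fun k => ‖g k‖ ^ 2 * cschWeight β k * ‖k‖⁻¹ := by
  refine h.mono' (((integrable_sq_norm hg).1.mul measurable_cschWeight.aestronglyMeasurable).mul
      (Measurable.aestronglyMeasurable (by fun_prop))) (ae_of_all _ fun k => ?_)
  have h2 := cschWeight_nonneg (β := β) k
  rw [Real.norm_of_nonneg (by positivity)]
  gcongr
  exact cschWeight_le_cothWeight hβ k

/-- `(2π²)⁻¹ / (|k|² (1 + |k|²))`, a probability density on `ℝ³`. -/
def poissonProfile (k : R3) : ℝ := (2 * Real.pi ^ 2)⁻¹ * (‖k‖ ^ 2 * (1 + ‖k‖ ^ 2))⁻¹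

/-- In polar coordinates the Jacobian cancels `|k|²` and leaves `∫ dr / (1 + r²) = π/2`, to be
multiplied by the area `4π` of the sphere. -/
lemma integral_poissonProfile : ∫ k, poissonProfile k = 1 := by
  have h := integral_fun_norm_addHaar (volume : Measure R3) (fun y : ℝ => (y ^ 2 * (1 + y ^ 2))⁻¹)
  have h2 : ∫ y in Set.Ioi (0 : ℝ), y ^ (Module.finrank ℝ R3 - 1) • (y ^ 2 * (1 + y ^ 2))⁻¹ =
      Real.pi / 2 := by
    rw [finrank_euclideanSpace, Fintype.card_fin]
    have e : ∫ y in Set.Ioi (0 : ℝ), y ^ (3 - 1) • (y ^ 2 * (1 + y ^ 2))⁻¹ =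
        ∫ y in Set.Ioi (0 : ℝ), (1 + y ^ 2)⁻¹ := by
      refine setIntegral_congr_fun measurableSet_Ioi fun y hy => ?_
      have hy' : y ≠ 0 := ne_of_gt hy
      simp only [smul_eq_mul]
      field_simp
    rw [e, integral_Ioi_inv_one_add_sq, Real.arctan_zero, sub_zero]
  have h3 : (volume : Measure R3).real (Metric.ball 0 1) = 4 * Real.pi / 3 := by
    rw [Measure.real, EuclideanSpace.volume_ball_fin_three]
    simp
    rw [ENNReal.toReal_ofReal (by positivity)]
    ring
  rw [h2, h3, finrank_euclideanSpace, Fintype.card_fin] at h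
  unfold poissonProfile
  rw [integral_const_mul, h]
  have := Real.pi_pos
  simp
  field_simp
  norm_num

/-- The decay at infinity asked of an approximate identity: the expression is at most a constant
times `1 / |k|`. -/
lemma tendsto_poissonProfile :
    Tendsto (fun k : R3 => ‖k‖ ^ Module.finrank ℝ R3 * poissonProfile k)
      (Bornology.cobounded R3) (𝓝 0) := by
  rw [finrank_euclideanSpace, Fintype.card_fin]
  have h1 : Tendsto (fun k : R3 => (2 * Real.pi ^ 2)⁻¹ * ‖k‖⁻¹) (Bornology.cobounded R3) (𝓝 0) := by
    have := (tendsto_inv_atTop_zero.comp (tendsto_norm_cobounded_atTop (E := R3))).const_mul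
      (2 * Real.pi ^ 2)⁻¹
    rwa [mul_zero] at this
  refine squeeze_zero (fun k => ?_) (fun k => ?_) h1
  · unfold poissonProfile; positivity
  · unfold poissonProfile
    rw [mul_left_comm]
    gcongr
    rcases (norm_nonneg k).eq_or_lt with h | h
    · simp [← h]
    · field_simp
      nlinarith

/-- Put `F = |g|² θ |k|²`, which tends to `γ² c` at the origin because `|g|² ~ γ² / |k|` and `θ ~ c
/ |k|`. The remaining kernel `ε / (|k|² (|k|² + ε²))` is `2π²` times the rescaled density `ε⁻³
poissonProfile (k / ε)`, an approximate identity at the origin. -/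
lemma tendsto_absorptiveIntegral_critical (hgs : HasCompactSupport g)
    (hlim : Tendsto (fun k : R3 => ‖g k‖ / ‖k‖ ^ (-1 / 2 : ℝ)) (𝓝[≠] 0) (𝓝 γ))
    {θ : R3 → ℝ} (hθ : Integrable fun k => ‖g k‖ ^ 2 * θ k) {c : ℝ}
    (hθ0 : Tendsto (fun k : R3 => ‖k‖ * θ k) (𝓝[≠] 0) (𝓝 c)) :
    Tendsto (absorptiveIntegral g θ) (𝓝[>] 0) (𝓝 (2 * Real.pi ^ 2 * (γ ^ 2 * c))) := by
  classical
  -- The value at the origin is prescribed to make `F` continuous there; a single point does not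
  -- affect integrals.
  let F : R3 → ℝ := Function.update (fun k => ‖g k‖ ^ 2 * θ k * ‖k‖ ^ 2) 0 (γ ^ 2 * c)
  have hF : F =ᵐ[volume] fun k => ‖g k‖ ^ 2 * θ k * ‖k‖ ^ 2 := by
    filter_upwards [ae_ne_zero] with k hk
    exact Function.update_of_ne hk _ _
  have hF0 : F 0 = γ ^ 2 * c := Function.update_self _ _ _
  have hFc : ContinuousAt F 0 := by
    rw [continuousAt_update_same]
    refine ((hlim.pow 2).mul hθ0).congr' ?_
    filter_upwards [self_mem_nhdsWithin] with k hk
    have hk' : 0 < ‖k‖ := norm_pos_iff.2 hk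
    have e : (‖k‖ ^ (-1 / 2 : ℝ)) ^ 2 = ‖k‖⁻¹ := by
      rw [← Real.rpow_natCast, ← Real.rpow_mul hk'.le, ← Real.rpow_neg_one]
      norm_num
    rw [div_pow, e]
    field_simp
  have hFi : Integrable F := by
    refine Integrable.congr ?_ hF.symm
    -- Compact support bounds the added factor `|k|²` by `R²` wherever `g` does not vanish.
    obtain ⟨R, hR⟩ := hgs.isCompact.isBounded.subset_closedBall (0 : R3)
    refine (hθ.norm.mul_const (R ^ 2)).mono' (hθ.1.mul (by fun_prop)) (ae_of_all _ fun k => ?_)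
    by_cases hk : g k = 0
    · simp [hk]
    · have h1 : ‖k‖ ≤ R := by simpa using hR (subset_tsupport g hk)
      rw [norm_mul, Real.norm_of_nonneg (by positivity : 0 ≤ ‖k‖ ^ 2)]
      gcongr
  have key := tendsto_integral_comp_smul_smul_of_integrable (μ := (volume : Measure R3))
    (φ := poissonProfile) (fun k => by unfold poissonProfile; positivity) integral_poissonProfile
    tendsto_poissonProfile hFi hFc
  have key2 := (key.comp tendsto_inv_nhdsGT_zero).const_mul (2 * Real.pi ^ 2)
  rw [hF0] at key2
  refine key2.congr' ?_
  filter_upwards [self_mem_nhdsWithin] with ε hε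
  have hε' : 0 < ε := hε
  simp only [Function.comp_apply]
  rw [← integral_const_mul, absorptiveIntegral]
  refine integral_congr_ae ?_
  filter_upwards [hF, ae_ne_zero] with k hk hk0
  have hk' : 0 < ‖k‖ := norm_pos_iff.2 hk0
  have hpi := Real.pi_pos
  rw [hk, poissonProfile, finrank_euclideanSpace, Fintype.card_fin, norm_smul,
    Real.norm_of_nonneg (by positivity : 0 ≤ ε⁻¹), smul_eq_mul]
  field_simp
  ring

/-- The ball `|k| < ε` alone forces divergence. There `|g|² ≥ (γ/2)² |k|^(2p)`, the weight is at
least `1 / (β|k|)` and the kernel at least `1 / (2ε)`. Since `2p - 1 < 0`, `|k|^(2p-1) ≥ ε^(2p-1)`;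
with the volume of order `ε³` this gives `C ε^(2p+1)`, whose exponent is negative. -/
lemma tendsto_absorptiveIntegral_atTop (hβ : 0 < β)
    (hlim : Tendsto (fun k : R3 => ‖g k‖ / ‖k‖ ^ p) (𝓝[≠] 0) (𝓝 γ)) (hp : p < -1 / 2) (hγ : 0 < γ)
    (h : Integrable fun k => ‖g k‖ ^ 2 * cschWeight β k) :
    Tendsto (absorptiveIntegral g (cschWeight β)) (𝓝[>] 0) atTop := by
  have h1 := hlim.eventually (eventually_ge_nhds (b := γ / 2) (by linarith))
  have h2 := (tendsto_norm_mul_cschWeight hβ).eventually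
    (eventually_ge_nhds (b := 1 / β) (by gcongr; norm_num))
  have h3 := h1.and h2
  rw [eventually_nhdsWithin_iff, Metric.eventually_nhds_iff] at h3
  obtain ⟨δ, hδ, h3⟩ := h3
  let v : ℝ := (volume : Measure R3).real (Metric.ball 0 1)
  have hv : 0 < v := ENNReal.toReal_pos (Metric.measure_ball_pos _ _ one_pos).ne'
    measure_ball_lt_top.ne
  -- The lower bounds for `|g|²`, the weight and the kernel, times the volume of the unit ball.
  let C : ℝ := (γ / 2) ^ 2 * (1 / β) * (1 / 2) * v
  have hC : 0 < C := by positivity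
  have lower : ∀ ε : ℝ, 0 < ε → ε < δ →
      C * ε ^ (2 * p + 1) ≤ absorptiveIntegral g (cschWeight β) ε := by
    intro ε hε hεδ
    have hi := integrable_absorptive h hε.ne'
    have hnn : ∀ k, 0 ≤ ‖g k‖ ^ 2 * cschWeight β k * (ε / (‖k‖ ^ 2 + ε ^ 2)) := fun k => by
      have := cschWeight_nonneg (β := β) k
      positivity
    have hvol : (volume : Measure R3).real (Metric.ball 0 ε) = ε ^ 3 * v := by
      rw [Measure.real, Measure.addHaar_ball _ _ hε.le, finrank_euclideanSpace, Fintype.card_fin,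
        ENNReal.toReal_mul, ENNReal.toReal_ofReal (by positivity)]
      rfl
    have hsub : C * ε ^ (2 * p + 1) =
        ∫ _ in Metric.ball (0 : R3) ε,
          (γ / 2) ^ 2 * (1 / β) * (1 / 2) * (ε ^ (2 * p - 1) * ε⁻¹) := by
      rw [setIntegral_const, hvol, smul_eq_mul]
      have : ε ^ (2 * p + 1) = ε ^ (2 * p - 1) * ε ^ 2 := by
        rw [← Real.rpow_natCast, ← Real.rpow_add hε]
        norm_num
        ring_nf
      rw [this]
      simp only [C]
      field_simp
    rw [hsub]
    refine le_trans ?_ (setIntegral_le_integral hi (ae_of_all _ hnn) (s := Metric.ball 0 ε))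
    refine setIntegral_mono_ae_restrict (integrableOn_const measure_ball_lt_top.ne) hi.integrableOn ?_
    filter_upwards [ae_restrict_mem measurableSet_ball, ae_restrict_of_ae ae_ne_zero] with k hk hk0
    have hk' : 0 < ‖k‖ := norm_pos_iff.2 hk0
    have hkε : ‖k‖ < ε := by simpa using hk
    obtain ⟨a1, a2⟩ := h3 (y := k) (by simpa using hkε.trans hεδ) hk0
    rw [le_div_iff₀ (by positivity)] at a1
    have b1 : (γ / 2) ^ 2 * (‖k‖ ^ p) ^ 2 ≤ ‖g k‖ ^ 2 := by
      rw [← mul_pow]; gcongr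
    have b2 : 1 / β * ‖k‖⁻¹ ≤ cschWeight β k := by
      rw [← div_eq_mul_inv, div_le_iff₀ hk', mul_comm]
      exact a2
    have b3 : 1 / 2 * ε⁻¹ ≤ ε / (‖k‖ ^ 2 + ε ^ 2) := by
      rw [le_div_iff₀ (by positivity)]
      field_simp
      nlinarith
    have b4 : ε ^ (2 * p - 1) ≤ (‖k‖ ^ p) ^ 2 * ‖k‖⁻¹ := by
      have : (‖k‖ ^ p) ^ 2 * ‖k‖⁻¹ = ‖k‖ ^ (2 * p - 1) := by
        rw [← Real.rpow_natCast, ← Real.rpow_mul hk'.le, ← Real.rpow_neg_one, ← Real.rpow_add hk']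
        norm_num
        ring_nf
      rw [this]
      exact Real.rpow_le_rpow_of_nonpos hk' hkε.le (by linarith)
    calc (γ / 2) ^ 2 * (1 / β) * (1 / 2) * (ε ^ (2 * p - 1) * ε⁻¹)
        ≤ (γ / 2) ^ 2 * (1 / β) * (1 / 2) * ((‖k‖ ^ p) ^ 2 * ‖k‖⁻¹ * ε⁻¹) := by gcongr
      _ = ((γ / 2) ^ 2 * (‖k‖ ^ p) ^ 2) * (1 / β * ‖k‖⁻¹) * (1 / 2 * ε⁻¹) := by ring
      _ ≤ _ := by
        have := cschWeight_nonneg (β := β) k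
        gcongr
  have htop : Tendsto (fun ε : ℝ => C * ε ^ (2 * p + 1)) (𝓝[>] 0) atTop :=
    (tendsto_rpow_neg_nhdsGT_zero (by linarith)).const_mul_atTop hC
  refine tendsto_atTop_mono' _ ?_ htop
  filter_upwards [self_mem_nhdsWithin, Ioo_mem_nhdsGT hδ] with ε hε hεδ
  exact lower ε hε hεδ.2

end Limits

/-! ### The level shift operator -/

section Conclusion

variable {ι : Type} [Fintype ι] [DecidableEq ι] {G : Matrix ι ι ℂ} {β : ℝ} {g : R3 → ℂ}

lemma matOp_mul (A B : Matrix (ι × ι) (ι × ι) ℂ) (u : KK ι) :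
    matOp (A * B) u = matOp A (matOp B u) := by
  rw [matOp, map_mul]
  rfl

/-- `G ⊗ 1` and `1 ⊗ 𝒞G𝒞` are Hermitian and commute, so one factor of each product moves to the left
entry. This brings the matrix into the shape of `lamForm_eq`. -/
lemma inner_shiftMatrix (hG : G.IsHermitian) (ξ η : ℝ) (u w : KK ι) :
    ⟪u, matOp (shiftMatrix G ξ η) w⟫_ℂ =
      (ξ + Complex.I * η) *
          ⟪matOp (G ⊗ₖ (1 : Matrix ι ι ℂ)) u, matOp (G ⊗ₖ (1 : Matrix ι ι ℂ)) w⟫_ℂ -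
        (ξ - Complex.I * η) * ⟪matOp ((1 : Matrix ι ι ℂ) ⊗ₖ G.map conj) u,
            matOp ((1 : Matrix ι ι ℂ) ⊗ₖ G.map conj) w⟫_ℂ -
        Complex.I * η *
          (⟪matOp (G ⊗ₖ (1 : Matrix ι ι ℂ)) u, matOp ((1 : Matrix ι ι ℂ) ⊗ₖ G.map conj) w⟫_ℂ +
          ⟪matOp ((1 : Matrix ι ι ℂ) ⊗ₖ G.map conj) u,
            matOp (G ⊗ₖ (1 : Matrix ι ι ℂ)) w⟫_ℂ) := by
  have hL := isHermitian_kronecker_one hG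
  have hR := isHermitian_one_kronecker hG
  have e1 : (G ^ 2) ⊗ₖ (1 : Matrix ι ι ℂ) =
      (G ⊗ₖ (1 : Matrix ι ι ℂ)) * (G ⊗ₖ (1 : Matrix ι ι ℂ)) := by
    rw [← Matrix.mul_kronecker_mul, pow_two, mul_one]
  have e2 : (1 : Matrix ι ι ℂ) ⊗ₖ (G ^ 2).map conj =
      ((1 : Matrix ι ι ℂ) ⊗ₖ G.map conj) * ((1 : Matrix ι ι ℂ) ⊗ₖ G.map conj) := by
    rw [← Matrix.mul_kronecker_mul, pow_two, mul_one, Matrix.map_mul]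
  have e3 : G ⊗ₖ G.map conj = (G ⊗ₖ (1 : Matrix ι ι ℂ)) * ((1 : Matrix ι ι ℂ) ⊗ₖ G.map conj) := by
    rw [← Matrix.mul_kronecker_mul, mul_one, one_mul]
  -- The same matrix factored in the other order: the mixed term is split evenly between the two
  -- orders.
  have e4 : G ⊗ₖ G.map conj = ((1 : Matrix ι ι ℂ) ⊗ₖ G.map conj) * (G ⊗ₖ (1 : Matrix ι ι ℂ)) := by
    rw [← Matrix.mul_kronecker_mul, mul_one, one_mul]
  simp only [← inner_matOp hL, ← inner_matOp hR, ← matOp_mul]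
  rw [← e1, ← e2, ← e3, ← e4, shiftMatrix]
  have h : matOp (((ξ : ℂ) + Complex.I * η) • ((G ^ 2) ⊗ₖ (1 : Matrix ι ι ℂ))
      - ((ξ : ℂ) - Complex.I * η) • ((1 : Matrix ι ι ℂ) ⊗ₖ (G ^ 2).map conj)
      - (2 * Complex.I * η) • (G ⊗ₖ G.map conj)) w =
      ((ξ : ℂ) + Complex.I * η) • matOp ((G ^ 2) ⊗ₖ (1 : Matrix ι ι ℂ)) w -
      ((ξ : ℂ) - Complex.I * η) • matOp ((1 : Matrix ι ι ℂ) ⊗ₖ (G ^ 2).map conj) w -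
      (2 * Complex.I * η) • matOp (G ⊗ₖ G.map conj) w := by
    simp only [matOp, map_sub, map_smul]
    rfl
  rw [h, inner_sub_right, inner_sub_right, inner_smul_right, inner_smul_right, inner_smul_right]
  ring

lemma tendsto_lamForm (e : ℝ) (hG : G.IsHermitian) (hβ : 0 < β) (hg : MemLp g 2 volume)
    (h1 : Integrable fun k => ‖g k‖ ^ 2 * cothWeight β k) {ξ η : ℝ}
    (hN : Tendsto (dispersiveIntegral g) (𝓝[>] 0) (𝓝 (2 * ξ)))
    (hM1 : Tendsto (absorptiveIntegral g (cothWeight β)) (𝓝[>] 0) (𝓝 (2 * η)))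
    (hM2 : Tendsto (absorptiveIntegral g (cschWeight β)) (𝓝[>] 0) (𝓝 (2 * η))) (u w : KK ι) :
    Tendsto (fun ε => lamForm (fun _ : ι => e) G β g 0 ε u w) (𝓝[>] 0)
      (𝓝 ⟪u, matOp (shiftMatrix G ξ η) w⟫_ℂ) := by
  have hN' := (Complex.continuous_ofReal.tendsto _).comp hN
  have hM1' := ((Complex.continuous_ofReal.tendsto _).comp hM1).const_mul Complex.I
  have hM2' := ((Complex.continuous_ofReal.tendsto _).comp hM2).const_mul Complex.I
  have h := (((((hN'.add hM1').mul_const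
      ⟪matOp (G ⊗ₖ (1 : Matrix ι ι ℂ)) u, matOp (G ⊗ₖ (1 : Matrix ι ι ℂ)) w⟫_ℂ).add
    ((hN'.neg.add hM1').mul_const ⟪matOp ((1 : Matrix ι ι ℂ) ⊗ₖ G.map conj) u,
            matOp ((1 : Matrix ι ι ℂ) ⊗ₖ G.map conj) w⟫_ℂ)).sub
    (hM2'.mul_const
      (⟪matOp (G ⊗ₖ (1 : Matrix ι ι ℂ)) u, matOp ((1 : Matrix ι ι ℂ) ⊗ₖ G.map conj) w⟫_ℂ +
          ⟪matOp ((1 : Matrix ι ι ℂ) ⊗ₖ G.map conj) u,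
            matOp (G ⊗ₖ (1 : Matrix ι ι ℂ)) w⟫_ℂ)))).const_mul (1 / 2 : ℂ)
  have hlimit : ∀ {a b : ℂ} {f : ℝ → ℂ}, Tendsto f (𝓝[>] 0) (𝓝 a) → a = b →
      Tendsto f (𝓝[>] 0) (𝓝 b) := fun hf hab => hab ▸ hf
  refine (hlimit h ?_).congr' ?_
  · rw [inner_shiftMatrix hG]
    push_cast
    ring
  · filter_upwards [self_mem_nhdsWithin] with ε hε
    exact (lamForm_eq e hG hβ hg (memLp_gPlus hβ hg h1) (memLp_gMinus hβ hg h1) h1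
      (ne_of_gt hε) u w).symm

lemma exists_levelShiftOperator (e : ℝ) (S : Matrix (ι × ι) (ι × ι) ℂ)
    (h : ∀ u w : KK ι, Tendsto (fun ε => lamForm (fun _ : ι => e) G β g 0 ε u w) (𝓝[>] 0)
      (𝓝 ⟪u, matOp S w⟫_ℂ)) :
    ∃ T : eigS (fun _ : ι => e) 0 →ₗ[ℂ] eigS (fun _ : ι => e) 0,
      IsLevelShiftOperator (fun _ => e) G β g 0 T ∧
        ∀ v : eigS (fun _ : ι => e) 0, (T v : KK ι) = matOp S v := by
  refine ⟨(matOp S).toLinearMap.restrict (fun v _ => ?_), fun u w => h u w, fun v => rfl⟩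
  rw [eigS_const]
  trivial

lemma absorptiveIntegral_csch_le_coth (hβ : 0 < β) (hg : MemLp g 2 volume)
    (h1 : Integrable fun k => ‖g k‖ ^ 2 * cothWeight β k) {ε : ℝ} (hε : 0 < ε) :
    absorptiveIntegral g (cschWeight β) ε ≤ absorptiveIntegral g (cothWeight β) ε := by
  refine integral_mono (integrable_absorptive (integrable_cschWeight hβ hg h1) hε.ne')
    (integrable_absorptive h1 hε.ne') fun k => ?_
  simp only
  gcongr
  exact cschWeight_le_cothWeight hβ k

/-- On the diagonal the dispersive terms are real. The imaginary part is `½ (M₁ (‖a‖² + ‖b‖²) - 2 M₂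
Re ⟪a, b⟫)`, and replacing `M₁` by the smaller `M₂` completes the square. -/
lemma absorptiveIntegral_csch_mul_le_im_lamForm (e : ℝ) (hG : G.IsHermitian) (hβ : 0 < β)
    (hg : MemLp g 2 volume) (h1 : Integrable fun k => ‖g k‖ ^ 2 * cothWeight β k) {ε : ℝ}
    (hε : 0 < ε) (u : KK ι) :
    absorptiveIntegral g (cschWeight β) ε *
        (1 / 2 * ‖matOp (G ⊗ₖ (1 : Matrix ι ι ℂ)) u -
          matOp ((1 : Matrix ι ι ℂ) ⊗ₖ G.map conj) u‖ ^ 2) ≤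
      (lamForm (fun _ : ι => e) G β g 0 ε u u).im := by
  rw [lamForm_eq e hG hβ hg (memLp_gPlus hβ hg h1) (memLp_gMinus hβ hg h1) h1 hε.ne']
  have hle := absorptiveIntegral_csch_le_coth hβ hg h1 hε
  generalize matOp (G ⊗ₖ (1 : Matrix ι ι ℂ)) u = a
  generalize matOp ((1 : Matrix ι ι ℂ) ⊗ₖ G.map conj) u = b
  generalize absorptiveIntegral g (cschWeight β) ε = M2 at *
  generalize absorptiveIntegral g (cothWeight β) ε = M1 at *
  have hsq := norm_sub_sq (𝕜 := ℂ) a b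
  have hab : ⟪a, b⟫_ℂ + ⟪b, a⟫_ℂ = ((2 * (⟪a, b⟫_ℂ).re : ℝ) : ℂ) := by
    rw [← inner_conj_symm b a, Complex.add_conj]
  rw [hab, inner_self_eq_norm_sq_to_K, inner_self_eq_norm_sq_to_K, hsq]
  have e2 : (1 / 2 : ℂ) = ((1 / 2 : ℝ) : ℂ) := by norm_num
  rw [e2, Complex.im_ofReal_mul]
  simp only [Complex.coe_algebraMap, ← Complex.ofReal_pow, Complex.sub_im, Complex.add_im,
    Complex.im_mul_ofReal, Complex.neg_im, Complex.ofReal_im, Complex.I_im, RCLike.re_to_complex]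
  nlinarith [mul_nonneg (sub_nonneg.2 hle) (add_nonneg (sq_nonneg ‖a‖) (sq_nonneg ‖b‖))]

lemma exists_matOp_ne {G : Matrix (Fin 2) (Fin 2) ℂ}
    (hG : ∀ c : ℂ, G ≠ c • (1 : Matrix (Fin 2) (Fin 2) ℂ)) :
    ∃ u : KK (Fin 2), matOp (G ⊗ₖ (1 : Matrix (Fin 2) (Fin 2) ℂ)) u ≠
      matOp ((1 : Matrix (Fin 2) (Fin 2) ℂ) ⊗ₖ G.map conj) u := by
  by_contra hcon
  push Not at hcon
  have h : G ⊗ₖ (1 : Matrix (Fin 2) (Fin 2) ℂ) = (1 : Matrix (Fin 2) (Fin 2) ℂ) ⊗ₖ G.map conj := by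
    refine (Matrix.toEuclideanCLM (𝕜 := ℂ) (n := Fin 2 × Fin 2)).injective ?_
    exact ContinuousLinearMap.ext hcon
  have h' : ∀ i j k l, G i k * (1 : Matrix (Fin 2) (Fin 2) ℂ) j l =
      (1 : Matrix (Fin 2) (Fin 2) ℂ) i k * conj (G j l) := fun i j k l =>
    congrFun (congrFun h (i, j)) (k, l)
  refine hG (G 0 0) ?_
  -- These entries give in turn `G₀₁ = 0`, `G₁₀ = 0`, `G₀₀ = conj G₀₀` and `G₁₁ = conj G₀₀`.
  have a1 := h' 0 0 1 0
  have a2 := h' 1 0 0 0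
  have a3 := h' 0 0 0 0
  have a4 := h' 1 0 1 0
  simp at a1 a2 a3 a4
  ext i j
  fin_cases i <;> fin_cases j
  · simp
  · simp [a1]
  · simp [a2]
  · simp [a4, ← a3]

end Conclusion

end LevelShift

end
open LevelShift

theorem theorem3p2 (e : ℝ) (G : Matrix (Fin 2) (Fin 2) ℂ) (hG : G.IsHermitian)
    (β : ℝ) (hβ : 0 < β)
    (g : R3 → ℂ) (hgL2 : MemLp g 2 volume) (hgcont : ContinuousOn g {0}ᶜ)
    (hgsupp : HasCompactSupport g)
    (p γ : ℝ) (hp : -1 < p)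
    (hlim : Tendsto (fun k : R3 => ‖g k‖ / ‖k‖ ^ p) (𝓝[≠] 0) (𝓝 γ))
    (E : Fin 2 → ℝ) (hE : E = fun _ => e)
    (ξ η : ℝ) (hξ : ξ = (∫ k : R3, ‖g k / (√‖k‖ : ℝ)‖ ^ 2) / 2)
    (hη : η = 2 * Real.pi ^ 2 * γ ^ 2 / β) :
    Module.finrank ℂ (LinearMap.range (P E 0).toLinearMap) = 4 ∧
    (∀ ε : ℝ, ε ≠ 0 → (Lam E G β g 0 ε).domain = ⊤) ∧
    (p < -1 / 2 → 0 < γ → (∀ c : ℂ, G ≠ c • (1 : Matrix (Fin 2) (Fin 2) ℂ)) →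
      ¬ ∃ T : eigS E 0 →ₗ[ℂ] eigS E 0, IsLevelShiftOperator E G β g 0 T) ∧
    (p = -1 / 2 → ∃ T : eigS E 0 →ₗ[ℂ] eigS E 0, IsLevelShiftOperator E G β g 0 T ∧
      ∀ v : eigS E 0, (T v : KK (Fin 2)) = matOp (shiftMatrix G ξ η) v) ∧
    (-1 / 2 < p → ∃ T : eigS E 0 →ₗ[ℂ] eigS E 0, IsLevelShiftOperator E G β g 0 T ∧
      ∀ v : eigS E 0, (T v : KK (Fin 2)) = matOp (shiftMatrix G ξ 0) v) := by
  subst hE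
  have h1 := integrable_cothWeight hβ hgL2 hlim hp
  have h2 := integrable_cschWeight hβ hgL2 h1
  have hP := memLp_gPlus hβ hgL2 h1
  have hM := memLp_gMinus hβ hgL2 h1
  have hN : Tendsto (dispersiveIntegral g) (𝓝[>] 0) (𝓝 (2 * ξ)) := by
    have := tendsto_dispersiveIntegral hgL2 (integrable_sq_norm_mul_inv hgL2 hlim hp)
    rwa [hξ, mul_div_cancel₀ _ two_ne_zero]
  refine ⟨by rw [finrank_range_P]; simp, fun ε hε => Lam_domain e hG hP hM hε, ?_, ?_, ?_⟩
  · rintro hp' hγ hGc ⟨T, hT⟩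
    obtain ⟨u, hu⟩ := exists_matOp_ne hGc
    have hpos : 0 < 1 / 2 * ‖matOp (G ⊗ₖ (1 : Matrix (Fin 2) (Fin 2) ℂ)) u -
        matOp ((1 : Matrix (Fin 2) (Fin 2) ℂ) ⊗ₖ G.map conj) u‖ ^ 2 := by
      have := norm_pos_iff.2 (sub_ne_zero.2 hu)
      positivity
    have hmem : u ∈ eigS (fun _ : Fin 2 => e) 0 := by rw [eigS_const]; trivial
    -- A level shift operator would make the imaginary part of this diagonal element converge, yet
    -- it dominates a positive multiple of a divergent integral.
    have hlimit := (Complex.continuous_im.tendsto _).comp (hT ⟨u, hmem⟩ ⟨u, hmem⟩)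
    have htop := (tendsto_absorptiveIntegral_atTop hβ hlim hp' hγ h2).atTop_mul_const hpos
    refine not_tendsto_nhds_of_tendsto_atTop (tendsto_atTop_mono' _ ?_ htop) _ hlimit
    filter_upwards [self_mem_nhdsWithin] with ε hε
    exact absorptiveIntegral_csch_mul_le_im_lamForm e hG hβ hgL2 h1 hε u
  · rintro rfl
    -- The constant `c` of `tendsto_absorptiveIntegral_critical` is `2 / β` for both weights.
    have hc : 2 * Real.pi ^ 2 * (γ ^ 2 * (2 / β)) = 2 * η := by rw [hη]; ring
    have hM1 := tendsto_absorptiveIntegral_critical hgsupp hlim h1 (tendsto_norm_mul_cothWeight hβ)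
    have hM2 := tendsto_absorptiveIntegral_critical hgsupp hlim h2 (tendsto_norm_mul_cschWeight hβ)
    rw [hc] at hM1 hM2
    exact exists_levelShiftOperator e _ (tendsto_lamForm e hG hβ hgL2 h1 hN hM1 hM2)
  · intro hp'
    have h1' := integrable_cothWeight_mul_inv hβ hgL2 hlim hp'
    have hM1 := tendsto_absorptiveIntegral_zero h1 (cothWeight_nonneg hβ) h1'
    have hM2 := tendsto_absorptiveIntegral_zero h2 cschWeight_nonneg
      (integrable_cschWeight_mul_inv hβ hgL2 h1')
    refine exists_levelShiftOperator e _ (tendsto_lamForm e hG hβ hgL2 h1 hN ?_ ?_)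
    · rwa [mul_zero]
    · rwa [mul_zero]
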